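/- **Theorem.** Consider randomized black-box algorithms in the following unit-cost model. An algorithm is a WHILE program whose data are finite binary trees with leaves that are nil or field elements. It may form pairs and take them apart, add, subtract, multiply and invert field elements (with $0^{-1}=0$), test whether a field element is zero, test for nil, query a polynomial at a point, and draw a fresh independent uniform element of a finite sample set $S$. Each of these operations takes one unit of time. The program is fixed and does not depend on the field, on $S$ or on the parameters; its input consists of $n,d,w$ in unary, and its output is a list of $n$ indices in unary. For a field $\mathbb{F}$, positive integers $n,d,w$, a permutation $\sigma\in S_n$ and a finite nonempty set $S\subseteq\mathbb{F}$, let $\mathcal{P}_{S,n,d,w,\sigma}$ be the random polynomial $$\Big(\prod_{i=1}^{n}\sum_{j=0}^{d}\mathcal{A}_{i,j}\,x_{\sigma(i)}^{j}\Big)[1,1],$$ where the entries of the matrices $\mathcal{A}_{i,j}\in\mathbb{F}^{w\times w}$ are drawn independently and uniformly from $S$ (and the factors are multiplied in the order $i=1,\dots,n$). An ROABP of individual degree at most $d$ in the order $\tau\in S_n$ is a layered directed graph with layers $0,\dots,n$, whose first and last layers are single vertices (source and sink) and whose edges between layers $i-1$ and $i$ carry univariate polynomials of degree at most $d$ in $x_{\tau(i)}$.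 It computes the sum, over all source–sink paths, of the products of the edge weights, and its width is the largest number of vertices in a layer. There are a randomized black-box algorithm $R$ and a constant $C\in\mathbb{N}$ such that the following holds for every field $\mathbb{F}$, all positive integers $n,d,w$ with $n\ge 3\log_{d+1}w$, every $\sigma\in S_n$, and every finite $S\subseteq\mathbb{F}$ with $|S|\ge 2^{2n+1}\cdot n\,d\,w^2$. Given $n,d,w$, black-box access to $f\sim\mathcal{P}_{S,n,d,w,\sigma}$, and random draws from $S$, with probability at least $1-2^{-(n-1)}$ over $f$ and the independent internal randomness of $R$, the algorithm $R$ outputs some $\tau\in S_n$ such that $f$ has an ROABP of width at most $w$ and individual degree at most $d$ in the order $\tau$, and it halts within time $$C\cdot n^{C\,(1+\log_{d+1}w)}\cdot (d\,w)^{C},$$ that is, in time $n^{O(1+\log_{d+1}w)}\cdot\mathrm{poly}(d,w)=\mathrm{poly}(n,d,w)\cdot n^{O(\log_{d+1}w)}$. -/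

import Mathlib

open MeasureTheory

universe u

namespace OrderFinding

/-! ### Read-once oblivious algebraic branching programs -/

/-- A layered directed graph with layers `0, …, n` (layer `i` has `layer i` vertices, the first and
the last layer are single vertices), whose edges between layers `i` and `i + 1` carry
univariate polynomials of degree at most `d` (an absent edge has weight `0`). -/
structure ROABP (F : Type u) [Field F] (n d : ℕ) where
  layer : Fin (n + 1) → ℕ
  layer_source : layer 0 = 1
  layer_sink : layer (Fin.last n) = 1
  weight : (i : Fin n) → Fin (layer i.castSucc) → Fin (layer i.succ) → Polynomial F
  natDegree_weight_le : ∀ i a b, (weight i a b).natDegree ≤ d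

/-- The polynomial computed when the program reads the variables in the order
`σ 0, σ 1, …, σ (n - 1)`: the sum over all source-sink paths of the product of the edge weights,
the weights between layers `i` and `i + 1` being polynomials in the variable `σ i`. -/
noncomputable def ROABP.poly {F : Type u} [Field F] {n d : ℕ} (P : ROABP F n d)
    (σ : Equiv.Perm (Fin n)) : MvPolynomial (Fin n) F :=
  ∑ p : ((i : Fin (n + 1)) → Fin (P.layer i)),
    ∏ i : Fin n, Polynomial.aeval (MvPolynomial.X (σ i) : MvPolynomial (Fin n) F)
      (P.weight i (p i.castSucc) (p i.succ))

/-- `f` is computed in the order `σ` by an ROABP of width at most `w` with edge weights of degree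
at most `d`. -/
def HasROABP {F : Type u} [Field F] {n : ℕ} (d w : ℕ) (σ : Equiv.Perm (Fin n))
    (f : MvPolynomial (Fin n) F) : Prop :=
  ∃ P : ROABP F n d, (∀ i, P.layer i ≤ w) ∧ P.poly σ = f

/-! ### Random ROABPs -/

/-- One draw from the finite set `S`. -/
def Draw {F : Type u} (S : Finset F) : Type u := {x : F // x ∈ S}

instance {F : Type u} (S : Finset F) : Fintype (Draw S) := inferInstanceAs (Fintype {x // x ∈ S})

instance {F : Type u} (S : Finset F) : MeasurableSpace (Draw S) := ⊤

theorem Draw.nonempty {F : Type u} {S : Finset F} (hS : S.Nonempty) : Nonempty (Draw S) :=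
  let ⟨x, hx⟩ := hS
  ⟨⟨x, hx⟩⟩

/-- The uniform distribution on `S`. -/
noncomputable def uniform {F : Type u} (S : Finset F) (hS : S.Nonempty) : Measure (Draw S) :=
  haveI : Nonempty (Draw S) := Draw.nonempty hS
  (PMF.uniformOfFintype (Draw S)).toMeasure

instance {F : Type u} (S : Finset F) (hS : S.Nonempty) : IsProbabilityMeasure (uniform S hS) := by
  unfold uniform; infer_instance

/-- The entries of the `w × w` coefficient matrices `A i j`, `i < n`, `j ≤ d`, drawn from `S`. -/
abbrev Entries {F : Type u} (S : Finset F) (n d w : ℕ) : Type u :=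
  Fin n × Fin (d + 1) × Fin w × Fin w → Draw S

/-- The polynomial `(∏ i, ∑ j, A i j * x_{σ i} ^ j)[1, 1]`. -/
noncomputable def randomPoly {F : Type u} [Field F] {S : Finset F} {n d w : ℕ} (hw : 0 < w)
    (σ : Equiv.Perm (Fin n)) (A : Entries S n d w) : MvPolynomial (Fin n) F :=
  (List.ofFn fun i : Fin n =>
    (Matrix.of fun a b : Fin w => ∑ j : Fin (d + 1),
      MvPolynomial.C (A (i, j, a, b)).1 * MvPolynomial.X (σ i) ^ (j : ℕ))).prod ⟨0, hw⟩ ⟨0, hw⟩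

/-- The joint law of the independent uniform matrix entries and of an infinite tape of further
independent uniform draws from `S`, the internal randomness of the algorithm. -/
noncomputable def law {F : Type u} (S : Finset F) (hS : S.Nonempty) (n d w : ℕ) :
    Measure (Entries S n d w × (ℕ → Draw S)) :=
  (Measure.pi fun _ => uniform S hS).prod (Measure.infinitePi fun _ => uniform S hS)

/-! ### Randomized black-box algorithms

Algorithms are programs of a WHILE language whose data are binary trees with field elements at the
leaves. One program serves for all fields: field elements can be added, subtracted, multiplied,
inverted and tested for being zero, and nothing else. Every elementary operation, every query to
the black box and every random draw takes one unit of time. -/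

/-- Data: binary trees whose leaves are `nil` or field elements. -/
inductive Val (F : Type u) : Type u
  | nil : Val F
  | fld (a : F) : Val F
  | cons (x y : Val F) : Val F

namespace Val

variable {F : Type u}

def hd : Val F → Val F
  | cons x _ => x
  | _ => nil

def tl : Val F → Val F
  | cons _ y => y
  | _ => nil

/-- The field element at a leaf; other trees are read as `0`. -/
def toField [Zero F] : Val F → F
  | fld a => a
  | _ => 0

/-- The list `[v₀, …, vₘ]` as the tree `cons v₀ (… (cons vₘ nil))`. -/
def ofList : List (Val F) → Val F
  | [] => nil
  | v :: l => cons v (ofList l)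

/-- Natural numbers in unary: lists of `nil`s. -/
def num (k : ℕ) : Val F := ofList (List.replicate k nil)

/-- The `i`-th entry of a list. -/
def entry (v : Val F) (i : ℕ) : Val F := (tl^[i] v).hd

/-- An order of the variables as the list of the numerals `σ 0, …, σ (n - 1)`. -/
def ofPerm {n : ℕ} (σ : Equiv.Perm (Fin n)) : Val F :=
  ofList (List.ofFn fun i => num (σ i : ℕ))

end Val

/-- Expressions; variables are numbered. -/
inductive Expr : Type
  | var (x : ℕ)
  | nil
  | cons (e₁ e₂ : Expr)
  | hd (e : Expr)
  | tl (e : Expr)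
  | zero
  | one
  | add (e₁ e₂ : Expr)
  | sub (e₁ e₂ : Expr)
  | mul (e₁ e₂ : Expr)
  | inv (e : Expr)
  | isZero (e : Expr)

/-- The number of operations in an expression, which is the time its evaluation takes. -/
def Expr.cost : Expr → ℕ
  | var _ | nil | zero | one => 1
  | hd e | tl e | inv e | isZero e => e.cost + 1
  | cons e₁ e₂ | add e₁ e₂ | sub e₁ e₂ | mul e₁ e₂ => e₁.cost + e₂.cost + 1

open Classical in
/-- The value of an expression. The test `isZero` yields a tree different from `nil` for true and
`nil` for false. -/
noncomputable def Expr.eval {F : Type u} [Field F] (s : ℕ → Val F) : Expr → Val F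
  | var x => s x
  | nil => .nil
  | cons e₁ e₂ => .cons (e₁.eval s) (e₂.eval s)
  | hd e => (e.eval s).hd
  | tl e => (e.eval s).tl
  | zero => .fld 0
  | one => .fld 1
  | add e₁ e₂ => .fld ((e₁.eval s).toField + (e₂.eval s).toField)
  | sub e₁ e₂ => .fld ((e₁.eval s).toField - (e₂.eval s).toField)
  | mul e₁ e₂ => .fld ((e₁.eval s).toField * (e₂.eval s).toField)
  | inv e => .fld (e.eval s).toField⁻¹
  | isZero e => if (e.eval s).toField = 0 then .cons .nil .nil else .nil

/-- Programs. `sample x` stores a random draw in `x`; `query x e` stores in `x` the answer of the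
black box to the point `e`. -/
inductive Prog : Type
  | assign (x : ℕ) (e : Expr)
  | sample (x : ℕ)
  | query (x : ℕ) (e : Expr)
  | seq (c₁ c₂ : Prog)
  | ite (e : Expr) (c₁ c₂ : Prog)
  | while (e : Expr) (c : Prog)

/-- A state: the contents of the variables and the position on the random tape. -/
structure State (F : Type u) where
  store : ℕ → Val F
  pos : ℕ

def State.set {F : Type u} (s : State F) (x : ℕ) (v : Val F) : State F :=
  ⟨Function.update s.store x v, s.pos⟩

/-- `Exec q ρ c s s' t`: with the black box `q` and the random tape `ρ`, the program `c` started in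
the state `s` halts in the state `s'` after time `t`. Conditions are true unless they are `nil`. -/
inductive Exec {F : Type u} [Field F] (q : Val F → F) (ρ : ℕ → F) :
    Prog → State F → State F → ℕ → Prop
  | assign (x : ℕ) (e : Expr) (s : State F) :
      Exec q ρ (.assign x e) s (s.set x (e.eval s.store)) (e.cost + 1)
  | sample (x : ℕ) (s : State F) :
      Exec q ρ (.sample x) s ⟨Function.update s.store x (.fld (ρ s.pos)), s.pos + 1⟩ 1
  | query (x : ℕ) (e : Expr) (s : State F) :
      Exec q ρ (.query x e) s (s.set x (.fld (q (e.eval s.store)))) (e.cost + 1)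
  | seq {c₁ c₂ : Prog} {s s' s'' : State F} {t₁ t₂ : ℕ} :
      Exec q ρ c₁ s s' t₁ → Exec q ρ c₂ s' s'' t₂ → Exec q ρ (.seq c₁ c₂) s s'' (t₁ + t₂)
  | ite_true {e : Expr} {c₁ c₂ : Prog} {s s' : State F} {t : ℕ} :
      e.eval s.store ≠ .nil → Exec q ρ c₁ s s' t → Exec q ρ (.ite e c₁ c₂) s s' (e.cost + 1 + t)
  | ite_false {e : Expr} {c₁ c₂ : Prog} {s s' : State F} {t : ℕ} :
      e.eval s.store = .nil → Exec q ρ c₂ s s' t → Exec q ρ (.ite e c₁ c₂) s s' (e.cost + 1 + t)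
  | while_true {e : Expr} {c : Prog} {s s' s'' : State F} {t₁ t₂ : ℕ} :
      e.eval s.store ≠ .nil → Exec q ρ c s s' t₁ → Exec q ρ (.while e c) s' s'' t₂ →
      Exec q ρ (.while e c) s s'' (e.cost + 1 + t₁ + t₂)
  | while_false {e : Expr} {c : Prog} {s : State F} :
      e.eval s.store = .nil → Exec q ρ (.while e c) s s (e.cost + 1)

/-- The black box for `f`: a list of field elements is answered by the value of `f` at the point
with these coordinates. -/
noncomputable def blackBox {F : Type u} [Field F] {n : ℕ} (f : MvPolynomial (Fin n) F)
    (v : Val F) : F :=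
  MvPolynomial.eval (fun i : Fin n => (v.entry i).toField) f

/-- Initially variable `0` holds the list of the parameters `n`, `d`, `w`, and all others `nil`. -/
def initial (F : Type u) (n d w : ℕ) : State F :=
  ⟨Function.update (fun _ => .nil) 0 (.ofList [.num n, .num d, .num w]), 0⟩

/-- On the parameters `n, d, w`, the black box for `f` and the random tape `ρ`, the program `R`
halts after time `t` with the order `τ` as its output (the final value of variable `0`). -/
def Outputs {F : Type u} [Field F] {n : ℕ} (R : Prog) (d w : ℕ) (f : MvPolynomial (Fin n) F)
    (ρ : ℕ → F) (τ : Equiv.Perm (Fin n)) (t : ℕ) : Prop :=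
  ∃ s : State F, Exec (blackBox f) ρ R (initial F n d w) s t ∧ s.store 0 = .ofPerm τ

end OrderFinding

/-!
The algorithm builds the order one variable at a time and recognizes the prefixes of a good order
by their rank. For a set `T` of variables consider the rank of `f` across the partition into `T`
and its complement (`SepRankLE`). By Nisan's characterization (`hasROABP_of_sepRankLE`) `f` has a
program of width `w` in the order `τ` as soon as the rank across every prefix of `τ` is at most
`w`, so it suffices to find an order with this property by means of a test for the rank.

Across some partitions the rank is at most `w` whatever the matrices are (`LowRankPartition`):
those with at most `log_{d+1} w` variables on one side, those of which one side is a prefix of the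
hidden order `σ`, and all partitions if `w = 1`. Across every other partition the rank is larger
than `w` for suitable matrices (`exists_identity_of_not_lowRankPartition`). Indeed three variables
then alternate between the two sides in the order `σ`. This allows just enough variables of the
two sides to be matched in such a way that no prefix of `σ` separates all pairs, and the
polynomial that tests the equality of all pairs has rank at most `w` across the prefixes of `σ`,
hence a program of width `w` in the order `σ`, while it has rank larger than `w` across the given
partition. A variant of the argument covers the case `w < d + 1`.

The test draws `w + 1` points for the variables in `T` and `w + 1` points for the others,
evaluates `f` at all combinations, and looks for a zero pivot in the resulting matrix by
elimination without pivoting. If the rank is at most `w` the matrix is singular and `T` is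
accepted (`SepRankLE.passes`). If the partition is not of low rank, then the product of the
leading minors is a nonzero polynomial in the matrix entries and the draws, of degree `O(n d w²)`,
and by the Schwartz-Zippel lemma it vanishes with small probability. Elimination without pivoting
is enough here because all leading minors are made nonzero at once. Since the same points serve
for all sets, the union bound over the `2 ^ n` sets shows that with probability at least
`1 - 2 ^ (-(n - 1))` the test accepts exactly the partitions of low rank (`le_law_testSound`).

Given this event, a depth-first search over the sequences all of whose sets are accepted succeeds.
It does not run out of nodes, because the prefixes of `σ` are accepted, and a set of low rank with
more than `log_{d+1} w` elements can always be extended by a variable to a set of low rank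
(`LowRankPartition.exists_insert`). Hence the search backtracks only among the sequences of length
at most `log_{d+1} w`, and it visits at most `n ^ (1 + log_{d+1} w) + n` nodes (`SearchInv.step`).
A node takes time polynomial in `n` and `w`. Being of low rank is invariant under complements, so
the sequence found is a good order in either direction.

The program is written out as `orderFinder`; its behaviour and its running time are derived from a
small calculus of total correctness (`WP`).
-/

namespace OrderFinding
/-! ### Interpolation in one variable -/

open MvPolynomial in
/-- The restriction of a polynomial to a line parallel to a coordinate axis. -/
theorem exists_univariate_restriction {F : Type u} [Field F] {n : ℕ} (f : MvPolynomial (Fin n) F)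
    (x : Fin n) (g : Fin n → F) :
    ∃ p : Polynomial F, p.natDegree ≤ degreeOf x f ∧
      ∀ y, p.eval y = eval (Function.update g x y) f := by
  refine ⟨aeval (Function.update (fun z => Polynomial.C (g z)) x Polynomial.X) f, ?_, ?_⟩
  · rw [aeval_def, eval₂_eq]
    refine Polynomial.natDegree_sum_le_of_forall_le _ _ fun m hm => ?_
    refine (Polynomial.natDegree_mul_le).trans ?_
    rw [← Polynomial.C_eq_algebraMap, Polynomial.natDegree_C, zero_add]
    refine (Polynomial.natDegree_prod_le _ _).trans ?_
    refine le_trans ?_ (monomial_le_degreeOf x hm)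
    calc _ ≤ ∑ i ∈ m.support, (if i = x then m x else 0) := by
          refine Finset.sum_le_sum fun i _ => ?_
          split_ifs with h
          · subst h; simp
          · rw [Function.update_of_ne h, ← map_pow, Polynomial.natDegree_C]
      _ ≤ m x := by
          rw [Finset.sum_ite_eq']; split_ifs <;> simp
  · intro y
    rw [← Polynomial.coe_evalRingHom, aeval_def, hom_eval₂, ← eval₂_id]
    congr 1
    · ext a; simp
    · ext z
      by_cases h : z = x
      · subst h; simp
      · simp [Function.update_of_ne h]

/-- The Lagrange basis polynomial of the nodes `s` that is one at `s e`. -/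
noncomputable def lag {F : Type u} [Field F] {d : ℕ} (s : Fin (d + 1) → F) (e : Fin (d + 1)) :
    Polynomial F :=
  Lagrange.basis Finset.univ s e

theorem natDegree_lag {F : Type u} [Field F] {d : ℕ} {s : Fin (d + 1) → F}
    (hs : Function.Injective s) (e : Fin (d + 1)) : (lag s e).natDegree ≤ d := by
  unfold lag
  rw [Lagrange.natDegree_basis hs.injOn (Finset.mem_univ e)]
  simp

theorem eval_lag {F : Type u} [Field F] {d : ℕ} {s : Fin (d + 1) → F}
    (hs : Function.Injective s) (e e' : Fin (d + 1)) :
    (lag s e).eval (s e') = if e = e' then 1 else 0 := by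
  unfold lag
  split_ifs with h
  · subst h; exact Lagrange.eval_basis_self hs.injOn (Finset.mem_univ _)
  · exact Lagrange.eval_basis_of_ne h (Finset.mem_univ _)

open MvPolynomial in
/-- Interpolation in one coordinate. -/
theorem eval_update_eq_sum_lag {F : Type u} [Field F] {n d : ℕ} {f : MvPolynomial (Fin n) F}
    {x : Fin n} (hf : degreeOf x f ≤ d) {s : Fin (d + 1) → F} (hs : Function.Injective s)
    (g : Fin n → F) (y : F) :
    eval (Function.update g x y) f =
      ∑ e, (lag s e).eval y * eval (Function.update g x (s e)) f := by
  obtain ⟨p, hp, hpe⟩ := exists_univariate_restriction f x g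
  have h := Lagrange.eq_interpolate (s := Finset.univ) (v := s) (f := p) hs.injOn
    (by
      refine (Polynomial.degree_le_natDegree).trans_lt ?_
      simp only [Finset.card_univ, Fintype.card_fin]
      exact_mod_cast Nat.lt_succ_of_le (hp.trans hf))
  rw [← hpe, h, Lagrange.interpolate_apply, Polynomial.eval_finsetSum]
  refine Finset.sum_congr rfl fun e _ => ?_
  simp [hpe, lag, mul_comm]

/-! ### Separation rank -/

/-- The rank of `f`, as a function on points, across the partition of the variables into `T` and
its complement, is at most `r`: the value at the point that agrees with `g` on `T` and with `h`
off `T` is a sum of `r` products of a function of `g` and a function of `h`. -/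
def SepRankLE {F : Type u} [Field F] {n : ℕ} (r : ℕ) (T : Finset (Fin n))
    (f : MvPolynomial (Fin n) F) : Prop :=
  ∃ u v : Fin r → (Fin n → F) → F, ∀ g h,
    MvPolynomial.eval (T.piecewise g h) f = ∑ a, u a g * v a h

section SepRank

variable {F : Type u} [Field F] {n : ℕ}

theorem SepRankLE.of_fintype {ι : Type*} [Fintype ι] {r : ℕ} {T : Finset (Fin n)}
    {f : MvPolynomial (Fin n) F} (hc : Fintype.card ι ≤ r) (u v : ι → (Fin n → F) → F)
    (h : ∀ g h, MvPolynomial.eval (T.piecewise g h) f = ∑ a, u a g * v a h) :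
    SepRankLE r T f := by
  obtain ⟨e⟩ := Function.Embedding.nonempty_of_card_le
    (show Fintype.card ι ≤ Fintype.card (Fin r) by simpa using hc)
  refine ⟨Function.extend e u 0, Function.extend e v 0, fun g h' => ?_⟩
  rw [h]
  refine Fintype.sum_of_injective e e.injective _ _ (fun i hi => ?_) fun i => ?_
  · rw [Function.extend_apply' _ _ _ (by simpa using hi)]; simp
  · simp [e.injective.extend_apply]

theorem SepRankLE.mono {r r' : ℕ} (h : r ≤ r') {T : Finset (Fin n)} {f : MvPolynomial (Fin n) F}
    (hf : SepRankLE r T f) : SepRankLE r' T f := by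
  obtain ⟨u, v, huv⟩ := hf
  exact SepRankLE.of_fintype (by simpa using h) u v huv

theorem SepRankLE.compl {r : ℕ} {T : Finset (Fin n)} {f : MvPolynomial (Fin n) F}
    (hf : SepRankLE r T f) : SepRankLE r Tᶜ f := by
  obtain ⟨u, v, huv⟩ := hf
  refine ⟨v, u, fun g h => ?_⟩
  rw [Finset.piecewise_compl, huv]
  exact Finset.sum_congr rfl fun a _ => mul_comm _ _

theorem SepRankLE.one (T : Finset (Fin n)) : SepRankLE 1 T (1 : MvPolynomial (Fin n) F) :=
  ⟨fun _ _ => 1, fun _ _ => 1, by simp⟩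

theorem SepRankLE.mul {r r' : ℕ} {T : Finset (Fin n)} {f f' : MvPolynomial (Fin n) F}
    (hf : SepRankLE r T f) (hf' : SepRankLE r' T f') : SepRankLE (r * r') T (f * f') := by
  obtain ⟨u, v, huv⟩ := hf
  obtain ⟨u', v', huv'⟩ := hf'
  refine SepRankLE.of_fintype (ι := Fin r × Fin r') (by simp)
    (fun a g => u a.1 g * u' a.2 g) (fun a g => v a.1 g * v' a.2 g) fun g h => ?_
  rw [map_mul, huv, huv', Finset.sum_mul_sum, Fintype.sum_prod_type]
  exact Finset.sum_congr rfl fun a _ => Finset.sum_congr rfl fun b _ => by ring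

theorem SepRankLE.prod {ι : Type*} (s : Finset ι) {r : ι → ℕ} {T : Finset (Fin n)}
    {f : ι → MvPolynomial (Fin n) F} (hf : ∀ i ∈ s, SepRankLE (r i) T (f i)) :
    SepRankLE (∏ i ∈ s, r i) T (∏ i ∈ s, f i) := by
  classical
  induction s using Finset.induction_on with
  | empty => simpa using SepRankLE.one T
  | insert i s hi ih =>
    rw [Finset.prod_insert hi, Finset.prod_insert hi]
    exact (hf i (by simp)).mul (ih fun j hj => hf j (by simp [hj]))

theorem SepRankLE.empty (f : MvPolynomial (Fin n) F) : SepRankLE 1 ∅ f :=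
  ⟨fun _ _ => 1, fun _ h => MvPolynomial.eval h f, by simp⟩

/-- Moving one variable across the partition multiplies the rank by at most the number of
interpolation nodes. -/
theorem SepRankLE.insert {d r : ℕ} {f : MvPolynomial (Fin n) F} {x : Fin n}
    (hdeg : MvPolynomial.degreeOf x f ≤ d) {s : Fin (d + 1) → F} (hs : Function.Injective s)
    {T : Finset (Fin n)} (hx : x ∉ T) (hf : SepRankLE r T f) :
    SepRankLE (r * (d + 1)) (insert x T) f := by
  obtain ⟨u, v, huv⟩ := hf
  refine SepRankLE.of_fintype (ι := Fin r × Fin (d + 1)) (by simp)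
    (fun a g => u a.1 g * (lag s a.2).eval (g x)) (fun a h => v a.1 (Function.update h x (s a.2)))
    fun g h => ?_
  rw [Finset.piecewise_insert, eval_update_eq_sum_lag hdeg hs, Fintype.sum_prod_type_right]
  refine Finset.sum_congr rfl fun e _ => ?_
  rw [Finset.update_piecewise_of_notMem _ _ _ hx, huv, Finset.mul_sum]
  exact Finset.sum_congr rfl fun a _ => by ring

theorem SepRankLE.pow_card {d : ℕ} {f : MvPolynomial (Fin n) F}
    (hdeg : ∀ x, MvPolynomial.degreeOf x f ≤ d) {s : Fin (d + 1) → F}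
    (hs : Function.Injective s) (T : Finset (Fin n)) : SepRankLE ((d + 1) ^ T.card) T f := by
  induction T using Finset.induction_on with
  | empty => simpa using SepRankLE.empty f
  | insert x T hx ih =>
    rw [Finset.card_insert_of_notMem hx, pow_succ]
    exact SepRankLE.insert (hdeg x) hs hx ih

end SepRank

/-! ### Sums over paths -/

/-- Transfer matrices: if the vectors `g i` satisfy `g (i + 1) = g i * m i`, then the sum over all
paths of the products of the weights, with the initial vector `g 0`, is the last vector. -/
theorem sum_paths_eq {R : Type*} [CommSemiring R] : ∀ {n : ℕ} (l : Fin (n + 1) → ℕ)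
    (m : (i : Fin n) → Fin (l i.castSucc) → Fin (l i.succ) → R)
    (g : (i : Fin (n + 1)) → Fin (l i) → R)
    (_ : ∀ (i : Fin n) b, g i.succ b = ∑ a, g i.castSucc a * m i a b)
    (h : Fin (l (Fin.last n)) → R),
    ∑ p : ((i : Fin (n + 1)) → Fin (l i)),
      g 0 (p 0) * (∏ i : Fin n, m i (p i.castSucc) (p i.succ)) * h (p (Fin.last n)) =
      ∑ b, g (Fin.last n) b * h b
  | 0, l, m, g, _, h => by
    rw [← (Fin.consEquiv fun i : Fin 1 => Fin (l i)).sum_comp, Fintype.sum_prod_type]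
    refine Finset.sum_congr rfl fun b _ => ?_
    simp [Fin.consEquiv]
  | n + 1, l, m, g, hg, h => by
    have ih := sum_paths_eq (n := n) (fun i => l i.succ) (fun i => m i.succ) (fun i => g i.succ)
      (fun i b => hg i.succ b) h
    rw [← (Fin.consEquiv fun i : Fin (n + 2) => Fin (l i)).sum_comp, Fintype.sum_prod_type,
      Finset.sum_comm]
    refine Eq.trans ?_ ih
    refine Finset.sum_congr rfl fun p _ => ?_
    have h0 := hg 0 (p 0)
    simp only [Fin.succ_zero_eq_one] at h0 ⊢
    rw [h0, Finset.sum_mul, Finset.sum_mul]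
    refine Finset.sum_congr rfl fun a _ => ?_
    simp only [Fin.consEquiv, Equiv.coe_fn_mk, Fin.prod_univ_succ, Fin.castSucc_zero,
      ← Fin.succ_castSucc, ← Fin.succ_last]
    simp only [Fin.cons_zero, Fin.cons_succ, mul_assoc]

/-! ### Programs from separation ranks -/

section Nisan

open MvPolynomial

variable {F : Type u} [Field F] {n : ℕ}

/-- The first `j` variables in the order `τ`. -/
def prefixSet (τ : Equiv.Perm (Fin n)) (j : ℕ) : Finset (Fin n) :=
  Finset.univ.filter fun x => (τ.symm x : ℕ) < j

theorem mem_prefixSet {τ : Equiv.Perm (Fin n)} {j : ℕ} {x : Fin n} :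
    x ∈ prefixSet τ j ↔ (τ.symm x : ℕ) < j := by
  simp [prefixSet]

theorem prefixSet_succ (τ : Equiv.Perm (Fin n)) (i : Fin n) :
    prefixSet τ (i + 1) = insert (τ i) (prefixSet τ i) := by
  ext x
  rw [Finset.mem_insert, mem_prefixSet, mem_prefixSet, Nat.lt_succ_iff_lt_or_eq, or_comm,
    ← Equiv.symm_apply_eq, Fin.ext_iff]

theorem notMem_prefixSet (τ : Equiv.Perm (Fin n)) (i : Fin n) : τ i ∉ prefixSet τ i := by
  simp [mem_prefixSet]

theorem eval_aeval_X (y : Fin n → F) (x : Fin n) (p : Polynomial F) :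
    eval y (Polynomial.aeval (X x : MvPolynomial (Fin n) F) p) = p.eval (y x) := by
  rw [Polynomial.aeval_def, Polynomial.hom_eval₂, eval_X, ← Polynomial.eval₂_id]
  congr 1
  ext a
  simp

theorem degreeOf_aeval_X_le (x y : Fin n) (p : Polynomial F) :
    degreeOf x (Polynomial.aeval (X y : MvPolynomial (Fin n) F) p) ≤
      if y = x then p.natDegree else 0 := by
  rw [Polynomial.aeval_eq_sum_range]
  refine (degreeOf_sum_le _ _ _).trans (Finset.sup_le fun i hi => ?_)
  rw [smul_eq_C_mul]
  refine (degreeOf_C_mul_le _ _ _).trans ((degreeOf_pow_le _ _ _).trans ?_)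
  rw [degreeOf_X]
  have : i ≤ p.natDegree := Nat.lt_succ_iff.1 (Finset.mem_range.1 hi)
  by_cases h : y = x
  · rw [if_pos h.symm, if_pos h]; omega
  · rw [if_neg (Ne.symm h), if_neg h]; omega

theorem degreeOf_poly_le {d : ℕ} (P : ROABP F n d) (τ : Equiv.Perm (Fin n)) (x : Fin n) :
    degreeOf x (P.poly τ) ≤ d := by
  unfold ROABP.poly
  refine (degreeOf_sum_le _ _ _).trans (Finset.sup_le fun p _ => ?_)
  refine (degreeOf_prod_le _ _ _).trans ?_
  calc _ ≤ ∑ i : Fin n, (if i = τ.symm x then d else 0) := by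
        refine Finset.sum_le_sum fun i _ => (degreeOf_aeval_X_le _ _ _).trans ?_
        have := P.natDegree_weight_le i (p i.castSucc) (p i.succ)
        by_cases h : τ i = x
        · rw [if_pos h, if_pos (by simp [← h])]; exact this
        · rw [if_neg h]; exact Nat.zero_le _
    _ = d := by simp

/-- Two polynomials of small individual degrees that agree as functions are equal. -/
theorem eq_of_eval_eq {d : ℕ} {f f' : MvPolynomial (Fin n) F} (hf : ∀ x, degreeOf x f ≤ d)
    (hf' : ∀ x, degreeOf x f' ≤ d) {s : Fin (d + 1) → F} (hs : Function.Injective s)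
    (h : ∀ g, eval g f = eval g f') : f = f' := by
  rw [← sub_eq_zero]
  refine eq_zero_of_eval_zero_at_prod_finset _ (fun _ => Finset.univ.map ⟨s, hs⟩) (fun x => ?_)
    fun g _ => by simp [h]
  simp only [Finset.card_map, Finset.card_univ, Fintype.card_fin]
  exact Nat.lt_succ_of_le ((degreeOf_sub_le _ _ _).trans (max_le (hf x) (hf' x)))

/-- The space spanned by the functions obtained from `f` by fixing the variables off `T`. -/
def sliceSpan (T : Finset (Fin n)) (f : MvPolynomial (Fin n) F) :
    Submodule F ((Fin n → F) → F) :=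
  Submodule.span F (Set.range fun h g => eval (T.piecewise g h) f)

theorem SepRankLE.exists_span_eq {r : ℕ} {T : Finset (Fin n)} {f : MvPolynomial (Fin n) F}
    (hf : SepRankLE r T f) : ∃ m ≤ r, ∃ g : Fin m → (Fin n → F) → F,
      Submodule.span F (Set.range g) = sliceSpan T f := by
  obtain ⟨u, v, huv⟩ := hf
  have hle : sliceSpan T f ≤ Submodule.span F (Set.range u) := by
    refine Submodule.span_le.2 ?_
    rintro _ ⟨h, rfl⟩
    have : (fun g => eval (T.piecewise g h) f) = ∑ a, v a h • u a := by
      ext g; simp [huv, mul_comm]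
    change (fun g => eval (T.piecewise g h) f) ∈ _
    rw [this]
    exact Submodule.sum_mem _ fun a _ => Submodule.smul_mem _ _ (Submodule.subset_span ⟨a, rfl⟩)
  have : FiniteDimensional F (Submodule.span F (Set.range u)) :=
    FiniteDimensional.span_of_finite F (Set.finite_range u)
  have : FiniteDimensional F (sliceSpan T f) := Submodule.finiteDimensional_of_le hle
  refine ⟨Module.finrank F (sliceSpan T f), ?_,
    fun a => (Module.finBasis F (sliceSpan T f) a : (Fin n → F) → F), ?_⟩
  · refine (Submodule.finrank_mono hle).trans ?_
    simpa [Set.finrank] using finrank_range_le_card (R := F) u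
  · have := (Module.finBasis F (sliceSpan T f)).span_eq
    have h2 := congrArg (Submodule.map (sliceSpan T f).subtype) this
    rw [Submodule.map_span, Submodule.map_subtype_top, ← Set.range_comp] at h2
    exact h2

/-- One layer of a branching program: the slices on `insert x T` are combinations of slices on `T`
with coefficients that are polynomials in the new variable. -/
theorem exists_edge_weights {d m : ℕ} {f : MvPolynomial (Fin n) F} {x : Fin n}
    (hdeg : degreeOf x f ≤ d) {s : Fin (d + 1) → F} (hs : Function.Injective s)
    {T : Finset (Fin n)} (hx : x ∉ T) {g : Fin m → (Fin n → F) → F}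
    (hg : sliceSpan T f ≤ Submodule.span F (Set.range g)) {G : (Fin n → F) → F}
    (hG : G ∈ sliceSpan (insert x T) f) :
    ∃ p : Fin m → Polynomial F, (∀ a, (p a).natDegree ≤ d) ∧
      ∀ y, G y = ∑ a, g a y * (p a).eval (y x) := by
  induction hG using Submodule.span_induction with
  | mem G hG =>
    obtain ⟨h, rfl⟩ := hG
    have hc : ∀ e, ∃ c : Fin m → F, ∑ a, c a • g a =
        fun y => eval (T.piecewise y (Function.update h x (s e))) f := fun e =>
      (Submodule.mem_span_range_iff_exists_fun F).1 (hg (Submodule.subset_span ⟨_, rfl⟩))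
    choose c hc using hc
    refine ⟨fun a => ∑ e, Polynomial.C (c e a) * lag s e, fun a => ?_, fun y => ?_⟩
    · exact Polynomial.natDegree_sum_le_of_forall_le _ _ fun e _ =>
        (Polynomial.natDegree_C_mul_le _ _).trans (natDegree_lag hs e)
    · dsimp only
      rw [Finset.piecewise_insert, eval_update_eq_sum_lag hdeg hs]
      simp only [Polynomial.eval_finsetSum, Finset.mul_sum]
      rw [Finset.sum_comm]
      refine Finset.sum_congr rfl fun e _ => ?_
      rw [Finset.update_piecewise_of_notMem _ _ _ hx, ← congrFun (hc e) y]
      simp only [Finset.sum_apply, Pi.smul_apply, smul_eq_mul, Finset.mul_sum,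
        Polynomial.eval_mul, Polynomial.eval_C]
      exact Finset.sum_congr rfl fun a _ => by ring
  | zero => exact ⟨0, by simp, by simp⟩
  | add G G' _ _ ih ih' =>
    obtain ⟨p, hp, hpe⟩ := ih
    obtain ⟨p', hp', hpe'⟩ := ih'
    refine ⟨p + p', fun a => (Polynomial.natDegree_add_le_of_degree_le (hp a) (hp' a)), fun y => ?_⟩
    simp [hpe, hpe', mul_add, Finset.sum_add_distrib]
  | smul c G _ ih =>
    obtain ⟨p, hp, hpe⟩ := ih
    refine ⟨c • p, fun a => (Polynomial.natDegree_smul_le _ _).trans (hp a), fun y => ?_⟩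
    simp only [Pi.smul_apply, smul_eq_mul, hpe, Finset.mul_sum, Polynomial.eval_smul]
    exact Finset.sum_congr rfl fun a _ => by ring

/-- Nisan's characterization: a polynomial of individual degrees at most `d` whose rank is at most
`w` across every prefix of the order `τ` has a program of width `w` in the order `τ`. The vertices
of layer `j` are a basis of the space of slices on the first `j` variables. -/
theorem hasROABP_of_sepRankLE {d w : ℕ} (hn : 0 < n) (hw : 0 < w) {f : MvPolynomial (Fin n) F}
    (hdeg : ∀ x, degreeOf x f ≤ d) {s : Fin (d + 1) → F} (hs : Function.Injective s)
    (τ : Equiv.Perm (Fin n)) (h : ∀ j : ℕ, SepRankLE w (prefixSet τ j) f) :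
    HasROABP d w τ f := by
  -- The first and the last layer are single vertices with prescribed functions: `1` need not lie in
  -- the slices on no variables, and `f` alone need not span the slices on all variables.
  have hlayer : ∀ j : Fin (n + 1), ∃ m ≤ w, ∃ g : Fin m → (Fin n → F) → F,
      (j = 0 → m = 1 ∧ g = fun _ _ => 1) ∧
      (j = Fin.last n → m = 1 ∧ g = fun _ y => eval y f) ∧
      (j ≠ 0 → ∀ a, g a ∈ sliceSpan (prefixSet τ j) f) ∧
      (j ≠ Fin.last n → sliceSpan (prefixSet τ j) f ≤ Submodule.span F (Set.range g)) := by
    intro j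
    by_cases h0 : j = 0
    · subst h0
      refine ⟨1, hw, fun _ _ => 1, fun _ => ⟨rfl, rfl⟩, fun h => ?_, fun h => absurd rfl h,
        fun _ => Submodule.span_le.2 ?_⟩
      · rw [Fin.ext_iff] at h; simp at h; omega
      · rintro _ ⟨h, rfl⟩
        refine (Submodule.mem_span_range_iff_exists_fun F).2 ⟨fun _ => eval h f, ?_⟩
        ext y
        rw [Fin.sum_univ_one]
        change eval h f * 1 = eval ((prefixSet τ (0 : Fin (n + 1))).piecewise y h) f
        rw [mul_one]
        congr 2
        ext z
        exact (Finset.piecewise_eq_of_notMem _ _ _ (by simp [mem_prefixSet])).symm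
    by_cases hl : j = Fin.last n
    · subst hl
      refine ⟨1, hw, fun _ y => eval y f, fun h => absurd h h0, fun _ => ⟨rfl, rfl⟩,
        fun _ _ => Submodule.subset_span ⟨0, ?_⟩, fun h => absurd rfl h⟩
      ext y
      have : (prefixSet τ n).piecewise y 0 = y := by
        ext z
        exact Finset.piecewise_eq_of_mem _ _ _ (by simp [mem_prefixSet])
      simp [this]
    · obtain ⟨m, hm, g, hg⟩ := (h j).exists_span_eq
      exact ⟨m, hm, g, fun h => absurd h h0, fun h => absurd h hl,
        fun _ a => hg ▸ Submodule.subset_span ⟨a, rfl⟩, fun _ => hg.ge⟩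
  choose m hm g hg0 hgl hgm hgs using hlayer
  have hedge : ∀ (i : Fin n) (b : Fin (m i.succ)), ∃ p : Fin (m i.castSucc) → Polynomial F,
      (∀ a, (p a).natDegree ≤ d) ∧
        ∀ y, g i.succ b y = ∑ a, g i.castSucc a y * (p a).eval (y (τ i)) := by
    intro i b
    refine exists_edge_weights (hdeg _) hs (notMem_prefixSet τ i)
      (hgs i.castSucc (Fin.castSucc_lt_last i).ne) ?_
    rw [← prefixSet_succ]
    exact hgm i.succ (Fin.succ_ne_zero i) b
  choose p hpd hpe using hedge
  let P : ROABP F n d :=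
    { layer := m
      layer_source := (hg0 0 rfl).1
      layer_sink := (hgl _ rfl).1
      weight := fun i a b => p i b a
      natDegree_weight_le := fun i a b => hpd i b a }
  refine ⟨P, hm, eq_of_eval_eq (degreeOf_poly_le P τ) hdeg hs fun y => ?_⟩
  have hsum := sum_paths_eq m (fun i a b => (p i b a).eval (y (τ i))) (fun i a => g i a y)
    (fun i b => hpe i b y) fun _ => 1
  simp only [(hg0 0 rfl).2, (hgl _ rfl).2] at hsum
  simp only [one_mul, mul_one, Finset.sum_const, Finset.card_univ, Fintype.card_fin,
    (hgl _ rfl).1, one_smul] at hsum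
  rw [← hsum, ROABP.poly, map_sum]
  refine Finset.sum_congr rfl fun q _ => ?_
  rw [map_prod]
  refine Finset.prod_congr rfl fun i _ => ?_
  exact eval_aeval_X _ _ _

end Nisan

/-! ### Matrix products -/

section MatVal

open MvPolynomial

variable {R : Type*} [CommSemiring R] {n d w : ℕ}

/-- The `i`-th matrix factor, evaluated at the point `y`. The coefficients lie in any semiring, so
that numbers, polynomials in the variables and polynomials in the entries are covered at once. -/
def matFactor (σ : Equiv.Perm (Fin n)) (A : Fin n × Fin (d + 1) × Fin w × Fin w → R)
    (y : Fin n → R) (i : Fin n) : Matrix (Fin w) (Fin w) R :=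
  Matrix.of fun a b => ∑ j : Fin (d + 1), A (i, j, a, b) * y (σ i) ^ (j : ℕ)

/-- The value at the point `y` of the corner entry of the product of the matrix factors. -/
def matVal (hw : 0 < w) (σ : Equiv.Perm (Fin n)) (A : Fin n × Fin (d + 1) × Fin w × Fin w → R)
    (y : Fin n → R) : R :=
  (List.ofFn (matFactor σ A y)).prod ⟨0, hw⟩ ⟨0, hw⟩

theorem map_matVal {R' : Type*} [CommSemiring R'] (φ : R →+* R') (hw : 0 < w)
    (σ : Equiv.Perm (Fin n)) (A : Fin n × Fin (d + 1) × Fin w × Fin w → R) (y : Fin n → R) :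
    φ (matVal hw σ A y) = matVal hw σ (φ ∘ A) (φ ∘ y) := by
  have : φ (matVal hw σ A y) =
      φ.mapMatrix ((List.ofFn (matFactor σ A y)).prod) ⟨0, hw⟩ ⟨0, hw⟩ := rfl
  have hf : φ.mapMatrix ∘ matFactor σ A y = matFactor σ (φ ∘ A) (φ ∘ y) := by
    ext i a b
    simp [matFactor]
  rw [this, map_list_prod, List.map_ofFn, hf, matVal]

/-- The entries of a product of matrices as sums over paths. -/
theorem list_prod_apply_eq_sum_paths (M : Fin n → Matrix (Fin w) (Fin w) R) (a b : Fin w) :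
    (List.ofFn M).prod a b = ∑ p : Fin (n + 1) → Fin w,
      (if a = p 0 then 1 else 0) * (∏ i, M i (p i.castSucc) (p i.succ)) *
        (if p (Fin.last n) = b then 1 else 0) := by
  have := sum_paths_eq (fun _ : Fin (n + 1) => w) (fun i => M i)
    (fun i c => ((List.ofFn M).take i).prod a c) (fun i c => by
      rw [Fin.val_succ, List.prod_take_succ _ _ (by simp), Matrix.mul_apply]
      simp) (fun c => if c = b then 1 else 0)
  simp only [Fin.val_zero, List.take_zero, List.prod_nil, Matrix.one_apply, Fin.val_last] at this
  rw [this, List.take_of_length_le (by simp)]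
  simp

/-- The polynomial with the matrix entries `A`; `randomPoly` is by definition of this form. -/
noncomputable def matPoly {F : Type u} [Field F] (hw : 0 < w) (σ : Equiv.Perm (Fin n))
    (A : Fin n × Fin (d + 1) × Fin w × Fin w → F) : MvPolynomial (Fin n) F :=
  matVal hw σ (fun x => C (A x)) X

theorem eval_matPoly {F : Type u} [Field F] (hw : 0 < w) (σ : Equiv.Perm (Fin n))
    (A : Fin n × Fin (d + 1) × Fin w × Fin w → F) (y : Fin n → F) :
    eval y (matPoly hw σ A) = matVal hw σ A y := by
  rw [matPoly, map_matVal]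
  congr 1
  · ext x; simp
  · ext x; simp

theorem degreeOf_matPoly_le {F : Type u} [Field F] (hw : 0 < w) (σ : Equiv.Perm (Fin n))
    (A : Fin n × Fin (d + 1) × Fin w × Fin w → F) (x : Fin n) :
    degreeOf x (matPoly hw σ A) ≤ d := by
  unfold matPoly matVal
  rw [list_prod_apply_eq_sum_paths]
  refine (degreeOf_sum_le _ _ _).trans (Finset.sup_le fun p _ => ?_)
  have hite : ∀ (P : Prop) [Decidable P],
      degreeOf x (if P then 1 else 0 : MvPolynomial (Fin n) F) = 0 := fun P _ => by
    split_ifs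
    · rw [← C_1, degreeOf_C]
    · rw [degreeOf_zero]
  refine (degreeOf_mul_le _ _ _).trans ?_
  rw [hite, add_zero]
  refine (degreeOf_mul_le _ _ _).trans ?_
  rw [hite, zero_add]
  refine (degreeOf_prod_le _ _ _).trans ?_
  calc _ ≤ ∑ i : Fin n, (if i = σ.symm x then d else 0) := by
        refine Finset.sum_le_sum fun i _ => ?_
        simp only [matFactor, Matrix.of_apply]
        refine (degreeOf_sum_le _ _ _).trans (Finset.sup_le fun j _ => ?_)
        refine (degreeOf_C_mul_le _ _ _).trans ((degreeOf_pow_le _ _ _).trans ?_)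
        rw [degreeOf_X]
        have := j.2
        by_cases h : σ i = x
        · rw [if_pos h.symm, if_pos (by simp [← h])]; omega
        · rw [if_neg (Ne.symm h)]; omega
    _ = d := by simp

/-- The degree in the entries and the coordinates together. -/
theorem totalDegree_matVal_X_le {F : Type u} [Field F] {V : Type*} (hw : 0 < w)
    (σ : Equiv.Perm (Fin n)) (A : Fin n × Fin (d + 1) × Fin w × Fin w → V) (y : Fin n → V) :
    (matVal hw σ (fun x => (X (A x) : MvPolynomial V F)) (fun x => X (y x))).totalDegree ≤
      n * (d + 1) := by
  unfold matVal
  rw [list_prod_apply_eq_sum_paths]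
  refine (totalDegree_finsetSum _ _).trans (Finset.sup_le fun p _ => ?_)
  have hite : ∀ (P : Prop) [Decidable P],
      totalDegree (if P then 1 else 0 : MvPolynomial V F) = 0 := fun P _ => by
    split_ifs
    · rw [← C_1, totalDegree_C]
    · rw [totalDegree_zero]
  refine (totalDegree_mul _ _).trans ?_
  rw [hite, add_zero]
  refine (totalDegree_mul _ _).trans ?_
  rw [hite, zero_add]
  refine (totalDegree_finsetProd _ _).trans ?_
  calc _ ≤ ∑ i : Fin n, (d + 1) := by
        refine Finset.sum_le_sum fun i _ => ?_
        simp only [matFactor, Matrix.of_apply]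
        refine (totalDegree_finsetSum _ _).trans (Finset.sup_le fun j _ => ?_)
        refine (totalDegree_mul _ _).trans ?_
        rw [totalDegree_X]
        refine (Nat.add_le_add_left (totalDegree_pow _ _) _).trans ?_
        rw [totalDegree_X]
        have := j.2
        omega
    _ = n * (d + 1) := by simp

/-- Across a prefix of its order a matrix product splits into two matrix products. -/
theorem sepRankLE_prefixSet {F : Type u} [Field F] (hw : 0 < w) (σ : Equiv.Perm (Fin n))
    (A : Fin n × Fin (d + 1) × Fin w × Fin w → F) (j : ℕ) :
    SepRankLE w (prefixSet σ j) (matPoly hw σ A) := by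
  refine ⟨fun a g => ((List.ofFn (matFactor σ A g)).take j).prod ⟨0, hw⟩ a,
    fun a h => ((List.ofFn (matFactor σ A h)).drop j).prod a ⟨0, hw⟩, fun g h => ?_⟩
  rw [eval_matPoly, ← Matrix.mul_apply]
  have h1 : (List.ofFn (matFactor σ A g)).take j =
      (List.ofFn (matFactor σ A ((prefixSet σ j).piecewise g h))).take j := by
    refine List.ext_getElem (by simp) fun i hi _ => ?_
    simp only [List.length_take, List.length_ofFn, lt_min_iff] at hi
    simp only [List.getElem_take, List.getElem_ofFn, matFactor]
    rw [Finset.piecewise_eq_of_mem _ _ _ (by simp [mem_prefixSet, hi.1])]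
  have h2 : (List.ofFn (matFactor σ A h)).drop j =
      (List.ofFn (matFactor σ A ((prefixSet σ j).piecewise g h))).drop j := by
    refine List.ext_getElem (by simp) fun i hi _ => ?_
    simp only [List.getElem_drop, List.getElem_ofFn, matFactor]
    rw [Finset.piecewise_eq_of_notMem _ _ _ (by simp [mem_prefixSet])]
  rw [h1, h2, ← List.prod_append, List.take_append_drop]
  rfl

theorem sepRankLE_of_width_one {F : Type u} [Field F] (σ : Equiv.Perm (Fin n))
    (A : Fin n × Fin (d + 1) × Fin 1 × Fin 1 → F) (T : Finset (Fin n)) :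
    SepRankLE 1 T (matPoly Nat.one_pos σ A) := by
  have hval : ∀ y, matVal Nat.one_pos σ A y = ∏ i, matFactor σ A y i 0 0 := fun y => by
    unfold matVal
    rw [list_prod_apply_eq_sum_paths]
    simp [Subsingleton.elim _ (0 : Fin 1)]
  refine ⟨fun _ g => ∏ i, if σ i ∈ T then matFactor σ A g i 0 0 else 1,
    fun _ h => ∏ i, if σ i ∈ T then 1 else matFactor σ A h i 0 0, fun g h => ?_⟩
  rw [eval_matPoly, hval, Fin.sum_univ_one, ← Finset.prod_mul_distrib]
  refine Finset.prod_congr rfl fun i _ => ?_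
  by_cases hi : σ i ∈ T <;> simp [matFactor, hi]

/-- Layers of a branching program of width `w` can be padded to `w` vertices, which turns the
program into a product of `w × w` matrices. -/
theorem HasROABP.exists_matVal_eq {F : Type u} [Field F] (hw : 0 < w) {σ : Equiv.Perm (Fin n)}
    {f : MvPolynomial (Fin n) F} (h : HasROABP d w σ f) :
    ∃ A : Fin n × Fin (d + 1) × Fin w × Fin w → F, ∀ y, matVal hw σ A y = eval y f := by
  obtain ⟨P, hP, rfl⟩ := h
  let A : Fin n × Fin (d + 1) × Fin w × Fin w → F := fun x =>
    if h : (x.2.2.1 : ℕ) < P.layer x.1.castSucc ∧ (x.2.2.2 : ℕ) < P.layer x.1.succ then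
      (P.weight x.1 ⟨_, h.1⟩ ⟨_, h.2⟩).coeff x.2.1 else 0
  have hA : ∀ y i (a : Fin (P.layer i.castSucc)) (b : Fin (P.layer i.succ)),
      matFactor σ A y i (Fin.castLE (hP _) a) (Fin.castLE (hP _) b) =
        (P.weight i a b).eval (y (σ i)) := by
    intro y i a b
    rw [Polynomial.eval_eq_sum_range' (Nat.lt_succ_of_le (P.natDegree_weight_le i a b)),
      ← Fin.sum_univ_eq_sum_range (fun j => (P.weight i a b).coeff j * y (σ i) ^ j)]
    simp [matFactor, A]
  have hA0 : ∀ y i c (b : Fin (P.layer i.succ)), c ∉ Set.range (Fin.castLE (hP i.castSucc)) →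
      matFactor σ A y i c (Fin.castLE (hP _) b) = 0 := by
    intro y i c b hc
    have : ¬ (c : ℕ) < P.layer i.castSucc := fun h => hc ⟨⟨c, h⟩, rfl⟩
    simp [matFactor, A, this]
  refine ⟨A, fun y => ?_⟩
  have hsum := sum_paths_eq P.layer (fun i a b => (P.weight i a b).eval (y (σ i)))
    (fun i c => ((List.ofFn (matFactor σ A y)).take i).prod ⟨0, hw⟩ (Fin.castLE (hP i) c))
    (fun i b => by
      rw [Fin.val_succ, List.prod_take_succ _ _ (by simp), Matrix.mul_apply]
      refine (Fintype.sum_of_injective (Fin.castLE (hP i.castSucc)) (Fin.castLE_injective _)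
        _ _ (fun c hc => ?_) fun a => ?_).symm
      · simp [hA0 y i c b hc]
      · simp [hA]) fun _ => 1
  rw [ROABP.poly, map_sum]
  have hlast : ∀ b : Fin (P.layer (Fin.last n)), Fin.castLE (hP (Fin.last n)) b = ⟨0, hw⟩ :=
    fun b => Fin.ext (by have := b.2; have := P.layer_sink; simp; omega)
  have hfirst : ∀ b : Fin (P.layer 0), Fin.castLE (hP 0) b = ⟨0, hw⟩ :=
    fun b => Fin.ext (by have := b.2; have := P.layer_source; simp; omega)
  simp only [hlast, hfirst, Fin.val_zero, List.take_zero, List.prod_nil, Matrix.one_apply,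
    if_true, one_mul, mul_one, Fin.val_last, Finset.sum_const, Finset.card_univ, Fintype.card_fin,
    P.layer_sink, one_smul] at hsum
  rw [List.take_of_length_le (by simp)] at hsum
  rw [matVal, ← hsum]
  refine Finset.sum_congr rfl fun p _ => ?_
  rw [map_prod]
  exact Finset.prod_congr rfl fun i _ => (eval_aeval_X _ _ _).symm

end MatVal

/-! ### Partitions of high rank -/

section Generic

open MvPolynomial

variable {F : Type u} [Field F] {n d w : ℕ}

/-- The polynomial in the variables `x` and `y` that on the grid of the nodes is the equality
test. -/
noncomputable def eqPoly (s : Fin (d + 1) → F) (x y : Fin n) : MvPolynomial (Fin n) F :=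
  ∑ e, Polynomial.aeval (X x) (lag s e) * Polynomial.aeval (X y) (lag s e)

theorem eval_eqPoly (s : Fin (d + 1) → F) (x y : Fin n) (g : Fin n → F) :
    eval g (eqPoly s x y) = ∑ e, (lag s e).eval (g x) * (lag s e).eval (g y) := by
  simp [eqPoly, eval_aeval_X]

theorem sepRankLE_eqPoly (s : Fin (d + 1) → F) (x y : Fin n) (T : Finset (Fin n)) :
    SepRankLE (if x ∈ T ↔ y ∈ T then 1 else d + 1) T (eqPoly s x y) := by
  by_cases hx : x ∈ T <;> by_cases hy : y ∈ T <;> simp only [hx, hy, iff_true, iff_false,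
    not_true, if_true, if_false]
  · exact ⟨fun _ g => eval g (eqPoly s x y), fun _ _ => 1, fun g h => by simp [eval_eqPoly, hx, hy]⟩
  · exact ⟨fun e g => (lag s e).eval (g x), fun e h => (lag s e).eval (h y),
      fun g h => by simp [eval_eqPoly, hx, hy]⟩
  · exact ⟨fun e g => (lag s e).eval (g y), fun e h => (lag s e).eval (h x),
      fun g h => by simp [eval_eqPoly, hx, hy, mul_comm]⟩
  · exact ⟨fun _ _ => 1, fun _ g => eval g (eqPoly s x y), fun g h => by simp [eval_eqPoly, hx, hy]⟩

theorem degreeOf_lag_le {s : Fin (d + 1) → F} (hs : Function.Injective s) (e : Fin (d + 1))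
    (x z : Fin n) : degreeOf z (Polynomial.aeval (X x : MvPolynomial (Fin n) F) (lag s e)) ≤
      if x = z then d else 0 := by
  refine (degreeOf_aeval_X_le _ _ _).trans ?_
  split_ifs
  · exact natDegree_lag hs e
  · exact le_rfl

theorem sum_ite_injective_le {k : ℕ} {t : Fin k → Fin n} (ht : Function.Injective t) (z : Fin n)
    (d : ℕ) : (∑ r, if t r = z then d else 0) ≤ d := by
  rw [← Finset.sum_filter, Finset.sum_const, smul_eq_mul]
  refine (Nat.mul_le_mul_right d (Finset.card_le_one.2 fun a ha b hb => ht ?_)).trans_eq (one_mul d)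
  simp only [Finset.mem_filter] at ha hb
  rw [ha.2, hb.2]

theorem degreeOf_prod_eqPoly_le {s : Fin (d + 1) → F} (hs : Function.Injective s) {k : ℕ}
    {t c : Fin k → Fin n} (ht : Function.Injective t) (hc : Function.Injective c)
    (htc : ∀ r r', t r ≠ c r') (z : Fin n) : degreeOf z (∏ r, eqPoly s (t r) (c r)) ≤ d := by
  refine (degreeOf_prod_le _ _ _).trans ?_
  calc _ ≤ ∑ r, ((if t r = z then d else 0) + if c r = z then d else 0) := by
        refine Finset.sum_le_sum fun r _ => ?_
        refine (degreeOf_sum_le _ _ _).trans (Finset.sup_le fun e _ => ?_)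
        exact (degreeOf_mul_le _ _ _).trans
          (Nat.add_le_add (degreeOf_lag_le hs _ _ _) (degreeOf_lag_le hs _ _ _))
    _ = (∑ r, if t r = z then d else 0) + ∑ r, if c r = z then d else 0 :=
        Finset.sum_add_distrib
    _ ≤ d := by
        by_cases h : ∃ r, t r = z
        · obtain ⟨r, rfl⟩ := h
          have : (∑ r', if c r' = t r then d else 0) = 0 :=
            Finset.sum_eq_zero fun r' _ => if_neg (htc r r').symm
          rw [this, add_zero]
          exact sum_ite_injective_le ht _ _
        · push Not at h
          rw [Finset.sum_eq_zero fun r _ => if_neg (h r), zero_add]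
          exact sum_ite_injective_le hc _ _

/-- A family of points on the two sides of a partition on which the equality tests of matched
pairs form an identity matrix. -/
theorem exists_points_prod_eqPoly {s : Fin (d + 1) → F} (hs : Function.Injective s) {k m : ℕ}
    (hm : m ≤ (d + 1) ^ k) {T : Finset (Fin n)} {t c : Fin k → Fin n}
    (ht : Function.Injective t) (hc : Function.Injective c) (htT : ∀ r, t r ∈ T)
    (hcT : ∀ r, c r ∉ T) : ∃ α β : Fin m → Fin n → F, ∀ i j,
      eval (T.piecewise (α i) (β j)) (∏ r, eqPoly s (t r) (c r)) = if i = j then 1 else 0 := by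
  obtain ⟨u⟩ : Nonempty (Fin m ↪ (Fin k → Fin (d + 1))) :=
    Function.Embedding.nonempty_of_card_le (by simpa using hm)
  refine ⟨fun i => Function.extend t (fun r => s (u i r)) 0,
    fun j => Function.extend c (fun r => s (u j r)) 0, fun i j => ?_⟩
  have h : ∀ r, eval (T.piecewise (Function.extend t (fun r => s (u i r)) 0)
      (Function.extend c (fun r => s (u j r)) 0)) (eqPoly s (t r) (c r)) =
      if u i r = u j r then 1 else 0 := fun r => by
    rw [eval_eqPoly]
    simp [htT, hcT, ht.extend_apply, hc.extend_apply, eval_lag hs]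
    simp [eq_comm]
  rw [map_prod, Finset.prod_congr rfl fun r _ => h r]
  by_cases hij : i = j
  · simp [hij]
  · rw [if_neg hij]
    obtain ⟨r, hr⟩ : ∃ r, u i r ≠ u j r := by
      by_contra! h'
      exact hij (u.injective (funext h'))
    exact Finset.prod_eq_zero (Finset.mem_univ r) (if_neg hr)

/-- Matched pairs with two prescribed entries. -/
theorem exists_injective_extending {α : Type*} [DecidableEq α] {S : Finset α} {k : ℕ}
    (hS : k + 2 ≤ S.card) {x y : α} (hx : x ∈ S) (hy : y ∈ S) (hxy : x ≠ y) :
    ∃ t : Fin (k + 2) → α, Function.Injective t ∧ (∀ r, t r ∈ S) ∧ t 0 = x ∧ t 1 = y := by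
  obtain ⟨e⟩ : Nonempty (Fin k ↪ ((S.erase x).erase y : Finset α)) := by
    refine Function.Embedding.nonempty_of_card_le ?_
    rw [Fintype.card_fin, Fintype.card_coe, Finset.card_erase_of_mem (by simp [hy, hxy.symm]),
      Finset.card_erase_of_mem hx]
    omega
  have he : ∀ r, (e r : α) ≠ y ∧ (e r : α) ≠ x ∧ (e r : α) ∈ S := fun r => by
    have := (e r).2
    simpa only [Finset.mem_erase] using this
  refine ⟨Fin.cons x (Fin.cons y fun r => e r), ?_, ?_, rfl, rfl⟩
  · rw [Fin.cons_injective_iff, Fin.cons_injective_iff]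
    refine ⟨?_, ?_, fun a b h => e.injective (Subtype.ext h)⟩
    · rintro ⟨r, hr⟩
      refine Fin.cases (fun hr => hxy hr.symm) (fun r hr => (he r).2.1 hr) r hr
    · rintro ⟨r, hr⟩
      exact (he r).1 hr
  · refine Fin.cases hx (Fin.cases hy fun r => (he r).2.2)

/-- Two of the matched pairs occupy disjoint intervals of the order, so no prefix separates all
pairs and the rank across a prefix is at most `(d + 1) ^ (k + 1)`. -/
theorem sepRankLE_prod_eqPoly (s : Fin (d + 1) → F) {σ : Equiv.Perm (Fin n)} {k : ℕ}
    {t c : Fin (k + 2) → Fin n}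
    (h : max (σ.symm (t 0)) (σ.symm (c 0)) < min (σ.symm (t 1)) (σ.symm (c 1))) (j : ℕ) :
    SepRankLE ((d + 1) ^ (k + 1)) (prefixSet σ j) (∏ r, eqPoly s (t r) (c r)) := by
  refine (SepRankLE.prod Finset.univ fun r _ => sepRankLE_eqPoly s (t r) (c r) _).mono ?_
  obtain ⟨r₀, hr₀⟩ : ∃ r, (t r ∈ prefixSet σ j ↔ c r ∈ prefixSet σ j) := by
    simp only [max_lt_iff, lt_min_iff, Fin.lt_def] at h
    by_cases h0 : t 0 ∈ prefixSet σ j ↔ c 0 ∈ prefixSet σ j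
    · exact ⟨0, h0⟩
    · refine ⟨1, ?_⟩
      simp only [mem_prefixSet] at h0 ⊢
      omega
  rw [← Finset.mul_prod_erase _ _ (Finset.mem_univ r₀), if_pos hr₀, one_mul]
  refine (Finset.prod_le_pow_card _ _ (d + 1) fun r _ => ?_).trans_eq ?_
  · split_ifs <;> omega
  · simp

/-- The case of a partition with more than one variable needed on either side to exceed rank `w`:
memory for all but one of the matched pairs suffices to test that all pairs are equal. -/
theorem exists_identity_of_le (hn : 0 < n) (hw : 0 < w) {s : Fin (d + 1) → F}
    (hs : Function.Injective s) {σ : Equiv.Perm (Fin n)} {T : Finset (Fin n)} {k : ℕ}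
    (hkw : (d + 1) ^ (k + 1) ≤ w) (hwk : w < (d + 1) ^ (k + 2)) (hT : k + 2 ≤ T.card)
    (hT' : k + 2 ≤ Tᶜ.card) {a b c : Fin n} (hab : σ.symm a < σ.symm b)
    (hbc : σ.symm b < σ.symm c) (ha : a ∈ T) (hb : b ∉ T) (hc : c ∈ T) :
    ∃ (A : Fin n × Fin (d + 1) × Fin w × Fin w → F) (α β : Fin (w + 1) → Fin n → F), ∀ i j,
      matVal hw σ A (T.piecewise (α i) (β j)) = if i = j then 1 else 0 := by
  have hac : a ≠ c := fun h => absurd (hab.trans hbc) (by simp [h])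
  obtain ⟨e, heT, heb⟩ : ∃ e ∈ Tᶜ, e ≠ b := Finset.exists_mem_ne (by omega) b
  have key : ∀ {x y x' y' : Fin n}, x ∈ T → x' ∈ T → x ≠ x' → y ∈ Tᶜ → y' ∈ Tᶜ → y ≠ y' →
      max (σ.symm x) (σ.symm y) < min (σ.symm x') (σ.symm y') →
      ∃ (A : Fin n × Fin (d + 1) × Fin w × Fin w → F) (α β : Fin (w + 1) → Fin n → F), ∀ i j,
        matVal hw σ A (T.piecewise (α i) (β j)) = if i = j then 1 else 0 := by
    intro x y x' y' hx hx' hxx hy hy' hyy hlt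
    obtain ⟨t, ht, htT, ht0, ht1⟩ := exists_injective_extending hT hx hx' hxx
    obtain ⟨c, hc, hcT, hc0, hc1⟩ := exists_injective_extending hT' hy hy' hyy
    have hcT' : ∀ r, c r ∉ T := fun r => Finset.mem_compl.1 (hcT r)
    have hdeg := degreeOf_prod_eqPoly_le hs ht hc
      (fun r r' h => hcT' r' (h ▸ htT r))
    obtain ⟨A, hA⟩ := HasROABP.exists_matVal_eq hw (hasROABP_of_sepRankLE hn hw hdeg hs σ fun j =>
      (sepRankLE_prod_eqPoly s (by rw [ht0, ht1, hc0, hc1]; exact hlt) j).mono hkw)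
    obtain ⟨α, β, h⟩ := exists_points_prod_eqPoly hs (m := w + 1) hwk ht hc htT hcT'
    exact ⟨A, α, β, fun i j => by rw [hA, h]⟩
  -- A second variable `e` off `T` is matched with `a` if it precedes `b`, and with `c` otherwise.
  have hbT : b ∈ Tᶜ := Finset.mem_compl.2 hb
  rcases lt_or_gt_of_ne (fun h => heb (σ.symm.injective h) : σ.symm e ≠ σ.symm b) with h | h
  · exact key ha hc hac heT hbT heb (by simp [*, hab.trans hbc, h.trans hbc])
  · exact key ha hc hac hbT heT heb.symm
      (by simp [*, hab.trans hbc, hab.trans h])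

/-- The case of a single variable sufficing to exceed rank `w`: the middle variable takes one of
`w + 1` values, of which the left variable stores `w` and the right variable marks the last. -/
theorem exists_identity_of_lt (hn : 0 < n) (hw : 2 ≤ w) {s : Fin (d + 1) → F}
    (hs : Function.Injective s) {σ : Equiv.Perm (Fin n)} {T : Finset (Fin n)}
    (hwd : w < d + 1) {a b c : Fin n} (hab : σ.symm a < σ.symm b)
    (hbc : σ.symm b < σ.symm c) (ha : a ∈ T) (hb : b ∉ T) (hc : c ∈ T) :
    ∃ (A : Fin n × Fin (d + 1) × Fin w × Fin w → F) (α β : Fin (w + 1) → Fin n → F), ∀ i j,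
      matVal (by omega : 0 < w) σ A (T.piecewise (α i) (β j)) = if i = j then 1 else 0 := by
  have hac : a ≠ c := fun h => absurd (hab.trans hbc) (by simp [h])
  have hab' : a ≠ b := fun h => hb (h ▸ ha)
  have hbc' : b ≠ c := fun h => hb (h ▸ hc)
  let u : Fin (w + 1) → Fin w := fun l => if h : (l : ℕ) < w then ⟨l, h⟩ else ⟨0, by omega⟩
  let v : Fin (w + 1) → Fin 2 := fun l => if (l : ℕ) < w then 0 else 1
  let U : Fin w → Polynomial F := fun l => lag s (Fin.castLE (by omega) l)
  let V : Fin 2 → Polynomial F := fun l => lag s (Fin.castLE (by omega) l)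
  let B : Fin (w + 1) → Polynomial F := fun l => lag s (Fin.castLE (by omega) l)
  let f : MvPolynomial (Fin n) F := ∑ l, Polynomial.aeval (X a) (U (u l)) *
    Polynomial.aeval (X b) (B l) * Polynomial.aeval (X c) (V (v l))
  have hf : ∀ y, eval y f =
      ∑ l, (U (u l)).eval (y a) * (B l).eval (y b) * (V (v l)).eval (y c) := fun y => by
    simp [f, eval_aeval_X]
  have hdeg : ∀ z, degreeOf z f ≤ d := fun z => by
    refine (degreeOf_sum_le _ _ _).trans (Finset.sup_le fun l _ => ?_)
    refine (degreeOf_mul_le _ _ _).trans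
      ((Nat.add_le_add_right (degreeOf_mul_le _ _ _) _).trans ?_)
    have h1 := degreeOf_lag_le hs (Fin.castLE (by omega) (u l)) a z
    have h2 := degreeOf_lag_le hs (Fin.castLE (by omega) l) b z
    have h3 := degreeOf_lag_le hs (Fin.castLE (by omega) (v l)) c z
    refine (Nat.add_le_add (Nat.add_le_add h1 h2) h3).trans ?_
    split_ifs <;> simp_all
  have hrank : ∀ j, SepRankLE w (prefixSet σ j) f := fun j => by
    have hab'' : b ∈ prefixSet σ j → a ∈ prefixSet σ j := by
      simp only [mem_prefixSet, Fin.lt_def] at *; omega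
    have hbc'' : c ∈ prefixSet σ j → b ∈ prefixSet σ j := by
      simp only [mem_prefixSet, Fin.lt_def] at *; omega
    by_cases h1 : a ∈ prefixSet σ j
    · by_cases h2 : b ∈ prefixSet σ j
      · by_cases h3 : c ∈ prefixSet σ j
        · refine SepRankLE.mono (show 1 ≤ w by omega)
            ⟨fun _ g => eval g f, fun _ _ => 1, fun g h => ?_⟩
          simp [hf, h1, h2, h3]
        · refine SepRankLE.mono hw ⟨fun i g => ∑ l with v l = i,
            (U (u l)).eval (g a) * (B l).eval (g b), fun i h => (V i).eval (h c), fun g h => ?_⟩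
          simp only [hf, Finset.piecewise_eq_of_mem _ _ _ h1, Finset.piecewise_eq_of_mem _ _ _ h2,
            Finset.piecewise_eq_of_notMem _ _ _ h3]
          rw [← Finset.sum_fiberwise _ v]
          refine Finset.sum_congr rfl fun i _ => ?_
          rw [Finset.sum_mul]
          refine Finset.sum_congr rfl fun l hl => ?_
          rw [(Finset.mem_filter.1 hl).2]
      · have h3 : c ∉ prefixSet σ j := fun h => h2 (hbc'' h)
        refine ⟨fun i g => (U i).eval (g a), fun i h => ∑ l with u l = i,
          (B l).eval (h b) * (V (v l)).eval (h c), fun g h => ?_⟩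
        simp only [hf, Finset.piecewise_eq_of_mem _ _ _ h1, Finset.piecewise_eq_of_notMem _ _ _ h2,
          Finset.piecewise_eq_of_notMem _ _ _ h3]
        rw [← Finset.sum_fiberwise _ u]
        refine Finset.sum_congr rfl fun i _ => ?_
        rw [Finset.mul_sum]
        refine Finset.sum_congr rfl fun l hl => ?_
        rw [(Finset.mem_filter.1 hl).2, mul_assoc]
    · have h2 : b ∉ prefixSet σ j := fun h => h1 (hab'' h)
      have h3 : c ∉ prefixSet σ j := fun h => h2 (hbc'' h)
      refine SepRankLE.mono (show 1 ≤ w by omega)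
        ⟨fun _ _ => 1, fun _ h => eval h f, fun g h => ?_⟩
      simp [hf, h1, h2, h3]
  obtain ⟨A, hA⟩ := HasROABP.exists_matVal_eq (by omega)
    (hasROABP_of_sepRankLE hn (by omega) hdeg hs σ hrank)
  refine ⟨A, fun i => Function.update (fun _ => s (Fin.castLE (by omega) (v i))) a
    (s (Fin.castLE (by omega) (u i))), fun j _ => s (Fin.castLE (by omega) j), fun i j => ?_⟩
  rw [hA, hf]
  simp only [Finset.piecewise_eq_of_mem _ _ _ ha, Finset.piecewise_eq_of_mem _ _ _ hc,
    Finset.piecewise_eq_of_notMem _ _ _ hb, Function.update_self, Function.update_of_ne hac.symm,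
    U, V, B, eval_lag hs, (Fin.castLE_injective _).eq_iff]
  rw [Finset.sum_eq_single j (fun l _ hl => by simp [hl]) (by simp)]
  by_cases hij : i = j
  · simp [hij]
  · have : ¬ (u j = u i ∧ v j = v i) := by
      rw [Fin.ext_iff] at hij
      rintro ⟨h1, h2⟩
      have := i.2
      have := j.2
      simp only [u, v] at h1 h2
      split_ifs at h1 h2 <;> simp_all
      all_goals omega
    rw [not_and_or] at this
    rcases this with h | h <;> simp [h, hij]

/-- A set that is not a prefix contains a variable that comes after one outside the set. -/
theorem exists_inversion {σ : Equiv.Perm (Fin n)} {T : Finset (Fin n)}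
    (h : ∀ j, T ≠ prefixSet σ j) : ∃ b c, σ.symm b < σ.symm c ∧ b ∉ T ∧ c ∈ T := by
  by_contra! hcon
  by_cases hT : ∃ i : Fin n, σ i ∉ T
  · have hmin := Fin.find_spec hT
    refine h (Fin.find _ hT) ?_
    ext x
    rw [mem_prefixSet]
    constructor
    · intro hx
      by_contra hlt
      have hne : σ.symm x ≠ Fin.find _ hT := fun h' => hmin (by rw [← h']; simpa using hx)
      refine hcon _ _ ?_ hmin hx
      rw [σ.symm_apply_apply]
      exact lt_of_le_of_ne (not_lt.1 hlt) hne.symm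
    · intro hx
      by_contra hxT
      exact absurd (Fin.find_le_of_pos hT (j := σ.symm x) (by simpa using hxT)) (not_le.2 hx)
  · push Not at hT
    refine h n ?_
    ext x
    simpa [mem_prefixSet] using hT (σ.symm x)

/-- The partitions across which every product of `w × w` matrices in the order `σ` has rank at
most `w`: one side has so few variables that it is a matter of counting monomials, or one side is
a prefix of the order, or the width is one. -/
def LowRankPartition (d w : ℕ) (σ : Equiv.Perm (Fin n)) (T : Finset (Fin n)) : Prop :=
  T.card ≤ Nat.log (d + 1) w ∨ Tᶜ.card ≤ Nat.log (d + 1) w ∨ (∃ j, T = prefixSet σ j) ∨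
    (∃ j, Tᶜ = prefixSet σ j) ∨ w = 1

theorem LowRankPartition.compl {σ : Equiv.Perm (Fin n)} {T : Finset (Fin n)}
    (h : LowRankPartition d w σ T) : LowRankPartition d w σ Tᶜ := by
  unfold LowRankPartition at *
  rw [compl_compl]
  tauto

theorem LowRankPartition.sepRankLE {s : Fin (d + 1) → F} (hs : Function.Injective s)
    {σ : Equiv.Perm (Fin n)} {T : Finset (Fin n)} (h : LowRankPartition d w σ T) (hw : 0 < w)
    (A : Fin n × Fin (d + 1) × Fin w × Fin w → F) : SepRankLE w T (matPoly hw σ A) := by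
  have hcard : ∀ T : Finset (Fin n), T.card ≤ Nat.log (d + 1) w →
      SepRankLE w T (matPoly hw σ A) := fun T hT =>
    (SepRankLE.pow_card (degreeOf_matPoly_le hw σ A) hs T).mono
      ((Nat.pow_le_pow_right (by omega) hT).trans (Nat.pow_log_le_self _ hw.ne'))
  rcases h with h | h | ⟨j, rfl⟩ | ⟨j, h⟩ | rfl
  · exact hcard T h
  · simpa using (hcard _ h).compl
  · exact sepRankLE_prefixSet hw σ A j
  · simpa [← h] using (sepRankLE_prefixSet hw σ A j).compl
  · exact sepRankLE_of_width_one σ A T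

/-- For every other partition, some product of matrices has rank larger than `w`. -/
theorem exists_identity_of_not_lowRankPartition (hn : 0 < n) (hd : 0 < d) (hw : 0 < w)
    {s : Fin (d + 1) → F} (hs : Function.Injective s) {σ : Equiv.Perm (Fin n)}
    {T : Finset (Fin n)} (h : ¬ LowRankPartition d w σ T) :
    ∃ (A : Fin n × Fin (d + 1) × Fin w × Fin w → F) (α β : Fin (w + 1) → Fin n → F), ∀ i j,
      matVal hw σ A (T.piecewise (α i) (β j)) = if i = j then 1 else 0 := by
  have main : ∀ T : Finset (Fin n), ¬ LowRankPartition d w σ T → ∀ a b c : Fin n,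
      σ.symm a < σ.symm b → σ.symm b < σ.symm c → a ∈ T → b ∉ T → c ∈ T →
      ∃ (A : Fin n × Fin (d + 1) × Fin w × Fin w → F) (α β : Fin (w + 1) → Fin n → F), ∀ i j,
        matVal hw σ A (T.piecewise (α i) (β j)) = if i = j then 1 else 0 := by
    intro T hT a b c hab hbc ha hb hc
    simp only [LowRankPartition, not_or, not_le] at hT
    have hlt := Nat.lt_pow_succ_log_self (b := d + 1) (by omega) w
    have hle := Nat.pow_log_le_self (d + 1) hw.ne'
    rcases hk : Nat.log (d + 1) w with _ | k
    · rw [hk] at hlt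
      exact exists_identity_of_lt hn (by omega) hs (by simpa using hlt) hab hbc ha hb hc
    · rw [hk] at hlt hle hT
      exact exists_identity_of_le hn hw hs hle hlt hT.1 hT.2.1 hab hbc ha hb hc
  -- An inversion of `T` and one of its complement have different first elements, and together they
  -- contain three variables that alternate between the two sides.
  have hT := h
  simp only [LowRankPartition, not_or, not_exists] at hT
  obtain ⟨b, c, hbc, hb, hc⟩ := exists_inversion hT.2.2.1
  obtain ⟨b', c', hbc', hb', hc'⟩ := exists_inversion hT.2.2.2.1
  rw [Finset.mem_compl, not_not] at hb'
  rw [Finset.mem_compl] at hc'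
  have hne : σ.symm b' ≠ σ.symm b := fun h' => hb (σ.symm.injective h' ▸ hb')
  rcases lt_or_gt_of_ne hne with hlt | hlt
  · exact main T h b' b c hlt hbc hb' hb hc
  · obtain ⟨A, α, β, hA⟩ := main Tᶜ (fun h' => h (by simpa using h'.compl)) b b' c' hlt hbc'
      (by simpa using hb) (by simpa using hb') (by simpa using hc')
    refine ⟨A, β, α, fun i j => ?_⟩
    rw [← Finset.piecewise_compl, hA]
    simp [eq_comm]

end Generic

/-! ### The singularity test -/

section Elimination

variable {F : Type u} [Field F]

/-- One step of division-free Gaussian elimination without pivoting. -/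
def elimStep (M : ℕ → ℕ → F) (i j : ℕ) : F :=
  M (i + 1) (j + 1) * M 0 0 - M (i + 1) 0 * M 0 (j + 1)

/-- Elimination without pivoting on the leading `m × m` block of `M` meets a zero pivot. -/
def ZeroPivot : ℕ → (ℕ → ℕ → F) → Prop
  | 0, _ => False
  | m + 1, M => M 0 0 = 0 ∨ ZeroPivot m (elimStep M)

/-- Elimination on a singular block meets a zero pivot. -/
theorem zeroPivot_of_kernel : ∀ {m : ℕ} {M : ℕ → ℕ → F} {x : ℕ → F}, (∃ j < m, x j ≠ 0) →
    (∀ i < m, ∑ j ∈ Finset.range m, M i j * x j = 0) → ZeroPivot m M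
  | 0, M, x, ⟨j, hj, _⟩, _ => absurd hj (Nat.not_lt_zero j)
  | m + 1, M, x, ⟨j, hj, hxj⟩, hM => by
    by_cases ha : M 0 0 = 0
    · exact Or.inl ha
    have h0 := hM 0 (by omega)
    rw [Finset.sum_range_succ'] at h0
    refine Or.inr (zeroPivot_of_kernel (x := fun j => x (j + 1)) ?_ fun i hi => ?_)
    · by_contra! hx
      have hx0 : x 0 = 0 := by
        rw [Finset.sum_eq_zero fun j hj => by rw [hx j (Finset.mem_range.1 hj), mul_zero],
          zero_add] at h0
        exact (mul_eq_zero.1 h0).resolve_left ha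
      rcases j with _ | j
      · exact hxj hx0
      · exact hxj (hx j (by omega))
    · have hi := hM (i + 1) (by omega)
      rw [Finset.sum_range_succ'] at hi
      have : ∑ j ∈ Finset.range m, elimStep M i j * x (j + 1) =
          M 0 0 * ∑ j ∈ Finset.range m, M (i + 1) (j + 1) * x (j + 1) -
            M (i + 1) 0 * ∑ j ∈ Finset.range m, M 0 (j + 1) * x (j + 1) := by
        rw [Finset.mul_sum, Finset.mul_sum, ← Finset.sum_sub_distrib]
        exact Finset.sum_congr rfl fun j _ => by unfold elimStep; ring
      rw [this, eq_neg_of_add_eq_zero_left hi, eq_neg_of_add_eq_zero_left h0]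
      ring

/-- A zero pivot exhibits a singular leading block, although the whole block may be regular. -/
theorem ZeroPivot.exists_kernel : ∀ {m : ℕ} {M : ℕ → ℕ → F}, ZeroPivot m M →
    ∃ l < m, ∃ x : ℕ → F, (∃ j < l + 1, x j ≠ 0) ∧
      ∀ i < l + 1, ∑ j ∈ Finset.range (l + 1), M i j * x j = 0
  | 0, M, h => h.elim
  | m + 1, M, h => by
    by_cases ha : M 0 0 = 0
    · exact ⟨0, by omega, fun _ => 1, ⟨0, by omega, one_ne_zero⟩, fun i hi => by
        obtain rfl : i = 0 := by omega
        simp [ha]⟩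
    obtain ⟨l, hl, x, ⟨j, hj, hxj⟩, hx⟩ := (h.resolve_left ha).exists_kernel
    let x₀ : F := -(∑ j ∈ Finset.range (l + 1), M 0 (j + 1) * x j) / M 0 0
    refine ⟨l + 1, by omega, fun j => Nat.casesOn j x₀ x, ⟨j + 1, by omega, hxj⟩, fun i hi => ?_⟩
    rw [Finset.sum_range_succ']
    rcases i with _ | i
    · change ∑ j ∈ Finset.range (l + 1), M 0 (j + 1) * x j + M 0 0 * x₀ = 0
      rw [mul_div_cancel₀ _ ha, add_neg_cancel]
    · have hi := hx i (by omega)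
      have : ∑ j ∈ Finset.range (l + 1), elimStep M i j * x j =
          M 0 0 * ∑ j ∈ Finset.range (l + 1), M (i + 1) (j + 1) * x j -
            M (i + 1) 0 * ∑ j ∈ Finset.range (l + 1), M 0 (j + 1) * x j := by
        rw [Finset.mul_sum, Finset.mul_sum, ← Finset.sum_sub_distrib]
        exact Finset.sum_congr rfl fun j _ => by unfold elimStep; ring
      rw [this] at hi
      change ∑ j ∈ Finset.range (l + 1), M (i + 1) (j + 1) * x j + M (i + 1) 0 * x₀ = 0
      simp only [x₀]
      field_simp
      linear_combination hi

theorem ZeroPivot.exists_det_eq_zero {m : ℕ} {M : ℕ → ℕ → F} (h : ZeroPivot m M) :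
    ∃ l < m, (Matrix.of fun i j : Fin (l + 1) => M i j).det = 0 := by
  obtain ⟨l, hl, x, ⟨j, hj, hxj⟩, hx⟩ := h.exists_kernel
  refine ⟨l, hl, Matrix.exists_mulVec_eq_zero_iff.1 ⟨fun i => x i, fun h0 => ?_, ?_⟩⟩
  · exact hxj (congrFun h0 ⟨j, hj⟩)
  · ext i
    have := hx i i.2
    rw [← Fin.sum_univ_eq_sum_range (fun j => M i j * x j)] at this
    simpa [Matrix.mulVec, dotProduct] using this

end Elimination

section Test

variable {F : Type u} [Field F] {n d w : ℕ}

/-- The `i`-th random point for the variables inside the tested set, read off the random tape. -/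
def innerPoint (n : ℕ) {R : Type*} (ρ : ℕ → R) (i : ℕ) (x : Fin n) : R := ρ (2 * (n * i + x))

/-- The `i`-th random point for the variables outside the tested set. -/
def outerPoint (n : ℕ) {R : Type*} (ρ : ℕ → R) (i : ℕ) (x : Fin n) : R := ρ (2 * (n * i + x) + 1)

/-- The matrix of values of `f` at the points combined from an inner and an outer one. -/
noncomputable def testMatrix (f : MvPolynomial (Fin n) F) (ρ : ℕ → F) (T : Finset (Fin n))
    (i j : ℕ) : F :=
  MvPolynomial.eval (T.piecewise (innerPoint n ρ i) (outerPoint n ρ j)) f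

/-- The randomized test for rank at most `w` across the partition into `T` and its complement. The
same points serve for all `T`. -/
def Passes (w : ℕ) (f : MvPolynomial (Fin n) F) (ρ : ℕ → F) (T : Finset (Fin n)) : Prop :=
  ZeroPivot (w + 1) (testMatrix f ρ T)

/-- Partitions of rank at most `w` are always accepted, since the test matrix has size `w + 1`. -/
theorem SepRankLE.passes {f : MvPolynomial (Fin n) F} {T : Finset (Fin n)}
    (h : SepRankLE w T f) (ρ : ℕ → F) : Passes w f ρ T := by
  obtain ⟨u, v, huv⟩ := h
  let L : (Fin (w + 1) → F) →ₗ[F] (Fin w → F) :=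
    Matrix.toLin' (Matrix.of fun a (j : Fin (w + 1)) => v a (outerPoint n ρ j))
  obtain ⟨x, hx, hx0⟩ := Submodule.exists_mem_ne_zero_of_ne_bot
    (LinearMap.ker_ne_bot_of_finrank_lt (f := L) (by simp))
  obtain ⟨j, hj⟩ := Function.ne_iff.1 hx0
  have hL : ∀ a, ∑ j : Fin (w + 1), v a (outerPoint n ρ j) * x j = 0 := fun a => by
    simpa [L, Matrix.mulVec, dotProduct] using congrFun (LinearMap.mem_ker.1 hx) a
  refine zeroPivot_of_kernel (x := fun j => if h : j < w + 1 then x ⟨j, h⟩ else 0)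
    ⟨j, j.2, by simpa [Nat.lt_succ_iff.1 j.2] using hj⟩ fun i _ => ?_
  rw [← Fin.sum_univ_eq_sum_range
    (fun j => testMatrix f ρ T i j * if h : j < w + 1 then x ⟨j, h⟩ else 0)]
  simp only [testMatrix, huv, Fin.is_lt, dite_true, Fin.eta, Finset.sum_mul]
  rw [Finset.sum_comm]
  refine Finset.sum_eq_zero fun a _ => ?_
  simp only [mul_assoc, ← Finset.mul_sum, hL, mul_zero]

/-- The outcomes for which the test only accepts partitions that always have rank at most `w`. -/
def TestSound (hw : 0 < w) (σ : Equiv.Perm (Fin n))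
    (A : Fin n × Fin (d + 1) × Fin w × Fin w → F) (ρ : ℕ → F) : Prop :=
  ∀ T, Passes w (matPoly hw σ A) ρ T → LowRankPartition d w σ T

/-- The number of draws used by the test. -/
def tapeLength (n w : ℕ) : ℕ := 2 * (n * (w + 1))

/-- The inner and the outer points are read off disjoint parts of the tape. -/
theorem exists_tape (α β : Fin (w + 1) → Fin n → F) : ∃ ρ : ℕ → F, ∀ i : Fin (w + 1),
    innerPoint n ρ i = α i ∧ outerPoint n ρ i = β i := by
  refine ⟨fun m => if h : m / 2 / n < w + 1 ∧ m / 2 % n < n then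
    (if m % 2 = 0 then α else β) ⟨_, h.1⟩ ⟨_, h.2⟩ else 0, fun i => ⟨?_, ?_⟩⟩ <;>
  · ext x
    have hn : 0 < n := x.pos
    have h1 : (n * i + x : ℕ) / n = i := by
      rw [Nat.mul_add_div hn, Nat.div_eq_of_lt x.2, add_zero]
    have h2 : (n * i + x : ℕ) % n = x := by
      rw [Nat.mul_add_mod, Nat.mod_eq_of_lt x.2]
    have h3 : (2 * (n * i + x : ℕ) + 1) / 2 = n * i + x := by omega
    have h4 : (2 * (n * i + x : ℕ) + 1) % 2 = 1 := by omega
    simp [innerPoint, outerPoint, h1, h2, h3, h4, Nat.lt_succ_iff.1 i.2]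

theorem index_lt_tapeLength {i : ℕ} (hi : i < w + 1) (x : Fin n) :
    2 * (n * i + x) + 1 < tapeLength n w := by
  have h1 : n * (i + 1) ≤ n * (w + 1) := Nat.mul_le_mul_left n hi
  have := x.2
  rw [mul_add] at h1
  unfold tapeLength
  omega

theorem testMatrix_congr {f : MvPolynomial (Fin n) F} {T : Finset (Fin n)} {ρ ρ' : ℕ → F}
    (h : ∀ m < tapeLength n w, ρ m = ρ' m) {i j : ℕ} (hi : i < w + 1) (hj : j < w + 1) :
    testMatrix f ρ T i j = testMatrix f ρ' T i j := by
  have h1 : innerPoint n ρ i = innerPoint n ρ' i := funext fun x =>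
    h _ (by have := index_lt_tapeLength hi x; omega)
  have h2 : outerPoint n ρ j = outerPoint n ρ' j := funext fun x =>
    h _ (index_lt_tapeLength hj x)
  rw [testMatrix, h1, h2, testMatrix]

end Test

section MinorProd

open MvPolynomial

variable {F : Type u} [Field F] {n d w : ℕ}

/-- The variables that stand for the matrix entries and for the draws on the tape. One superfluous
draw makes the index type of the draws nonempty by its form. -/
abbrev RandVar (n d w : ℕ) : Type :=
  (Fin n × Fin (d + 1) × Fin w × Fin w) ⊕ Fin (tapeLength n w + 1)

/-- The tape of variables; only its entries below `tapeLength n w` matter, and `Fin.ofNat` reduces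
the others. -/
def tapeVar (n d w : ℕ) (m : ℕ) : RandVar n d w := Sum.inr (Fin.ofNat _ m)

/-- The product of the leading minors of the test matrix, as a polynomial in the matrix entries and
the draws. It vanishes at the outcomes for which the test accepts `T`. -/
noncomputable def minorProd (F : Type u) [Field F] (hw : 0 < w) (σ : Equiv.Perm (Fin n))
    (d : ℕ) (T : Finset (Fin n)) : MvPolynomial (RandVar n d w) F :=
  ∏ l ∈ Finset.range (w + 1), (Matrix.of fun i j : Fin (l + 1) =>
    matVal hw σ (fun x => X (Sum.inl x)) fun x =>
      X (T.piecewise (innerPoint n (tapeVar n d w) i) (outerPoint n (tapeVar n d w) j) x)).det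

theorem eval_minorProd (hw : 0 < w) (σ : Equiv.Perm (Fin n)) (T : Finset (Fin n))
    (r : RandVar n d w → F) {ρ : ℕ → F}
    (hρ : ∀ m < tapeLength n w, ρ m = r (tapeVar n d w m)) :
    eval r (minorProd F hw σ d T) = ∏ l ∈ Finset.range (w + 1), (Matrix.of fun i j : Fin (l + 1) =>
      testMatrix (matPoly hw σ fun x => r (Sum.inl x)) ρ T i j).det := by
  rw [minorProd, map_prod]
  refine Finset.prod_congr rfl fun l hl => ?_
  rw [RingHom.map_det]
  congr 1
  ext i j
  have hl := Finset.mem_range.1 hl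
  rw [Matrix.of_apply, testMatrix_congr hρ (lt_of_lt_of_le i.2 hl) (lt_of_lt_of_le j.2 hl),
    testMatrix, eval_matPoly, RingHom.mapMatrix_apply, Matrix.map_apply, Matrix.of_apply,
    map_matVal]
  congr 1
  · ext x; simp
  · ext x
    by_cases hx : x ∈ T <;> simp [hx, innerPoint, outerPoint]

theorem totalDegree_det_le {V : Type*} {l D : ℕ} (M : Matrix (Fin l) (Fin l) (MvPolynomial V F))
    (hM : ∀ i j, (M i j).totalDegree ≤ D) : M.det.totalDegree ≤ l * D := by
  rw [Matrix.det_apply]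
  refine (totalDegree_finsetSum _ _).trans (Finset.sup_le fun p _ => ?_)
  have : ∀ z : ℤˣ, ∀ q : MvPolynomial V F, (z • q).totalDegree = q.totalDegree := fun z q => by
    rcases Int.units_eq_one_or z with rfl | rfl <;> simp
  rw [this]
  refine (totalDegree_finsetProd _ _).trans ((Finset.sum_le_sum fun i _ => hM _ _).trans_eq ?_)
  simp

theorem totalDegree_minorProd_le (hw : 0 < w) (σ : Equiv.Perm (Fin n)) (T : Finset (Fin n)) :
    2 * (minorProd F hw σ d T).totalDegree ≤ (w + 1) * (w + 2) * (n * (d + 1)) := by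
  have h : (minorProd F hw σ d T).totalDegree ≤
      ∑ l ∈ Finset.range (w + 1), (l + 1) * (n * (d + 1)) :=
    (totalDegree_finsetProd _ _).trans (Finset.sum_le_sum fun l _ =>
      totalDegree_det_le _ fun i j => totalDegree_matVal_X_le hw σ _ _)
  rw [← Finset.sum_mul] at h
  have h2 : ∀ m, 2 * ∑ l ∈ Finset.range m, (l + 1) = m * (m + 1) := fun m => by
    induction m with
    | zero => simp
    | succ m ih => rw [Finset.sum_range_succ, mul_add, ih]; ring
  calc _ ≤ 2 * ((∑ l ∈ Finset.range (w + 1), (l + 1)) * (n * (d + 1))) :=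
        Nat.mul_le_mul_left 2 h
    _ = _ := by rw [← mul_assoc, h2]

/-- At the identity matrices of `exists_identity_of_not_lowRankPartition` all minors are one. -/
theorem minorProd_ne_zero (hn : 0 < n) (hd : 0 < d) (hw : 0 < w) {s : Fin (d + 1) → F}
    (hs : Function.Injective s) {σ : Equiv.Perm (Fin n)} {T : Finset (Fin n)}
    (h : ¬ LowRankPartition d w σ T) : minorProd F hw σ d T ≠ 0 := by
  obtain ⟨A, α, β, hA⟩ := exists_identity_of_not_lowRankPartition hn hd hw hs h
  obtain ⟨ρ, hρ⟩ := exists_tape α β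
  intro h0
  have h1 := eval_minorProd (d := d) hw σ T (Sum.elim A fun i => ρ i) (ρ := ρ) fun m hm => by
    simp only [tapeVar, Sum.elim_inr, Fin.val_ofNat]
    rw [Nat.mod_eq_of_lt (by omega)]
  rw [h0, map_zero, Finset.prod_congr rfl (g := fun _ => 1) fun l hl => ?_] at h1
  · simp at h1
  · have hl := Finset.mem_range.1 hl
    rw [← Matrix.det_one (n := Fin (l + 1))]
    congr 1
    ext i j
    have hi := hA ⟨i, lt_of_lt_of_le i.2 hl⟩ ⟨j, lt_of_lt_of_le j.2 hl⟩
    rw [← (hρ _).1, ← (hρ _).2] at hi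
    simp only [Matrix.of_apply, testMatrix, eval_matPoly, Sum.elim_inl, Matrix.one_apply]
    simpa [Fin.ext_iff] using hi

theorem eval_minorProd_eq_zero (hw : 0 < w) {σ : Equiv.Perm (Fin n)} {T : Finset (Fin n)}
    (r : RandVar n d w → F) {ρ : ℕ → F}
    (hρ : ∀ m < tapeLength n w, ρ m = r (tapeVar n d w m))
    (h : Passes w (matPoly hw σ fun x => r (Sum.inl x)) ρ T) :
    eval r (minorProd F hw σ d T) = 0 := by
  obtain ⟨l, hl, h0⟩ := ZeroPivot.exists_det_eq_zero h
  rw [eval_minorProd hw σ T r hρ]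
  exact Finset.prod_eq_zero (Finset.mem_range.2 hl) h0

end MinorProd

/-! ### The probability that the test is sound -/

section Probability

variable {F : Type u} {n d w : ℕ}

theorem uniform_singleton {S : Finset F} (hS : S.Nonempty) (x : Draw S) :
    uniform S hS {x} = (S.card : ENNReal)⁻¹ := by
  have : Nonempty (Draw S) := Draw.nonempty hS
  have : MeasurableSingletonClass (Draw S) := ⟨fun _ => trivial⟩
  unfold uniform
  rw [PMF.toMeasure_apply_singleton _ _ (measurableSet_singleton x), PMF.uniformOfFintype_apply]
  congr 2
  exact Fintype.card_coe S

open MvPolynomial in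
/-- The Schwartz-Zippel lemma for an arbitrary finite set of variables. -/
theorem card_zeros_mul_card_le [Field F] {V : Type*} [Fintype V] [DecidableEq V]
    {p : MvPolynomial V F} (hp : p ≠ 0) {S : Finset F} (hS : S.Nonempty) (B : Finset (V → Draw S))
    (hB : ∀ r ∈ B, eval (fun x => (r x).1) p = 0) :
    B.card * S.card ≤ p.totalDegree * S.card ^ Fintype.card V := by
  classical
  let e := Fintype.equivFin V
  have hp' : rename e p ≠ 0 := fun h => hp (rename_injective e e.injective (by simpa using h))
  have hsz := schwartz_zippel_totalDegree hp' S
  have hS0 : (0 : ℚ≥0) < S.card := by exact_mod_cast hS.card_pos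
  rw [div_le_div_iff₀ (by positivity) hS0] at hsz
  have hdeg : (rename e p).totalDegree ≤ p.totalDegree := totalDegree_rename_le _ _
  have hcard : B.card ≤ (Finset.filter (fun g => eval g (rename e p) = 0)
      (Fintype.piFinset fun _ : Fin (Fintype.card V) => S)).card := by
    refine Finset.card_le_card_of_injOn (fun r i => (r (e.symm i)).1) (fun r hr => ?_) ?_
    · simp only [Finset.coe_filter, Fintype.mem_piFinset, Set.mem_ofPred_eq]
      refine ⟨fun i => (r _).2, ?_⟩
      rw [eval_rename, ← hB r hr]
      congr 2
      ext x
      simp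
    · intro r _ r' _ h
      ext x
      have := congrFun h (e x)
      simp only [Equiv.symm_apply_apply] at this
      exact Subtype.ext this
  have hsz' : (Finset.filter (fun g => eval g (rename e p) = 0)
      (Fintype.piFinset fun _ : Fin (Fintype.card V) => S)).card * S.card ≤
      (rename e p).totalDegree * S.card ^ Fintype.card V := by exact_mod_cast hsz
  exact (Nat.mul_le_mul_right _ hcard).trans (hsz'.trans (Nat.mul_le_mul_right _ hdeg))

/-- The matrix entries and the part of the tape that is used by the test. -/
def usedDraws {S : Finset F} (ω : Entries S n d w × (ℕ → Draw S)) : RandVar n d w → Draw S :=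
  Sum.elim ω.1 fun i => ω.2 i

theorem law_usedDraws_eq {S : Finset F} (hS : S.Nonempty) (r : RandVar n d w → Draw S) :
    law S hS n d w {ω | usedDraws ω = r} =
      ((S.card : ENNReal)⁻¹) ^ Fintype.card (RandVar n d w) := by
  have : MeasurableSingletonClass (Draw S) := ⟨fun _ => trivial⟩
  have hset : {ω : Entries S n d w × (ℕ → Draw S) | usedDraws ω = r} =
      {fun x => r (Sum.inl x)} ×ˢ Set.pi (Finset.range (tapeLength n w + 1))
        (fun m => {r (tapeVar n d w m)}) := by
    ext ω
    simp only [Set.mem_ofPred_eq, Set.mem_prod, Set.mem_singleton_iff, Set.mem_pi,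
      Finset.coe_range, Set.mem_Iio]
    constructor
    · rintro rfl
      refine ⟨rfl, fun m hm => ?_⟩
      simp [usedDraws, tapeVar, Nat.mod_eq_of_lt hm]
    · rintro ⟨h1, h2⟩
      ext x
      rcases x with x | i
      · exact congrFun h1 x
      · have := h2 i i.2
        simp only [tapeVar, Fin.ofNat_val_eq_self] at this
        exact this
  rw [hset, law, Measure.prod_prod, Measure.infinitePi_pi _ fun _ _ => measurableSet_singleton _,
    Measure.pi_singleton]
  simp only [uniform_singleton, Finset.prod_const, Finset.card_univ, Finset.card_range,
    Fintype.card_sum, Fintype.card_fin, pow_add]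

theorem law_real_le {S : Finset F} (hS : S.Nonempty) (B : Finset (RandVar n d w → Draw S)) :
    (law S hS n d w).real {ω | usedDraws ω ∈ B} ≤
      B.card / (S.card : ℝ) ^ Fintype.card (RandVar n d w) := by
  have hset : {ω : Entries S n d w × (ℕ → Draw S) | usedDraws ω ∈ B} =
      ⋃ r ∈ B, {ω | usedDraws ω = r} := by
    ext ω; simp
  rw [hset]
  refine (measureReal_biUnion_finset_le _ _).trans_eq ?_
  simp only [measureReal_def, law_usedDraws_eq, Finset.sum_const, nsmul_eq_mul,
    ENNReal.toReal_pow, ENNReal.toReal_inv, ENNReal.toReal_natCast, inv_pow]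
  rfl

/-- The union bound over the `2 ^ n` sets `T` of the probabilities that `minorProd` vanishes. -/
theorem le_law_testSound [Field F] {S : Finset F} (hS : S.Nonempty) (hn : 0 < n) (hd : 0 < d)
    (hw : 0 < w) (σ : Equiv.Perm (Fin n)) (hcard : 2 ^ (2 * n + 1) * (n * d * w ^ 2) ≤ S.card)
    {s : Fin (d + 1) → F} (hs : Function.Injective s) :
    1 - 1 / (2 : ℝ) ^ (n - 1) ≤ (law S hS n d w).real
      {ω | TestSound hw σ (fun x => (ω.1 x).1) fun i => (ω.2 i).1} := by
  classical
  have : IsProbabilityMeasure (law S hS n d w) := by unfold law; infer_instance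
  let L := law S hS n d w
  let G := {ω : Entries S n d w × (ℕ → Draw S) |
    TestSound hw σ (fun x => (ω.1 x).1) fun i => (ω.2 i).1}
  -- The degree bound below needs `2 ≤ w`; for width one every partition has low rank.
  by_cases hw1 : w = 1
  · have hG : G = Set.univ := Set.eq_univ_of_forall fun ω T _ =>
      Or.inr (Or.inr (Or.inr (Or.inr hw1)))
    change _ ≤ L.real G
    rw [hG, probReal_univ]
    simp
  let B : Finset (RandVar n d w → Draw S) := Finset.univ.filter fun r =>
    ∃ T, ¬ LowRankPartition d w σ T ∧
      MvPolynomial.eval (fun x => (r x).1) (minorProd F hw σ d T) = 0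
  have hGB : Set.univ ⊆ G ∪ {ω | usedDraws ω ∈ B} := by
    intro ω _
    by_cases hω : ω ∈ G
    · exact Or.inl hω
    refine Or.inr ?_
    simp only [G, TestSound, Set.mem_ofPred_eq, not_forall] at hω
    obtain ⟨T, hT, hlow⟩ := hω
    refine Finset.mem_filter.2 ⟨Finset.mem_univ _, T, hlow, ?_⟩
    refine eval_minorProd_eq_zero hw (fun x => (usedDraws ω x).1)
      (ρ := fun i => (ω.2 i).1) (fun m hm => ?_) hT
    simp only [usedDraws, tapeVar, Sum.elim_inr, Fin.val_ofNat]
    rw [Nat.mod_eq_of_lt (by omega)]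
  set M := Fintype.card (RandVar n d w)
  have hB : 2 ^ n * B.card ≤ 2 * S.card ^ M := by
    have hD : ∀ T, 2 ^ (2 * n + 1) * (minorProd F hw σ d T).totalDegree ≤ 4 * S.card := by
      intro T
      have h1 := totalDegree_minorProd_le (F := F) (d := d) hw σ T
      have h2 : (w + 1) * (w + 2) * (n * (d + 1)) ≤ 8 * (n * d * w ^ 2) := by
        have e1 : (w + 1) * (w + 2) ≤ 3 * w ^ 2 := by
          have : 2 ≤ w := by omega
          nlinarith
        have e2 : n * (d + 1) ≤ n * (2 * d) := Nat.mul_le_mul_left n (by omega)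
        calc _ ≤ 3 * w ^ 2 * (n * (2 * d)) := Nat.mul_le_mul e1 e2
          _ = 6 * (n * d * w ^ 2) := by ring
          _ ≤ _ := Nat.mul_le_mul_right _ (by norm_num)
      calc _ ≤ 2 ^ (2 * n + 1) * (4 * (n * d * w ^ 2)) := Nat.mul_le_mul_left _ (by omega)
        _ = 4 * (2 ^ (2 * n + 1) * (n * d * w ^ 2)) := by ring
        _ ≤ _ := Nat.mul_le_mul_left 4 hcard
    have hBT : ∀ T : Finset (Fin n), ¬ LowRankPartition d w σ T →
        2 ^ (2 * n + 1) * (Finset.univ.filter fun r : RandVar n d w → Draw S =>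
          MvPolynomial.eval (fun x => (r x).1) (minorProd F hw σ d T) = 0).card ≤
          4 * S.card ^ M := by
      intro T hT
      have h1 := card_zeros_mul_card_le (minorProd_ne_zero hn hd hw hs hT) hS
        (Finset.univ.filter fun r : RandVar n d w → Draw S =>
          MvPolynomial.eval (fun x => (r x).1) (minorProd F hw σ d T) = 0)
        (fun r hr => (Finset.mem_filter.1 hr).2)
      refine Nat.le_of_mul_le_mul_right ?_ hS.card_pos
      calc _ ≤ 2 ^ (2 * n + 1) * ((minorProd F hw σ d T).totalDegree * S.card ^ M) := by
            rw [mul_assoc]; exact Nat.mul_le_mul_left _ h1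
        _ = 2 ^ (2 * n + 1) * (minorProd F hw σ d T).totalDegree * S.card ^ M := by ring
        _ ≤ 4 * S.card * S.card ^ M := Nat.mul_le_mul_right _ (hD T)
        _ = _ := by ring
    have hsub : B ⊆ (Finset.univ.filter fun T => ¬ LowRankPartition d w σ T).biUnion fun T =>
        Finset.univ.filter fun r : RandVar n d w → Draw S =>
          MvPolynomial.eval (fun x => (r x).1) (minorProd F hw σ d T) = 0 := by
      intro r hr
      obtain ⟨T, hT, h0⟩ := (Finset.mem_filter.1 hr).2
      exact Finset.mem_biUnion.2 ⟨T, by simp [hT], by simp [h0]⟩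
    have hle := (Finset.card_le_card hsub).trans Finset.card_biUnion_le
    have : 2 ^ (2 * n + 1) * B.card ≤ 2 ^ n * (4 * S.card ^ M) := by
      refine (Nat.mul_le_mul_left _ hle).trans ?_
      rw [Finset.mul_sum]
      refine (Finset.sum_le_card_nsmul _ _ _ fun T hT => hBT T (Finset.mem_filter.1 hT).2).trans ?_
      refine Nat.mul_le_mul_right _ ((Finset.card_filter_le _ _).trans ?_)
      simp
    refine Nat.le_of_mul_le_mul_left (c := 2 * 2 ^ n) ?_ (by positivity)
    calc _ = 2 ^ (2 * n + 1) * B.card := by ring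
      _ ≤ _ := this
      _ = _ := by ring
  have hBr : L.real {ω | usedDraws ω ∈ B} ≤ 1 / (2 : ℝ) ^ (n - 1) := by
    refine (law_real_le hS B).trans ?_
    have hS0 : (0 : ℝ) < S.card := by exact_mod_cast hS.card_pos
    rw [div_le_div_iff₀ (by positivity) (by positivity), one_mul]
    have hB' : (2 : ℝ) ^ n * B.card ≤ 2 * (S.card : ℝ) ^ M := by exact_mod_cast hB
    obtain ⟨m, rfl⟩ : ∃ m, n = m + 1 := ⟨n - 1, by omega⟩
    rw [pow_succ] at hB'
    rw [Nat.add_sub_cancel]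
    linarith
  have h1 : L.real Set.univ ≤ L.real G + L.real {ω | usedDraws ω ∈ B} :=
    (measureReal_mono hGB).trans (measureReal_union_le _ _)
  rw [probReal_univ] at h1
  change _ ≤ L.real G
  linarith

end Probability

/-! ### Reasoning about programs -/

section Logic

variable {F : Type u} [Field F] {q : Val F → F} {ρ : ℕ → F}

/-- The program `c`, started in `s`, halts in a state `s'` after a time `t` with `Q s' t`. -/
def WP (q : Val F → F) (ρ : ℕ → F) (c : Prog) (s : State F) (Q : State F → ℕ → Prop) : Prop :=
  ∃ s' t, Exec q ρ c s s' t ∧ Q s' t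

theorem WP.mono {c : Prog} {s : State F} {Q Q' : State F → ℕ → Prop} (h : WP q ρ c s Q)
    (hQ : ∀ s' t, Q s' t → Q' s' t) : WP q ρ c s Q' := by
  obtain ⟨s', t, he, h⟩ := h
  exact ⟨s', t, he, hQ _ _ h⟩

theorem WP.assign {x : ℕ} {e : Expr} {s : State F} {Q : State F → ℕ → Prop}
    (h : Q (s.set x (e.eval s.store)) (e.cost + 1)) : WP q ρ (.assign x e) s Q :=
  ⟨_, _, .assign x e s, h⟩

theorem WP.query {x : ℕ} {e : Expr} {s : State F} {Q : State F → ℕ → Prop}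
    (h : Q (s.set x (.fld (q (e.eval s.store)))) (e.cost + 1)) : WP q ρ (.query x e) s Q :=
  ⟨_, _, .query x e s, h⟩

theorem WP.seq {c₁ c₂ : Prog} {s : State F} {Q : State F → ℕ → Prop}
    (h : WP q ρ c₁ s fun s' t => WP q ρ c₂ s' fun s'' t' => Q s'' (t + t')) :
    WP q ρ (.seq c₁ c₂) s Q := by
  obtain ⟨s', t, h₁, s'', t', h₂, h⟩ := h
  exact ⟨s'', _, .seq h₁ h₂, h⟩

theorem WP.ite {e : Expr} {c₁ c₂ : Prog} {s : State F} {Q : State F → ℕ → Prop}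
    (h₁ : e.eval s.store ≠ .nil → WP q ρ c₁ s fun s' t => Q s' (e.cost + 1 + t))
    (h₂ : e.eval s.store = .nil → WP q ρ c₂ s fun s' t => Q s' (e.cost + 1 + t)) :
    WP q ρ (.ite e c₁ c₂) s Q := by
  by_cases h : e.eval s.store = .nil
  · obtain ⟨s', t, he, hQ⟩ := h₂ h
    exact ⟨s', _, .ite_false h he, hQ⟩
  · obtain ⟨s', t, he, hQ⟩ := h₁ h
    exact ⟨s', _, .ite_true h he, hQ⟩

/-- Loops with a variant: each round takes time at most `B` and decreases `k`. -/
theorem WP.while_variant {e : Expr} {c : Prog} {B : ℕ} (I : ℕ → State F → Prop)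
    (hI : ∀ k s, I k s → e.eval s.store ≠ .nil →
      ∃ k' < k, WP q ρ c s fun s' t => t ≤ B ∧ I k' s') :
    ∀ {k : ℕ} {s : State F}, I k s → WP q ρ (.while e c) s fun s' t =>
      t ≤ k * (B + e.cost + 1) + e.cost + 1 ∧ (∃ k', I k' s') ∧ e.eval s'.store = .nil := by
  intro k
  induction k using Nat.strong_induction_on with
  | _ k ih =>
    intro s h
    by_cases he : e.eval s.store = .nil
    · exact ⟨s, _, .while_false he, by omega, ⟨k, h⟩, he⟩
    obtain ⟨k', hk', s', t, hex, ht, hI'⟩ := hI k s h he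
    obtain ⟨s'', t', hex', ht', hI'', he'⟩ := ih k' hk' hI'
    refine ⟨s'', _, .while_true he hex hex', ?_, hI'', he'⟩
    have : (k' + 1) * (B + e.cost + 1) ≤ k * (B + e.cost + 1) := Nat.mul_le_mul_right _ hk'
    rw [add_mul, one_mul] at this
    omega

/-- Loops that run for exactly `m` rounds. -/
theorem WP.while_count {e : Expr} {c : Prog} {B : ℕ} (I : ℕ → State F → Prop)
    (h0 : ∀ s, I 0 s → e.eval s.store = .nil)
    (hI : ∀ k s, I (k + 1) s → e.eval s.store ≠ .nil ∧
      WP q ρ c s fun s' t => t ≤ B ∧ I k s') {m : ℕ} {s : State F} (h : I m s) :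
    WP q ρ (.while e c) s fun s' t => t ≤ m * (B + e.cost + 1) + e.cost + 1 ∧ I 0 s' := by
  refine (WP.while_variant (B := B) I (fun k s hk he => ?_) h).mono ?_
  · rcases k with _ | k
    · exact absurd (h0 s hk) he
    · exact ⟨k, Nat.lt_succ_self k, (hI k s hk).2⟩
  · rintro s' t ⟨ht, ⟨k, hk⟩, he⟩
    refine ⟨ht, ?_⟩
    rcases k with _ | k
    · exact hk
    · exact absurd he (hI k s' hk).1

end Logic

section Store

variable {F : Type u}

@[simp]
theorem State.set_store_self (s : State F) (x : ℕ) (v : Val F) : (s.set x v).store x = v := by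
  simp [State.set]

theorem State.set_store_of_ne (s : State F) {x y : ℕ} (v : Val F) (h : y ≠ x) :
    (s.set x v).store y = s.store y := by
  simp [State.set, h]

@[simp]
theorem State.set_pos (s : State F) (x : ℕ) (v : Val F) : (s.set x v).pos = s.pos := rfl

/-- The states agree on the variables below `m` and on the position on the tape. Each subroutine
uses variables above those of its callers, so that this describes what it preserves. -/
def SameBelow (m : ℕ) (s s' : State F) : Prop :=
  (∀ v < m, s'.store v = s.store v) ∧ s'.pos = s.pos

theorem SameBelow.refl (m : ℕ) (s : State F) : SameBelow m s s := ⟨fun _ _ => rfl, rfl⟩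

theorem SameBelow.trans {m : ℕ} {s s' s'' : State F} (h : SameBelow m s s')
    (h' : SameBelow m s' s'') : SameBelow m s s'' :=
  ⟨fun v hv => (h'.1 v hv).trans (h.1 v hv), h'.2.trans h.2⟩

theorem SameBelow.mono {m m' : ℕ} {s s' : State F} (h : SameBelow m s s') (hm : m' ≤ m) :
    SameBelow m' s s' :=
  ⟨fun v hv => h.1 v (by omega), h.2⟩

theorem SameBelow.set {m : ℕ} {s s' : State F} (h : SameBelow m s s') {x : ℕ} (hx : m ≤ x)
    (v : Val F) : SameBelow m s (s'.set x v) :=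
  ⟨fun y hy => by rw [State.set_store_of_ne _ _ (by omega), h.1 y hy], h.2⟩

theorem WP.sample [Field F] {q : Val F → F} {ρ : ℕ → F} {x : ℕ} {s : State F}
    {Q : State F → ℕ → Prop} (h : Q ⟨(s.set x (.fld (ρ s.pos))).store, s.pos + 1⟩ 1) :
    WP q ρ (.sample x) s Q :=
  ⟨_, _, .sample x s, h⟩

end Store

/-! ### Lists and tables as data -/

section Tables

variable {α : Type*}

/-- The list `[g 0, …, g (n - 1)]`. -/
def up (g : ℕ → α) (n : ℕ) : List α := (List.range n).map g

/-- The list `[g (n - 1), …, g 0]`; loops that push results on a list turn one form into the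
other. -/
def down (g : ℕ → α) : ℕ → List α
  | 0 => []
  | n + 1 => g n :: down g n

theorem up_succ (g : ℕ → α) (n : ℕ) : up g (n + 1) = g 0 :: up (fun i => g (i + 1)) n := by
  simp [up, List.range_succ_eq_map, Function.comp_def]

theorem up_drop {g : ℕ → α} {n k : ℕ} (h : k < n) :
    (up g n).drop k = g k :: (up g n).drop (k + 1) := by
  rw [List.drop_eq_getElem_cons (by simpa [up] using h)]
  simp [up]

theorem up_drop_self (g : ℕ → α) (n : ℕ) : (up g n).drop n = [] :=
  List.drop_of_length_le (by simp [up])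

theorem length_down (g : ℕ → α) (n : ℕ) : (down g n).length = n := by
  induction n with
  | zero => rfl
  | succ n ih => simp [down, ih]

theorem down_reverse (g : ℕ → α) (n : ℕ) : (down g n).reverse = up g n := by
  induction n with
  | zero => rfl
  | succ n ih => rw [down, List.reverse_cons, ih]; simp [up, List.range_succ]

theorem down_congr {g g' : ℕ → α} {n : ℕ} (h : ∀ i < n, g i = g' i) : down g n = down g' n := by
  induction n with
  | zero => rfl
  | succ n ih => rw [down, down, h n (by omega), ih fun i hi => h i (by omega)]

theorem down_const (a : α) (n : ℕ) : down (fun _ => a) n = List.replicate n a := by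
  induction n with
  | zero => rfl
  | succ n ih => rw [down, ih, List.replicate_succ]

end Tables

section Data

variable {F : Type u}

@[simp] theorem Val.hd_cons (a b : Val F) : (Val.cons a b).hd = a := rfl
@[simp] theorem Val.tl_cons (a b : Val F) : (Val.cons a b).tl = b := rfl
@[simp] theorem Val.toField_fld [Zero F] (a : F) : (Val.fld a).toField = a := rfl
@[simp] theorem Val.ofList_nil : (Val.ofList [] : Val F) = .nil := rfl
@[simp] theorem Val.ofList_cons (v : Val F) (l : List (Val F)) :
    Val.ofList (v :: l) = .cons v (Val.ofList l) := rfl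
@[simp] theorem Val.num_zero : (Val.num 0 : Val F) = .nil := rfl
theorem Val.num_succ (k : ℕ) : (Val.num (k + 1) : Val F) = .cons .nil (Val.num k) := rfl

theorem Val.entry_ofList (l : List (Val F)) (i : ℕ) :
    (Val.ofList l).entry i = l.getD i .nil := by
  unfold Val.entry
  induction l generalizing i with
  | nil =>
    have : ∀ i, Val.tl^[i] (Val.nil : Val F) = .nil := fun i => by
      induction i with
      | zero => rfl
      | succ i ih => rw [Function.iterate_succ_apply]; exact ih
    simp [this, Val.hd]
  | cons v l ih =>
    rcases i with _ | i
    · rfl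
    · rw [Function.iterate_succ_apply]
      simpa using ih i

/-- The two truth values; `nil` is false. -/
def bitVal (b : Bool) : Val F := if b then .cons .nil .nil else .nil

end Data

/-! ### The test as a program -/

section Subroutines

variable {F : Type u} [Field F] {q : Val F → F} {ρ : ℕ → F}

/-- Prepends the reversal of the list in `a` to the list in `b`. -/
def revOnto (a b : ℕ) : Prog :=
  .while (.var a) (.seq (.assign b (.cons (.hd (.var a)) (.var b))) (.assign a (.tl (.var a))))

theorem wp_revOnto {a b : ℕ} (hab : a ≠ b) {s : State F} {l l' : List (Val F)}
    (ha : s.store a = .ofList l) (hb : s.store b = .ofList l') :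
    WP q ρ (revOnto a b) s fun s' t => t ≤ l.length * 10 + 2 ∧
      s'.store b = .ofList (l.reverse ++ l') ∧
      (∀ v, v ≠ a → v ≠ b → s'.store v = s.store v) ∧ s'.pos = s.pos := by
  have hmain := WP.while_count (q := q) (ρ := ρ) (e := .var a) (B := 8)
    (c := .seq (.assign b (.cons (.hd (.var a)) (.var b))) (.assign a (.tl (.var a))))
    (fun k s' => ∃ r r' : List (Val F), r.length = k ∧ s'.store a = .ofList r ∧
      s'.store b = .ofList r' ∧ r.reverse ++ r' = l.reverse ++ l' ∧
      (∀ v, v ≠ a → v ≠ b → s'.store v = s.store v) ∧ s'.pos = s.pos)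
    (fun s' ⟨r, r', hr, h1, _⟩ => by
      rw [List.length_eq_zero_iff] at hr
      simp [Expr.eval, h1, hr])
    (fun k s' ⟨r, r', hr, h1, h2, h3, h4, h5⟩ => by
      rcases r with _ | ⟨v, r⟩
      · simp at hr
      refine ⟨by simp [Expr.eval, h1], WP.seq (WP.assign (WP.assign ⟨by simp [Expr.cost], r,
        v :: r', by simpa using hr, ?_, ?_, by rw [← h3]; simp, fun v ha hb => ?_, h5⟩))⟩
      · simp [Expr.eval, State.set_store_of_ne, hab, h1]
      · simp [Expr.eval, State.set_store_of_ne, hab.symm, h1, h2]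
      · simp [State.set_store_of_ne, ha, hb, h4])
    (m := l.length) (s := s) ⟨l, l', rfl, ha, hb, rfl, fun _ _ _ => rfl, rfl⟩
  refine hmain.mono ?_
  rintro s' t ⟨ht, r, r', hr, _, h2, h3, h4, h5⟩
  rw [List.length_eq_zero_iff] at hr
  subst hr
  refine ⟨by simpa [Expr.cost] using ht, ?_, h4, h5⟩
  rw [h2, ← h3]
  simp

/-- Combines the point `19` and the point `20` along the bit table `18` into `17`. -/
def pointLoop : Prog :=
  .while (.var 18) (.seq (.ite (.hd (.var 18))
      (.assign 17 (.cons (.hd (.hd (.var 19))) (.var 17)))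
      (.assign 17 (.cons (.tl (.hd (.var 20))) (.var 17))))
    (.seq (.assign 18 (.tl (.var 18)))
      (.seq (.assign 19 (.tl (.var 19))) (.assign 20 (.tl (.var 20))))))

/-- A pair of points as a list of pairs of field elements, last coordinate first. -/
def pairVal (n : ℕ) (a c : ℕ → F) : Val F :=
  .ofList (down (fun x => .cons (.fld (a x)) (.fld (c x))) n)

/-- A set of numbers below `n` as a list of bits, last bit first. -/
def bitsVal (n : ℕ) (b : ℕ → Bool) : Val F := .ofList (down (fun x => bitVal (b x)) n)

/-- The point with the coordinates of `a` where `b` holds and those of `c` elsewhere. -/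
def pointVal (n : ℕ) (b : ℕ → Bool) (a c : ℕ → F) : Val F :=
  .ofList (up (fun x => .fld (if b x then a x else c x)) n)

theorem wp_pointLoop {n : ℕ} {b : ℕ → Bool} {a a' c c' : ℕ → F} {s : State F}
    (h17 : s.store 17 = .nil) (h18 : s.store 18 = bitsVal n b)
    (h19 : s.store 19 = pairVal n a a') (h20 : s.store 20 = pairVal n c' c) :
    WP q ρ pointLoop s fun s' t => t ≤ n * 24 + 2 ∧
      s'.store 17 = pointVal n b a c ∧ SameBelow 17 s s' := by
  refine (WP.while_count (B := 22) (fun k s' => k ≤ n ∧ s'.store 18 = bitsVal k b ∧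
    s'.store 19 = pairVal k a a' ∧ s'.store 20 = pairVal k c' c ∧
    s'.store 17 = .ofList ((up (fun x => .fld (if b x then a x else c x)) n).drop k) ∧
    SameBelow 17 s s') ?_ ?_ (m := n) ⟨le_rfl, h18, h19, h20, ?_, SameBelow.refl _ _⟩).mono ?_
  · rintro s' ⟨_, h18, _⟩
    simp [Expr.eval, h18, bitsVal, down]
  · rintro k s' ⟨hk, h18, h19, h20, h17, hs⟩
    rw [bitsVal, down] at h18
    rw [pairVal, down] at h19 h20
    refine ⟨by simp [Expr.eval, h18], WP.seq (WP.ite (fun hb => ?_) fun hb => ?_)⟩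
    · have hb : b k = true := by
        by_contra hb'
        simp [Expr.eval, h18, bitVal, hb'] at hb
      refine WP.assign (WP.seq (WP.assign (WP.seq (WP.assign (WP.assign ⟨by simp [Expr.cost],
        by omega, ?_, ?_, ?_, ?_,
        (((hs.set (by omega) _).set (by omega) _).set (by omega) _).set (by omega) _⟩)))))
      · simp [Expr.eval, State.set_store_of_ne, h18, bitsVal]
      · simp [Expr.eval, State.set_store_of_ne, h19, pairVal]
      · simp [Expr.eval, State.set_store_of_ne, h20, pairVal]
      · rw [up_drop (by omega)]
        simp [Expr.eval, State.set_store_of_ne, h19, h17, hb]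
    · have hb : b k = false := by
        by_contra hb'
        simp [Expr.eval, h18, bitVal, hb'] at hb
      refine WP.assign (WP.seq (WP.assign (WP.seq (WP.assign (WP.assign ⟨by simp [Expr.cost],
        by omega, ?_, ?_, ?_, ?_,
        (((hs.set (by omega) _).set (by omega) _).set (by omega) _).set (by omega) _⟩)))))
      · simp [Expr.eval, State.set_store_of_ne, h18, bitsVal]
      · simp [Expr.eval, State.set_store_of_ne, h19, pairVal]
      · simp [Expr.eval, State.set_store_of_ne, h20, pairVal]
      · rw [up_drop (by omega)]
        simp [Expr.eval, State.set_store_of_ne, h20, h17, hb]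
  · rw [up_drop_self, h17]; rfl
  · rintro s' t ⟨ht, _, _, _, _, h17, hs⟩
    exact ⟨by simpa [Expr.cost] using ht, h17, hs⟩

/-- Collects in `16` a row of the test matrix: the answers of the black box for the set `10`, the
inner point at the head of `14` and all outer points in `2`. -/
def rowLoop : Prog :=
  .while (.var 15) (.seq (.assign 17 .nil) (.seq (.assign 18 (.var 10))
    (.seq (.assign 19 (.hd (.var 14))) (.seq (.assign 20 (.hd (.var 15))) (.seq pointLoop
      (.seq (.query 21 (.var 17)) (.seq (.assign 16 (.cons (.var 21) (.var 16)))
        (.assign 15 (.tl (.var 15))))))))))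

/-- The list of the first `m` pairs of points, last pair first. -/
def pairsVal (n m : ℕ) (α β : ℕ → ℕ → F) : Val F :=
  .ofList (down (fun i => pairVal n (α i) (β i)) m)

theorem wp_rowLoop {n m : ℕ} {b : ℕ → Bool} {α β : ℕ → ℕ → F} {a a' : ℕ → F} {v : Val F}
    {s : State F}
    (h10 : s.store 10 = bitsVal n b) (h14 : s.store 14 = .cons (pairVal n a a') v)
    (h15 : s.store 15 = pairsVal n m α β) (h16 : s.store 16 = .nil) :
    WP q ρ rowLoop s fun s' t => t ≤ m * (n * 24 + 30) + 2 ∧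
      s'.store 16 = .ofList (up (fun j => .fld (q (pointVal n b a (β j)))) m) ∧
      SameBelow 15 s s' := by
  refine (WP.while_count (B := n * 24 + 28) (fun k s' => k ≤ m ∧ s'.store 15 = pairsVal n k α β ∧
    s'.store 16 = .ofList ((up (fun j => .fld (q (pointVal n b a (β j)))) m).drop k) ∧
    SameBelow 15 s s') ?_ ?_ (m := m) ⟨le_rfl, h15, ?_, SameBelow.refl _ _⟩).mono ?_
  · rintro s' ⟨_, h15, _⟩
    simp [Expr.eval, h15, pairsVal, down]
  · rintro k s' ⟨hk, h15, h16, hs⟩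
    rw [pairsVal, down] at h15
    refine ⟨by simp [Expr.eval, h15], WP.seq (WP.assign (WP.seq (WP.assign (WP.seq (WP.assign
      (WP.seq (WP.assign (WP.seq ((wp_pointLoop (n := n) (b := b) (a := a) (a' := a') (c := β k)
        (c' := α k) ?_ ?_ ?_ ?_).mono ?_)))))))))⟩
    · simp [Expr.eval, State.set_store_of_ne]
    · simp [Expr.eval, State.set_store_of_ne, hs.1, h10]
    · simp [Expr.eval, State.set_store_of_ne, hs.1, h14]
    · simp [Expr.eval, State.set_store_of_ne, h15]
    · rintro s'' t ⟨ht, h17, hs''⟩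
      refine WP.seq (WP.query (WP.seq (WP.assign (WP.assign ⟨?_, by omega, ?_, ?_, ?_⟩))))
      · simp only [Expr.cost]; omega
      · simp [Expr.eval, State.set_store_of_ne, hs''.1, h15, pairsVal]
      · rw [up_drop (by omega)]
        simp [Expr.eval, State.set_store_of_ne, hs''.1, h16, h17]
      · refine (((SameBelow.trans ?_ (hs''.mono (by omega))).set (by omega) _).set
          (by omega) _).set (by omega) _
        exact (((hs.set (by omega) _).set (by omega) _).set (by omega) _).set (by omega) _
  · rw [up_drop_self, h16]; rfl
  · rintro s' t ⟨ht, _, _, h16, hs⟩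
    refine ⟨ht.trans (by simp [Expr.cost]), by simpa using h16, hs⟩

/-- Computes in `13` the test matrix for the set `10` and the points `2`. -/
def matrixLoop : Prog :=
  .seq (.assign 13 .nil) (.seq (.assign 14 (.var 2)) (.while (.var 14)
    (.seq (.assign 15 (.var 2)) (.seq (.assign 16 .nil) (.seq rowLoop
      (.seq (.assign 13 (.cons (.var 16) (.var 13))) (.assign 14 (.tl (.var 14)))))))))

/-- A matrix as a list of rows. -/
def rowsVal (m m' : ℕ) (M : ℕ → ℕ → F) : Val F :=
  .ofList (up (fun i => .ofList (up (fun j => .fld (M i j)) m')) m)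

theorem wp_matrixLoop {n m : ℕ} {b : ℕ → Bool} {α β : ℕ → ℕ → F} {s : State F}
    (h10 : s.store 10 = bitsVal n b) (h2 : s.store 2 = pairsVal n m α β) :
    WP q ρ matrixLoop s fun s' t => t ≤ m * (m * (n * 24 + 30) + 20) + 10 ∧
      s'.store 13 = rowsVal m m (fun i j => q (pointVal n b (α i) (β j))) ∧
      SameBelow 13 s s' := by
  refine WP.seq (WP.assign (WP.seq (WP.assign ((WP.while_count
    (B := m * (n * 24 + 30) + 18) (fun k s' => k ≤ m ∧
    s'.store 14 = pairsVal n k α β ∧ s'.store 13 = .ofList ((up (fun i => .ofList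
      (up (fun j => .fld (q (pointVal n b (α i) (β j)))) m)) m).drop k) ∧
    SameBelow 13 s s') ?_ ?_ (m := m) ⟨le_rfl, ?_, ?_, ?_⟩).mono ?_))))
  · rintro s' ⟨_, h14, _⟩
    simp [Expr.eval, h14, pairsVal, down]
  · rintro k s' ⟨hk, h14, h13, hs⟩
    rw [pairsVal, down] at h14
    refine ⟨by simp [Expr.eval, h14], WP.seq (WP.assign (WP.seq (WP.assign (WP.seq
      ((wp_rowLoop (n := n) (m := m) (b := b) (α := α) (β := β) (a := α k) (a' := β k)
        (v := pairsVal n k α β) ?_ ?_ ?_ ?_).mono ?_)))))⟩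
    · simp [Expr.eval, State.set_store_of_ne, hs.1, h10]
    · simp [Expr.eval, State.set_store_of_ne, h14, pairsVal]
    · simp [Expr.eval, State.set_store_of_ne, hs.1, h2]
    · simp [Expr.eval]
    · rintro s'' t ⟨ht, h16, hs''⟩
      refine WP.seq (WP.assign (WP.assign ⟨?_, by omega, ?_, ?_, ?_⟩))
      · simp only [Expr.cost]; omega
      · simp [Expr.eval, State.set_store_of_ne, hs''.1, h14, pairsVal]
      · rw [up_drop (by omega)]
        simp [Expr.eval, State.set_store_of_ne, hs''.1, h13, h16]
      · refine ((SameBelow.trans ?_ (hs''.mono (by omega))).set (by omega) _).set (by omega) _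
        exact (hs.set (by omega) _).set (by omega) _
  · simp [Expr.eval, State.set_store_of_ne, h2]
  · rw [up_drop_self]
    simp [Expr.eval, State.set_store_of_ne]
  · exact ((SameBelow.refl _ _).set (by omega) _).set (by omega) _
  · rintro s' t ⟨ht, _, _, h13, hs⟩
    have ht : t ≤ m * (m * (n * 24 + 30) + 20) + 2 := ht
    exact ⟨by simp only [Expr.cost]; omega, h13, hs⟩

/-- Collects in `19`, last entry first, the next row of the elimination: `14` is the pivot row and
the head of `15` the row to be reduced, and `18` and `17` are their tails. -/
def elimEntryLoop : Prog :=
  .while (.var 17) (.seq (.assign 19 (.cons (.sub (.mul (.hd (.var 17)) (.hd (.var 14)))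
      (.mul (.hd (.hd (.var 15))) (.hd (.var 18)))) (.var 19)))
    (.seq (.assign 17 (.tl (.var 17))) (.assign 18 (.tl (.var 18)))))

theorem wp_elimEntryLoop {m : ℕ} {r p : ℕ → F} {a h : F} {v₁ v₂ v₃ : Val F} {s : State F}
    (h14 : s.store 14 = .cons (.fld a) v₁) (h15 : s.store 15 = .cons (.cons (.fld h) v₂) v₃)
    (h17 : s.store 17 = .ofList (up (fun j => .fld (r j)) m))
    (h18 : s.store 18 = .ofList (up (fun j => .fld (p j)) m)) (h19 : s.store 19 = .nil) :
    WP q ρ elimEntryLoop s fun s' t => t ≤ m * 24 + 2 ∧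
      s'.store 19 = .ofList (down (fun j => .fld (r j * a - h * p j)) m) ∧ SameBelow 17 s s' := by
  refine (WP.while_count (B := 22) (fun k s' => ∃ i, i + k = m ∧
    s'.store 17 = .ofList ((up (fun j => .fld (r j)) m).drop i) ∧
    s'.store 18 = .ofList ((up (fun j => .fld (p j)) m).drop i) ∧
    s'.store 19 = .ofList (down (fun j => .fld (r j * a - h * p j)) i) ∧
    SameBelow 17 s s') ?_ ?_ (m := m) ⟨0, by omega, h17, h18, h19, SameBelow.refl _ _⟩).mono ?_
  · rintro s' ⟨i, rfl, h17, _⟩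
    simp [Expr.eval, h17, up_drop_self]
  · rintro k s' ⟨i, hi, h17, h18, h19, hs⟩
    rw [up_drop (by omega)] at h17 h18
    refine ⟨by simp [Expr.eval, h17], WP.seq (WP.assign (WP.seq (WP.assign (WP.assign
      ⟨by simp [Expr.cost], i + 1, by omega, ?_, ?_, ?_,
        ((hs.set (by omega) _).set (by omega) _).set (by omega) _⟩))))⟩
    · simp [Expr.eval, State.set_store_of_ne, h17]
    · simp [Expr.eval, State.set_store_of_ne, h18]
    · simp [Expr.eval, State.set_store_of_ne, h17, h18, h19, hs.1, h14, h15, down]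
  · rintro s' t ⟨ht, i, rfl, _, _, h19, hs⟩
    exact ⟨by simpa [Expr.cost] using ht, h19, hs⟩

/-- Collects in `16`, last row first, the rows that result from the rows `15` by elimination with
the pivot row `14`. -/
def elimRowLoop : Prog :=
  .while (.var 15) (.seq (.assign 17 (.tl (.hd (.var 15)))) (.seq (.assign 18 (.tl (.var 14)))
    (.seq (.assign 19 .nil) (.seq elimEntryLoop (.seq (.assign 20 .nil) (.seq (revOnto 19 20)
      (.seq (.assign 16 (.cons (.var 20) (.var 16))) (.assign 15 (.tl (.var 15))))))))))

theorem wp_elimRowLoop {m m' : ℕ} {M : ℕ → ℕ → F} {s : State F}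
    (h14 : s.store 14 = .ofList (up (fun j => .fld (M 0 j)) (m' + 1)))
    (h15 : s.store 15 = rowsVal m (m' + 1) (fun i => M (i + 1))) (h16 : s.store 16 = .nil) :
    WP q ρ elimRowLoop s fun s' t => t ≤ m * (m' * 34 + 34) + 2 ∧
      s'.store 16 = .ofList (down (fun i => .ofList (up (fun j => .fld (elimStep M i j)) m')) m) ∧
      SameBelow 15 s s' := by
  rw [up_succ] at h14
  refine (WP.while_count (B := m' * 34 + 32) (fun k s' => ∃ i, i + k = m ∧
    s'.store 15 = .ofList ((up (fun i => .ofList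
      (up (fun j => .fld (M (i + 1) j)) (m' + 1))) m).drop i) ∧
    s'.store 16 = .ofList (down (fun i => .ofList (up (fun j => .fld (elimStep M i j)) m')) i) ∧
    SameBelow 15 s s') ?_ ?_ (m := m) ⟨0, by omega, h15, h16, SameBelow.refl _ _⟩).mono ?_
  · rintro s' ⟨i, rfl, h15, _⟩
    simp [Expr.eval, h15, up_drop_self]
  · rintro k s' ⟨i, hi, h15, h16, hs⟩
    rw [up_drop (by omega), up_succ] at h15
    refine ⟨by simp [Expr.eval, h15], WP.seq (WP.assign (WP.seq (WP.assign (WP.seq (WP.assign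
      (WP.seq ((wp_elimEntryLoop (m := m') (r := fun j => M (i + 1) (j + 1))
        (p := fun j => M 0 (j + 1)) (a := M 0 0) (h := M (i + 1) 0)
        (v₁ := .ofList (up (fun j => .fld (M 0 (j + 1))) m'))
        (v₂ := .ofList (up (fun j => .fld (M (i + 1) (j + 1))) m'))
        (v₃ := .ofList ((up (fun i => .ofList
          (up (fun j => .fld (M (i + 1) j)) (m' + 1))) m).drop (i + 1)))
        ?_ ?_ ?_ ?_ ?_).mono ?_)))))))⟩
    · simp [Expr.eval, State.set_store_of_ne, hs.1, h14]
    · simp [Expr.eval, State.set_store_of_ne, h15]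
    · simp [Expr.eval, State.set_store_of_ne, h15]
    · simp [Expr.eval, State.set_store_of_ne, hs.1, h14]
    · simp [Expr.eval]
    · rintro s'' t ⟨ht, h19, hs''⟩
      refine WP.seq (WP.assign (WP.seq ((wp_revOnto (l := down _ m') (l' := []) (by omega)
        (by rw [State.set_store_of_ne _ _ (by omega), h19]) (by simp [Expr.eval])).mono ?_)))
      rintro s₃ t₃ ⟨ht₃, h20, hs₃, hp₃⟩
      rw [length_down] at ht₃
      rw [down_reverse, List.append_nil] at h20
      refine WP.seq (WP.assign (WP.assign ⟨?_, i + 1, by omega, ?_, ?_, ?_⟩))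
      · simp only [Expr.cost]; omega
      · simp [Expr.eval, State.set_store_of_ne, hs₃, hs''.1, h15]
      · simp [Expr.eval, State.set_store_of_ne, hs₃, hs''.1, h16, h20, down, elimStep]
      · refine ((SameBelow.trans ?_ ⟨fun v hv => hs₃ v (by omega) (by omega), hp₃⟩).set
          (by omega) _).set (by omega) _
        refine (SameBelow.trans ?_ (hs''.mono (by omega))).set (by omega) _
        exact ((hs.set (by omega) _).set (by omega) _).set (by omega) _
  · rintro s' t ⟨ht, i, rfl, _, h16, hs⟩
    exact ⟨by simpa [Expr.cost] using ht, h16, hs⟩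

/-- Stores in `11` whether elimination in the matrix `13` meets a zero pivot. -/
def elimLoop : Prog :=
  .seq (.assign 11 .nil) (.while (.var 13) (.seq (.assign 14 (.hd (.var 13)))
    (.seq (.assign 15 (.tl (.var 13)))
      (.seq (.ite (.isZero (.hd (.var 14))) (.assign 11 (.cons .nil .nil)) (.assign 16 .nil))
        (.seq (.assign 16 .nil) (.seq elimRowLoop
          (.seq (.assign 13 .nil) (revOnto 16 13))))))))

theorem wp_elimLoop {m : ℕ} {M : ℕ → ℕ → F} {s : State F} (h13 : s.store 13 = rowsVal m m M) :
    WP q ρ elimLoop s fun s' t => t ≤ m * (m * (m * 34 + 44) + 62) + 10 ∧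
      (s'.store 11 ≠ .nil ↔ ZeroPivot m M) ∧ SameBelow 11 s s' := by
  refine WP.seq (WP.assign ((WP.while_count (B := m * (m * 34 + 44) + 60)
    (fun k s' => k ≤ m ∧ ∃ M', s'.store 13 = rowsVal k k M' ∧
      (s'.store 11 ≠ .nil ∨ ZeroPivot k M' ↔ ZeroPivot m M) ∧ SameBelow 11 s s')
    ?_ ?_ (m := m) ⟨le_rfl, M, ?_, ?_, ?_⟩).mono ?_))
  · rintro s' ⟨_, M', h13, _⟩
    simp [Expr.eval, h13, rowsVal, up]
  · rintro k s' ⟨hk, M', h13, h11, hs⟩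
    rw [rowsVal, up_succ] at h13
    refine ⟨by simp [Expr.eval, h13], WP.seq (WP.assign (WP.seq (WP.assign (WP.seq ?_))))⟩
    -- What follows the test of the pivot is the same in both cases.
    have rest : ∀ (s₁ : State F) (t₁ : ℕ), t₁ ≤ 20 →
        s₁.store 14 = .ofList (up (fun j => .fld (M' 0 j)) (k + 1)) →
        s₁.store 15 = rowsVal k (k + 1) (fun i => M' (i + 1)) → SameBelow 11 s s₁ →
        ((s₁.store 11 ≠ .nil ↔ (s'.store 11 ≠ .nil ∨ M' 0 0 = 0))) →
        WP q ρ (.seq (.assign 16 .nil) (.seq elimRowLoop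
          (.seq (.assign 13 .nil) (revOnto 16 13)))) s₁ fun s'' t =>
            6 + (t₁ + t) ≤ m * (m * 34 + 44) + 60 ∧ k ≤ m ∧
            ∃ M', s''.store 13 = rowsVal k k M' ∧
              (s''.store 11 ≠ .nil ∨ ZeroPivot k M' ↔ ZeroPivot m M) ∧ SameBelow 11 s s'' := by
      intro s₁ t₁ ht₁ h14 h15 hs₁ h11'
      refine WP.seq (WP.assign (WP.seq ((wp_elimRowLoop (m := k) (m' := k) (M := M')
        ?_ ?_ ?_).mono ?_)))
      · simp [State.set_store_of_ne, h14]
      · simp [State.set_store_of_ne, h15]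
      · simp [Expr.eval]
      rintro s₂ t₂ ⟨ht₂, h16, hs₂⟩
      refine WP.seq (WP.assign ((wp_revOnto (l := down _ k) (l' := []) (by omega)
        (by rw [State.set_store_of_ne _ _ (by omega), h16]) (by simp [Expr.eval])).mono ?_))
      rintro s₃ t₃ ⟨ht₃, h13, hs₃, hp₃⟩
      rw [length_down] at ht₃
      rw [down_reverse, List.append_nil] at h13
      refine ⟨?_, by omega, elimStep M', h13, ?_, ?_⟩
      · have h1 : k * (k * 34 + 34) + k * 10 ≤ m * (m * 34 + 44) := by
          rw [← mul_add]
          exact Nat.mul_le_mul (by omega) (by omega)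
        simp only [Expr.cost]; omega
      · rw [hs₃ 11 (by omega) (by omega), State.set_store_of_ne _ _ (by omega),
          hs₂.1 11 (by omega), State.set_store_of_ne _ _ (by omega), h11', ← h11, or_assoc]
        rfl
      · refine SameBelow.trans ?_ ⟨fun v hv => hs₃ v (by omega) (by omega), hp₃⟩
        refine (SameBelow.trans ?_ (hs₂.mono (by omega))).set (by omega) _
        exact hs₁.set (by omega) _
    refine WP.ite (fun hb => WP.assign ?_) fun hb => WP.assign ?_
    · refine (rest _ 10 (by omega) ?_ ?_ ?_ ?_).mono ?_
      · simp [Expr.eval, State.set_store_of_ne, h13]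
      · simp [Expr.eval, State.set_store_of_ne, h13, rowsVal]
      · exact ((hs.set (by omega) _).set (by omega) _).set (by omega) _
      · have : M' 0 0 = 0 := by
          by_contra h0
          simp [Expr.eval, State.set_store_of_ne, h13, up_succ, h0] at hb
        simp [Expr.eval, this]
      · rintro s'' t ⟨ht, h⟩
        exact ⟨by simp only [Expr.cost]; omega, h⟩
    · refine (rest _ 10 (by omega) ?_ ?_ ?_ ?_).mono ?_
      · simp [Expr.eval, State.set_store_of_ne, h13]
      · simp [Expr.eval, State.set_store_of_ne, h13, rowsVal]
      · exact ((hs.set (by omega) _).set (by omega) _).set (by omega) _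
      · have : M' 0 0 ≠ 0 := by
          intro h0
          simp [Expr.eval, State.set_store_of_ne, h13, up_succ, h0] at hb
        simp [State.set_store_of_ne, this]
      · rintro s'' t ⟨ht, h⟩
        exact ⟨by simp only [Expr.cost]; omega, h⟩
  · simp [State.set_store_of_ne, h13]
  · simp [Expr.eval]
  · exact (SameBelow.refl _ _).set (by omega) _
  · rintro s' t ⟨ht, _, M', _, h11, hs⟩
    have ht : t ≤ m * (m * (m * 34 + 44) + 62) + 2 := ht
    refine ⟨by simp only [Expr.cost]; omega, ?_, hs⟩
    simpa [ZeroPivot] using h11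

end Subroutines

/-! ### The search program -/

section Search

variable {F : Type u} [Field F] {q : Val F → F} {ρ : ℕ → F}

/-- Draws a pair of points with `n` coordinates, `13` being the numeral `n`, into `14`. -/
def sampleRow : Prog :=
  .while (.var 13) (.seq (.sample 15) (.seq (.sample 16)
    (.seq (.assign 14 (.cons (.cons (.var 15) (.var 16)) (.var 14))) (.assign 13 (.tl (.var 13))))))

theorem wp_sampleRow {n : ℕ} {s : State F} (h13 : s.store 13 = .num n) (h14 : s.store 14 = .nil) :
    WP q ρ sampleRow s fun s' t => t ≤ n * 14 + 2 ∧
      s'.store 14 = pairVal n (fun x => ρ (s.pos + 2 * x)) (fun x => ρ (s.pos + 2 * x + 1)) ∧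
      (∀ v < 13, s'.store v = s.store v) ∧ s'.pos = s.pos + 2 * n := by
  refine (WP.while_count (B := 12) (fun k s' => ∃ i, i + k = n ∧ s'.store 13 = .num k ∧
    s'.store 14 = pairVal i (fun x => ρ (s.pos + 2 * x)) (fun x => ρ (s.pos + 2 * x + 1)) ∧
    (∀ v < 13, s'.store v = s.store v) ∧ s'.pos = s.pos + 2 * i) ?_ ?_ (m := n)
    ⟨0, by omega, h13, h14, fun _ _ => rfl, rfl⟩).mono ?_
  · rintro s' ⟨i, _, h13, _⟩
    simp [Expr.eval, h13]
  · rintro k s' ⟨i, hi, h13, h14, hs, hp⟩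
    rw [Val.num_succ] at h13
    refine ⟨by simp [Expr.eval, h13], WP.seq (WP.sample (WP.seq (WP.sample (WP.seq (WP.assign
      (WP.assign ⟨by simp [Expr.cost], i + 1, by omega, ?_, ?_, fun v hv => ?_, ?_⟩))))))⟩
    · simp [Expr.eval, State.set_store_of_ne, h13]
    · simp [Expr.eval, State.set_store_of_ne, h14, pairVal, down, hp]
    · simp (disch := omega) only [State.set_store_of_ne]
      exact hs v hv
    · simp [hp]; ring
  · rintro s' t ⟨ht, i, rfl, _, h14, hs, hp⟩
    exact ⟨ht, h14, hs, hp⟩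

/-- Draws as many pairs of points as `12` says, into the list `2`. -/
def sampleLoop : Prog :=
  .while (.var 12) (.seq (.assign 13 (.var 1)) (.seq (.assign 14 .nil) (.seq sampleRow
    (.seq (.assign 2 (.cons (.var 14) (.var 2))) (.assign 12 (.tl (.var 12)))))))

theorem wp_sampleLoop {n m : ℕ} {s : State F} (h1 : s.store 1 = .num n)
    (h12 : s.store 12 = .num m) (h2 : s.store 2 = .nil) (hpos : s.pos = 0) :
    WP q ρ sampleLoop s fun s' t => t ≤ m * (n * 14 + 20) + 2 ∧
      s'.store 1 = .num n ∧ s'.store 2 = pairsVal n m (fun i x => ρ (2 * (n * i + x)))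
        (fun i x => ρ (2 * (n * i + x) + 1)) := by
  refine (WP.while_count (B := n * 14 + 18) (fun k s' => ∃ i, i + k = m ∧ s'.store 12 = .num k ∧
    s'.store 1 = .num n ∧ s'.store 2 = pairsVal n i (fun i x => ρ (2 * (n * i + x)))
        (fun i x => ρ (2 * (n * i + x) + 1)) ∧ s'.pos = 2 * (n * i)) ?_ ?_ (m := m)
    ⟨0, by omega, h12, h1, h2, by simpa using hpos⟩).mono ?_
  · rintro s' ⟨i, _, h12, _⟩
    simp [Expr.eval, h12]
  · rintro k s' ⟨i, hi, h12, h1, h2, hp⟩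
    rw [Val.num_succ] at h12
    refine ⟨by simp [Expr.eval, h12], WP.seq (WP.assign (WP.seq (WP.assign (WP.seq
      ((wp_sampleRow (n := n) ?_ ?_).mono ?_)))))⟩
    · simp [Expr.eval, State.set_store_of_ne, h1]
    · simp [Expr.eval]
    · rintro s'' t ⟨ht, h14, hs, hp'⟩
      refine WP.seq (WP.assign (WP.assign ⟨?_, i + 1, by omega, ?_, ?_, ?_, ?_⟩))
      · simp only [Expr.cost]; omega
      · simp [Expr.eval, State.set_store_of_ne, hs, h12]
      · simp [State.set_store_of_ne, hs, h1]
      · simp [Expr.eval, State.set_store_of_ne, hs, h2, h14, hp, pairsVal, down, mul_add]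
      · simp only [State.set_pos] at hp' ⊢
        rw [hp', hp]; ring
  · rintro s' t ⟨ht, i, rfl, _, h1, h2, _⟩
    exact ⟨ht, h1, h2⟩

/-- The test, as the program performs it, for the set `b`. -/
def ProgPasses (q : Val F → F) (n m : ℕ) (α β : ℕ → ℕ → F) (b : ℕ → Bool) : Prop :=
  ZeroPivot m fun i j => q (pointVal n b (α i) (β j))

/-- Tests the set that extends the current one by the next number; `8` holds the bits already
processed and `9` the others. -/
def testBody : Prog :=
  .seq (.assign 13 (.var 8)) (.seq (.assign 10 (.cons (.cons .nil .nil) (.tl (.var 9))))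
    (.seq (revOnto 13 10) (.seq matrixLoop elimLoop)))

/-- A bound for the time of one test. -/
def testTime (n m : ℕ) : ℕ :=
  10 * n + m * (m * (n * 24 + 30) + 20) + m * (m * (m * 34 + 44) + 62) + 100

/-- The hypothesis `hpre` says that `pre` is the list of the bits of `b` from `k + 1` on; it is
stated for all sets that agree with `b` there, in order to be used for the extended set. -/
theorem wp_testBody {n m k : ℕ} {b : ℕ → Bool} {α β : ℕ → ℕ → F} {pre : List (Val F)}
    {s : State F} (h2 : s.store 2 = pairsVal n m α β)
    (h8 : s.store 8 = .ofList pre) (h9 : s.store 9 = bitsVal (k + 1) b)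
    (hlen : pre.length + (k + 1) = n)
    (hpre : ∀ b' : ℕ → Bool, (∀ x ≥ k + 1, b' x = b x) →
      pre.reverse ++ down (fun x => bitVal (b' x)) (k + 1) = down (fun x => bitVal (b' x)) n) :
    WP q ρ testBody s fun s' t => t + 50 ≤ testTime n m ∧
      s'.store 10 = bitsVal n (Function.update b k true) ∧
      (s'.store 11 ≠ .nil ↔ ProgPasses q n m α β (Function.update b k true)) ∧
      SameBelow 10 s s' := by
  refine WP.seq (WP.assign (WP.seq (WP.assign (WP.seq ((wp_revOnto (l := pre)
    (l' := bitVal true :: down (fun x => bitVal (b x)) k) (by omega) ?_ ?_).mono ?_)))))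
  · simp [Expr.eval, State.set_store_of_ne, h8]
  · simp [Expr.eval, State.set_store_of_ne, h9, bitsVal, down, bitVal]
  rintro s₁ t₁ ⟨ht₁, h10, hs₁, hp₁⟩
  have hupd : pre.reverse ++ bitVal true :: down (fun x => bitVal (b x)) k =
      down (fun x => bitVal (F := F) (Function.update b k true x)) n := by
    rw [← hpre (Function.update b k true) fun x hx => Function.update_of_ne (by omega) _ _, down,
      Function.update_self]
    congr 2
    exact down_congr fun i hi => by rw [Function.update_of_ne (by omega)]
  rw [hupd] at h10
  refine WP.seq ((wp_matrixLoop (n := n) (m := m) (b := Function.update b k true) (α := α)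
    (β := β) h10 ?_).mono ?_)
  · rw [hs₁ 2 (by omega) (by omega)]
    simp [State.set_store_of_ne, h2]
  rintro s₂ t₂ ⟨ht₂, h13, hs₂⟩
  refine (wp_elimLoop h13).mono ?_
  rintro s₃ t₃ ⟨ht₃, h11, hs₃⟩
  refine ⟨?_, ?_, h11, ?_⟩
  · simp only [Expr.cost, testTime]
    omega
  · rw [hs₃.1 10 (by omega), hs₂.1 10 (by omega), h10]
    rfl
  · refine SameBelow.trans (SameBelow.trans ?_ (hs₂.mono (by omega))) (hs₃.mono (by omega))
    refine SameBelow.trans ?_ ⟨fun v hv => hs₁ v (by omega) (by omega), hp₁⟩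
    exact ((SameBelow.refl _ _).set (by omega) _).set (by omega) _

/-- Pushes on the stack `3` the accepted extensions of the node with the sequence `4`, a set and the
number `6` of missing variables. The bits of the set are moved from `9` to `8`, and `7` counts the
numbers down. -/
def childLoop : Prog :=
  .while (.var 9) (.seq (.ite (.hd (.var 9)) (.assign 10 .nil) (.seq testBody (.ite (.var 11)
      (.assign 3 (.cons (.cons (.cons (.var 7) (.var 4)) (.cons (.var 10) (.tl (.var 6))))
        (.var 3)))
      (.assign 10 .nil))))
    (.seq (.assign 8 (.cons (.hd (.var 9)) (.var 8))) (.seq (.assign 9 (.tl (.var 9)))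
      (.assign 7 (.tl (.var 7))))))

open Classical in
/-- The numbers from `k` to `n - 1` by which the set `b` can be extended. -/
noncomputable def extensions (q : Val F → F) (n m : ℕ) (α β : ℕ → ℕ → F) (b : ℕ → Bool)
    (k : ℕ) : List ℕ :=
  ((List.range n).drop k).filter fun x =>
    b x = false ∧ ProgPasses q n m α β (Function.update b x true)

open Classical in
theorem extensions_of_lt {n m k : ℕ} {α β : ℕ → ℕ → F} {b : ℕ → Bool} (hk : k < n) :
    extensions q n m α β b k =
      if b k = false ∧ ProgPasses q n m α β (Function.update b k true) then
        k :: extensions q n m α β b (k + 1) else extensions q n m α β b (k + 1) := by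
  unfold extensions
  rw [List.drop_eq_getElem_cons (by simpa using hk), List.filter_cons]
  simp

theorem wp_childLoop {n m : ℕ} {b : ℕ → Bool} {α β : ℕ → ℕ → F} {seqV remV : Val F}
    {L : List (Val F)} {s : State F} (h2 : s.store 2 = pairsVal n m α β)
    (h3 : s.store 3 = .ofList L) (h4 : s.store 4 = seqV) (h6 : s.store 6 = remV)
    (h7 : s.store 7 = .num (n - 1)) (h8 : s.store 8 = .nil) (h9 : s.store 9 = bitsVal n b) :
    WP q ρ childLoop s fun s' t => t ≤ n * (testTime n m + 2) + 2 ∧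
      s'.store 3 = .ofList ((extensions q n m α β b 0).map (fun x => Val.cons
        (.cons (.num x) seqV) (.cons (bitsVal n (Function.update b x true)) remV.tl)) ++ L) ∧
      s'.store 1 = s.store 1 ∧ s'.store 2 = s.store 2 := by
  refine (WP.while_count (B := testTime n m) (fun k s' => k ≤ n ∧ s'.store 7 = .num (k - 1) ∧
    s'.store 9 = bitsVal k b ∧ (∃ pre : List (Val F), s'.store 8 = .ofList pre ∧
      pre.length + k = n ∧ ∀ b' : ℕ → Bool, (∀ x ≥ k, b' x = b x) →
      pre.reverse ++ down (fun x => bitVal (b' x)) k = down (fun x => bitVal (b' x)) n) ∧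
    s'.store 3 = .ofList ((extensions q n m α β b k).map (fun x => Val.cons
        (.cons (.num x) seqV) (.cons (bitsVal n (Function.update b x true)) remV.tl)) ++ L) ∧
    s'.store 4 = seqV ∧ s'.store 6 = remV ∧
    s'.store 1 = s.store 1 ∧ s'.store 2 = s.store 2) ?_ ?_ (m := n)
    ⟨le_rfl, h7, h9, ⟨[], h8, by simp, by simp⟩, ?_, h4, h6, rfl, rfl⟩).mono ?_
  · rintro s' ⟨_, _, h9, _⟩
    simp [Expr.eval, h9, bitsVal, down]
  · rintro k s' ⟨hk, h7, h9, ⟨pre, h8, hlen, hpre⟩, h3, h4, h6, h1', h2'⟩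
    have h9' := h9
    rw [bitsVal, down] at h9
    refine ⟨by simp [Expr.eval, h9], WP.seq ?_⟩
    -- The passage to the next number is the same for members, accepted and rejected numbers.
    have tail : ∀ (s₁ : State F) (t₁ : ℕ), t₁ + 12 ≤ testTime n m →
        s₁.store 3 = .ofList ((extensions q n m α β b k).map (fun x => Val.cons
          (.cons (.num x) seqV) (.cons (bitsVal n (Function.update b x true)) remV.tl)) ++ L) →
        (∀ v < 10, v ≠ 3 → s₁.store v = s'.store v) →
        WP q ρ (.seq (.assign 8 (.cons (.hd (.var 9)) (.var 8))) (.seq (.assign 9 (.tl (.var 9)))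
          (.assign 7 (.tl (.var 7))))) s₁ fun s' t => t₁ + t ≤ testTime n m ∧
          k ≤ n ∧ s'.store 7 = .num (k - 1) ∧
          s'.store 9 = bitsVal k b ∧ (∃ pre : List (Val F), s'.store 8 = .ofList pre ∧
            pre.length + k = n ∧ ∀ b' : ℕ → Bool, (∀ x ≥ k, b' x = b x) →
            pre.reverse ++ down (fun x => bitVal (b' x)) k = down (fun x => bitVal (b' x)) n) ∧
          s'.store 3 = .ofList ((extensions q n m α β b k).map (fun x => Val.cons
            (.cons (.num x) seqV) (.cons (bitsVal n (Function.update b x true)) remV.tl)) ++ L) ∧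
          s'.store 4 = seqV ∧ s'.store 6 = remV ∧
          s'.store 1 = s.store 1 ∧ s'.store 2 = s.store 2 := by
      intro s₁ t₁ ht₁ h3₁ hs₁
      refine WP.seq (WP.assign (WP.seq (WP.assign (WP.assign ⟨?_, by omega, ?_, ?_,
        ⟨bitVal (b k) :: pre, ?_, ?_, fun b' hb' => ?_⟩, ?_, ?_, ?_, ?_, ?_⟩))))
      · simp only [Expr.cost]; omega
      · simp only [Expr.eval, State.set_store_self]
        rw [State.set_store_of_ne _ _ (by omega), State.set_store_of_ne _ _ (by omega),
          hs₁ 7 (by omega) (by omega), h7]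
        rcases k with _ | k
        · rfl
        · rfl
      · simp [Expr.eval, State.set_store_of_ne, hs₁, h9, bitsVal]
      · simp [Expr.eval, State.set_store_of_ne, hs₁, h9, h8]
      · simp only [List.length_cons]; omega
      · rw [← hpre b' fun x hx => hb' x (by omega), down, hb' k le_rfl]
        simp
      · simp [State.set_store_of_ne, h3₁]
      · simp [State.set_store_of_ne, hs₁, h4]
      · simp [State.set_store_of_ne, hs₁, h6]
      · simp [State.set_store_of_ne, hs₁, h1']
      · simp [State.set_store_of_ne, hs₁, h2']
    have htime : 100 ≤ testTime n m := by unfold testTime; omega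
    refine WP.ite (fun hb => WP.assign ?_) fun hb => WP.seq ?_
    · have hb : b k = true := by
        by_contra hb'
        simp [Expr.eval, h9, bitVal, hb'] at hb
      refine tail _ _ ?_ ?_ fun v hv _ => State.set_store_of_ne _ _ (by omega)
      · simp only [Expr.cost]; omega
      · rw [extensions_of_lt (by omega), if_neg (by simp [hb]),
          State.set_store_of_ne _ _ (by omega), h3]
    · have hb : b k = false := by
        by_contra hb'
        simp [Expr.eval, h9, bitVal, hb'] at hb
      refine (wp_testBody (h2'.trans h2) h8 h9' hlen hpre).mono ?_
      rintro s₂ t₂ ⟨ht₂, h10, h11, hs₂⟩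
      refine WP.ite (fun hp => WP.assign ?_) fun hp => WP.assign ?_
      · have hpass := h11.1 hp
        refine tail _ _ ?_ ?_ fun v hv hv3 => ?_
        · simp only [Expr.cost]; omega
        · rw [extensions_of_lt (by omega), if_pos ⟨hb, hpass⟩]
          simp [Expr.eval, hs₂.1, h7, h4, h6, h10, h3]
        · rw [State.set_store_of_ne _ _ hv3, hs₂.1 v hv]
      · have hpass : ¬ ProgPasses q n m α β (Function.update b k true) := fun h => h11.2 h hp
        refine tail _ _ ?_ ?_ fun v hv hv3 => ?_
        · simp only [Expr.cost]; omega
        · rw [extensions_of_lt (by omega), if_neg (by simp [hpass]),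
            State.set_store_of_ne _ _ (by omega), hs₂.1 3 (by omega), h3]
        · rw [State.set_store_of_ne _ _ (by omega), hs₂.1 v hv]
  · have : (List.range n).drop n = [] := List.drop_of_length_le (by simp)
    simp [extensions, this, h3]
  · rintro s' t ⟨ht, _, _, _, _, h3, _, _, h1, h2⟩
    exact ⟨ht, h3, h1, h2⟩

end Search

/-! ### Depth-first search -/

section DepthFirst

variable {n K : ℕ} {pass : List ℕ → Prop}

/-- The sequences of distinct numbers below `n`, last chosen first, that the search may build:
at every moment of their construction the set chosen so far was accepted. -/
def Admissible (n : ℕ) (pass : List ℕ → Prop) : List ℕ → Prop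
  | [] => True
  | x :: p => x < n ∧ x ∉ p ∧ pass (x :: p) ∧ Admissible n pass p

open Classical in
/-- The admissible extensions of a sequence. -/
noncomputable def children (n : ℕ) (pass : List ℕ → Prop) (p : List ℕ) : List (List ℕ) :=
  ((List.range n).filter fun x => x ∉ p ∧ pass (x :: p)).map fun x => x :: p

theorem mem_children {p p' : List ℕ} :
    p' ∈ children n pass p ↔ ∃ x < n, x ∉ p ∧ pass (x :: p) ∧ p' = x :: p := by
  simp only [children, List.mem_map, List.mem_filter, List.mem_range, decide_eq_true_eq]
  constructor
  · rintro ⟨x, ⟨h1, h2, h3⟩, rfl⟩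
    exact ⟨x, h1, h2, h3, rfl⟩
  · rintro ⟨x, h1, h2, h3, rfl⟩
    exact ⟨x, ⟨h1, h2, h3⟩, rfl⟩

theorem Admissible.of_mem_children {p p' : List ℕ} (hp : Admissible n pass p)
    (h : p' ∈ children n pass p) : Admissible n pass p' := by
  obtain ⟨x, hx, hxp, hpass, rfl⟩ := mem_children.1 h
  exact ⟨hx, hxp, hpass, hp⟩

theorem Admissible.nodup : ∀ {p : List ℕ}, Admissible n pass p → p.Nodup
  | [], _ => List.nodup_nil
  | _ :: _, h => List.nodup_cons.2 ⟨h.2.1, h.2.2.2.nodup⟩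

theorem Admissible.lt : ∀ {p : List ℕ}, Admissible n pass p → ∀ x ∈ p, x < n
  | [], _ => by simp
  | y :: p, h => fun x hx => by
    rcases List.mem_cons.1 hx with rfl | hx
    · exact h.1
    · exact h.2.2.2.lt x hx

theorem Admissible.length_le {p : List ℕ} (h : Admissible n pass p) : p.length ≤ n := by
  simpa using
    (h.nodup.subperm (l₂ := List.range n) fun x hx => List.mem_range.2 (h.lt x hx)).length_le

theorem Admissible.of_suffix {p p' : List ℕ} (h : Admissible n pass p) (hs : p' <:+ p) :
    Admissible n pass p' := by
  induction p with
  | nil => rw [List.suffix_nil.1 hs]; trivial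
  | cons x p ih =>
    rcases List.suffix_cons_iff.1 hs with rfl | hs
    · exact h
    · exact ih h.2.2.2 hs

theorem Admissible.pass_of_suffix {p p' : List ℕ} (h : Admissible n pass p) (hs : p' <:+ p)
    (hp' : p' ≠ []) : pass p' := by
  have := h.of_suffix hs
  rcases p' with _ | ⟨x, p'⟩
  · exact absurd rfl hp'
  · exact this.2.2.1

/-- A bound for the number of nodes of length less than `K` below a node of length `l`. -/
def subtreeBound (n K l : ℕ) : ℕ := ∑ i ∈ Finset.range (K - l), n ^ i

theorem subtreeBound_eq {l : ℕ} (hl : l < K) :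
    subtreeBound n K l = n * subtreeBound n K (l + 1) + 1 := by
  unfold subtreeBound
  obtain ⟨m, rfl⟩ : ∃ m, K = l + m + 1 := ⟨K - l - 1, by omega⟩
  rw [show l + m + 1 - l = m + 1 by omega, show l + m + 1 - (l + 1) = m by omega,
    Finset.sum_range_succ', Finset.mul_sum]
  simp [pow_succ']

theorem subtreeBound_zero_le (hn : 2 ≤ n) (K : ℕ) : subtreeBound n K 0 ≤ n ^ K := by
  unfold subtreeBound
  rw [Nat.sub_zero]
  induction K with
  | zero => simp
  | succ K ih =>
    rw [Finset.sum_range_succ, pow_succ]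
    nlinarith [Nat.zero_le (n ^ K)]

/-- The nodes of length less than `K` that the search may still visit from a list of nodes. -/
def workBound (n K : ℕ) (W : List (List ℕ)) : ℕ := (W.map fun p => subtreeBound n K p.length).sum

/-- A bound for the remaining rounds. A node of length at least `K` has an admissible extension,
so that once such a node is reached the search descends directly to a full sequence. -/
def roundsBound (n K : ℕ) (cur : List ℕ) (stack : List (List ℕ)) : ℕ :=
  if K ≤ cur.length then n - cur.length else workBound n K (cur :: stack) + n

theorem workBound_children_le {p : List ℕ} (hp : p.length < K) (W : List (List ℕ)) :
    workBound n K (children n pass p ++ W) + 1 ≤ workBound n K (p :: W) := by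
  have h1 : workBound n K (children n pass p) ≤ n * subtreeBound n K (p.length + 1) := by
    unfold workBound
    have hconst : (children n pass p).map (fun p' => subtreeBound n K p'.length) =
        List.replicate (children n pass p).length (subtreeBound n K (p.length + 1)) := by
      refine List.eq_replicate_iff.2 ⟨by simp, fun y hy => ?_⟩
      obtain ⟨p', hp', rfl⟩ := List.mem_map.1 hy
      obtain ⟨x, _, _, _, rfl⟩ := mem_children.1 hp'
      rfl
    rw [hconst, List.sum_replicate, smul_eq_mul]
    refine Nat.mul_le_mul_right _ ?_
    unfold children
    rw [List.length_map]
    exact (List.length_filter_le _ _).trans_eq (by simp)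
  have h2 : workBound n K (children n pass p ++ W) =
      workBound n K (children n pass p) + workBound n K W := by simp [workBound]
  have h3 : workBound n K (p :: W) = subtreeBound n K p.length + workBound n K W := by
    simp [workBound]
  rw [h2, h3, subtreeBound_eq hp]
  omega

/-- The invariant of the search: all nodes are admissible, and some node can be completed to the
full admissible sequence `goal`. -/
def SearchInv (n : ℕ) (pass : List ℕ → Prop) (goal cur : List ℕ) (stack : List (List ℕ)) : Prop :=
  (∀ p ∈ cur :: stack, Admissible n pass p) ∧ ∃ p ∈ cur :: stack, p <:+ goal

/-- The search never runs out of nodes, and each round decreases `roundsBound`. -/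
theorem SearchInv.step {goal cur : List ℕ} {stack : List (List ℕ)}
    (hgoal : Admissible n pass goal) (hlen : goal.length = n)
    (hext : ∀ p, Admissible n pass p → K ≤ p.length → p.length < n →
      ∃ x < n, x ∉ p ∧ pass (x :: p))
    (h : SearchInv n pass goal cur stack) (hcur : cur.length < n) :
    ∃ cur' stack', children n pass cur ++ stack = cur' :: stack' ∧
      SearchInv n pass goal cur' stack' ∧
      roundsBound n K cur' stack' < roundsBound n K cur stack := by
  obtain ⟨hadm, p, hp, hpg⟩ := h
  have hp' : ∃ p ∈ children n pass cur ++ stack, p <:+ goal := by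
    rcases List.mem_cons.1 hp with rfl | hp
    · obtain ⟨l, hl⟩ := hpg
      rcases List.eq_nil_or_concat l with rfl | ⟨l, x, rfl⟩
      · rw [List.nil_append] at hl
        subst hl
        omega
      · have hs : x :: p <:+ goal := ⟨l, by rw [← hl]; simp⟩
        have hx := hgoal.of_suffix hs
        exact ⟨x :: p, List.mem_append_left _ (mem_children.2 ⟨x, hx.1, hx.2.1, hx.2.2.1, rfl⟩), hs⟩
    · exact ⟨p, List.mem_append_right _ hp, hpg⟩
  have hadm' : ∀ p ∈ children n pass cur ++ stack, Admissible n pass p := by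
    intro p hp
    rcases List.mem_append.1 hp with hp | hp
    · exact (hadm cur (by simp)).of_mem_children hp
    · exact hadm p (by simp [hp])
  rcases hW : children n pass cur ++ stack with _ | ⟨cur', stack'⟩
  · rw [hW] at hp'
    simp at hp'
  refine ⟨cur', stack', rfl, ⟨hW ▸ hadm', hW ▸ hp'⟩, ?_⟩
  unfold roundsBound
  by_cases hc : K ≤ cur.length
  · obtain ⟨x, hx⟩ := hext cur (hadm cur (by simp)) hc hcur
    have hmem := mem_children.2 ⟨x, hx.1, hx.2.1, hx.2.2, rfl⟩
    have : cur' ∈ children n pass cur := by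
      rcases hch : children n pass cur with _ | ⟨c, l⟩
      · rw [hch] at hmem
        simp at hmem
      · rw [hch, List.cons_append, List.cons.injEq] at hW
        simp [hW.1]
    obtain ⟨y, _, _, _, rfl⟩ := mem_children.1 this
    rw [if_pos hc, if_pos (by simp; omega), List.length_cons]
    omega
  · have hlt := workBound_children_le (n := n) (pass := pass) (not_le.1 hc) stack
    rw [hW] at hlt
    rw [if_neg hc]
    split_ifs <;> omega

end DepthFirst

/-! ### The order finding algorithm -/

section Program

variable {F : Type u} [Field F] {q : Val F → F} {ρ : ℕ → F}

/-- A sequence as a list of numerals. -/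
def seqVal (p : List ℕ) : Val F := .ofList (p.map .num)

/-- The set of the members of a sequence. -/
def bitsOf (p : List ℕ) (x : ℕ) : Bool := decide (x ∈ p)

/-- A node of the search tree: the sequence, its set of members, and the number of missing
variables. -/
def nodeVal (n : ℕ) (p : List ℕ) : Val F :=
  .cons (seqVal p) (.cons (bitsVal n (bitsOf p)) (.num (n - p.length)))

theorem bitsOf_cons (x : ℕ) (p : List ℕ) :
    bitsOf (x :: p) = Function.update (bitsOf p) x true := by
  ext y
  by_cases h : y = x
  · subst h; simp [bitsOf]
  · simp [bitsOf, h]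

open Classical in
theorem children_eq_map_extensions {n m : ℕ} {α β : ℕ → ℕ → F} (p : List ℕ) :
    children n (fun p => ProgPasses q n m α β (bitsOf p)) p =
      (extensions q n m α β (bitsOf p) 0).map fun x => x :: p := by
  unfold children extensions
  rw [List.drop_zero]
  congr 1
  refine List.filter_congr fun x _ => decide_eq_decide.2 ?_
  dsimp only
  rw [bitsOf_cons]
  simp [bitsOf]

/-- One round of the search replaces the current node by the node on top of the stack, after the
accepted extensions have been pushed. -/
def searchLoop : Prog :=
  .while (.var 6) (.seq (.assign 7 (.tl (.var 1))) (.seq (.assign 8 .nil)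
    (.seq (.assign 9 (.var 5)) (.seq childLoop (.seq (.assign 4 (.hd (.hd (.var 3))))
      (.seq (.assign 5 (.hd (.tl (.hd (.var 3))))) (.seq (.assign 6 (.tl (.tl (.hd (.var 3)))))
        (.assign 3 (.tl (.var 3))))))))))

/-- The loop is analysed for any invariant `J` that guarantees a next node and any measure `size`
that decreases in each round. -/
theorem wp_searchLoop {n m : ℕ} {α β : ℕ → ℕ → F} {J : List ℕ → List (List ℕ) → Prop}
    {size : List ℕ → List (List ℕ) → ℕ}
    (hJ : ∀ cur stack, J cur stack → cur.length < n → ∃ cur' stack',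
      children n (fun p => ProgPasses q n m α β (bitsOf p)) cur ++ stack = cur' :: stack' ∧
      J cur' stack' ∧ size cur' stack' < size cur stack)
    {s : State F} {cur : List ℕ} {stack : List (List ℕ)} (h : J cur stack)
    (h1 : s.store 1 = .num n) (h2 : s.store 2 = pairsVal n m α β)
    (h3 : s.store 3 = .ofList (stack.map (nodeVal n))) (h4 : s.store 4 = seqVal cur)
    (h5 : s.store 5 = bitsVal n (bitsOf cur)) (h6 : s.store 6 = .num (n - cur.length)) :
    WP q ρ searchLoop s fun s' t =>
      t ≤ size cur stack * (n * (testTime n m + 2) + 42) + 2 ∧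
      ∃ cur stack, J cur stack ∧ n ≤ cur.length ∧ s'.store 4 = seqVal cur := by
  refine (WP.while_variant (B := n * (testTime n m + 2) + 40) (fun k s' => ∃ cur stack,
    size cur stack = k ∧ J cur stack ∧ s'.store 1 = .num n ∧ s'.store 2 = pairsVal n m α β ∧
    s'.store 3 = .ofList (stack.map (nodeVal n)) ∧ s'.store 4 = seqVal cur ∧
    s'.store 5 = bitsVal n (bitsOf cur) ∧ s'.store 6 = .num (n - cur.length)) ?_
    ⟨cur, stack, rfl, h, h1, h2, h3, h4, h5, h6⟩).mono ?_
  · rintro k s' ⟨cur, stack, rfl, h, h1, h2, h3, h4, h5, h6⟩ he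
    have hcur : cur.length < n := by
      by_contra hcur
      rw [Nat.sub_eq_zero_of_le (not_lt.1 hcur)] at h6
      simp [Expr.eval, h6] at he
    obtain ⟨cur', stack', heq, hJ', hlt⟩ := hJ cur stack h hcur
    refine ⟨_, hlt, WP.seq (WP.assign (WP.seq (WP.assign (WP.seq (WP.assign (WP.seq
      ((wp_childLoop (n := n) (m := m) (b := bitsOf cur) (α := α) (β := β) (seqV := seqVal cur)
        (remV := .num (n - cur.length)) (L := stack.map (nodeVal n))
        ?_ ?_ ?_ ?_ ?_ ?_ ?_).mono ?_)))))))⟩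
    · simp [State.set_store_of_ne, h2]
    · simp [State.set_store_of_ne, h3]
    · simp [State.set_store_of_ne, h4]
    · simp [State.set_store_of_ne, h6]
    · obtain ⟨n', rfl⟩ : ∃ n', n = n' + 1 := ⟨n - 1, by omega⟩
      simp [Expr.eval, State.set_store_of_ne, h1, Val.num_succ]
    · simp [Expr.eval, State.set_store_of_ne]
    · simp [Expr.eval, State.set_store_of_ne, h5]
    rintro s₁ t₁ ⟨ht₁, h3₁, h1₁, h2₁⟩
    have hstack : s₁.store 3 = .ofList ((cur' :: stack').map (nodeVal n)) := by
      rw [h3₁, ← heq, List.map_append]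
      congr 2
      rw [children_eq_map_extensions, List.map_map]
      refine List.map_congr_left fun x _ => ?_
      simp only [Function.comp, nodeVal, bitsOf_cons, seqVal, List.map_cons, Val.ofList_cons,
        List.length_cons]
      obtain ⟨m', hm'⟩ : ∃ m', n - cur.length = m' + 1 := ⟨n - cur.length - 1, by omega⟩
      rw [hm', show n - (cur.length + 1) = m' by omega]
      rfl
    refine WP.seq (WP.assign (WP.seq (WP.assign (WP.seq (WP.assign (WP.assign
      ⟨?_, cur', stack', rfl, hJ', ?_, ?_, ?_, ?_, ?_, ?_⟩))))))
    · simp only [Expr.cost]; omega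
    · simp [State.set_store_of_ne, h1₁, h1]
    · simp [State.set_store_of_ne, h2₁, h2]
    · simp [Expr.eval, State.set_store_of_ne, hstack]
    · simp [Expr.eval, State.set_store_of_ne, hstack, nodeVal]
    · simp [Expr.eval, State.set_store_of_ne, hstack, nodeVal]
    · simp [Expr.eval, State.set_store_of_ne, hstack, nodeVal]
  · rintro s' t ⟨ht, ⟨_, cur', stack', _, hJ', _, _, _, h4, _, h6⟩, he⟩
    refine ⟨ht, cur', stack', hJ', ?_, h4⟩
    by_contra hlt
    obtain ⟨m', hm'⟩ : ∃ m', n - cur'.length = m' + 1 := ⟨n - cur'.length - 1, by omega⟩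
    simp [Expr.eval, h6, hm', Val.num_succ] at he

/-- The order finding algorithm: it draws the points, searches from the empty sequence, and
returns the sequence found. The variable `1` holds `n`, `2` the points, `3` the stack, and `4`, `5`
and `6` the sequence, the set and the number of missing variables of the current node. The numeral
`n`, a list of `n` entries `nil`, also serves as the empty set of variables. -/
def orderFinder : Prog :=
  .seq (.assign 1 (.hd (.var 0))) (.seq (.assign 12 (.cons .nil (.hd (.tl (.tl (.var 0))))))
    (.seq (.assign 2 .nil) (.seq sampleLoop (.seq (.assign 3 .nil) (.seq (.assign 4 .nil)
      (.seq (.assign 5 (.var 1)) (.seq (.assign 6 (.var 1)) (.seq searchLoop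
        (.assign 0 (.var 4))))))))))

theorem wp_orderFinder {n d w : ℕ} {J : List ℕ → List (List ℕ) → Prop}
    {size : List ℕ → List (List ℕ) → ℕ}
    (hJ : ∀ cur stack, J cur stack → cur.length < n → ∃ cur' stack',
      children n (fun p => ProgPasses q n (w + 1) (fun i x => ρ (2 * (n * i + x)))
        (fun i x => ρ (2 * (n * i + x) + 1)) (bitsOf p)) cur ++ stack = cur' :: stack' ∧
      J cur' stack' ∧ size cur' stack' < size cur stack) (h : J [] []) :
    WP q ρ orderFinder (initial F n d w) fun s' t =>
      t ≤ size [] [] * (n * (testTime n (w + 1) + 2) + 42) + (w + 1) * (n * 14 + 20) + 50 ∧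
      ∃ cur stack, J cur stack ∧ n ≤ cur.length ∧ s'.store 0 = seqVal cur := by
  have h0 : (initial F n d w).store 0 = .ofList [.num n, .num d, .num w] := by simp [initial]
  refine WP.seq (WP.assign (WP.seq (WP.assign (WP.seq (WP.assign (WP.seq
    ((wp_sampleLoop (n := n) (m := w + 1) ?_ ?_ ?_ ?_).mono ?_)))))))
  · simp [Expr.eval, State.set_store_of_ne, h0]
  · simp [Expr.eval, State.set_store_of_ne, h0, Val.num_succ]
  · simp [Expr.eval]
  · rfl
  rintro s₁ t₁ ⟨ht₁, h1, h2⟩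
  refine WP.seq (WP.assign (WP.seq (WP.assign (WP.seq (WP.assign (WP.seq (WP.assign (WP.seq
    ((wp_searchLoop hJ h ?_ ?_ ?_ ?_ ?_ ?_).mono ?_)))))))))
  · simp [State.set_store_of_ne, h1]
  · simp [State.set_store_of_ne, h2]
  · simp [Expr.eval, State.set_store_of_ne]
  · simp [Expr.eval, State.set_store_of_ne, seqVal]
  · have hbits : bitsOf [] = fun _ => false := by ext; simp [bitsOf]
    have : bitsVal n (bitsOf []) = (Val.num n : Val F) := by
      rw [hbits, bitsVal, down_const]; rfl
    rw [this]
    simp [Expr.eval, State.set_store_of_ne, h1]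
  · simp [Expr.eval, State.set_store_of_ne, h1]
  rintro s₂ t₂ ⟨ht₂, cur, stack, hJ', hlen, h4⟩
  refine WP.assign ⟨?_, cur, stack, hJ', hlen, ?_⟩
  · simp only [Expr.cost]; omega
  · simp [Expr.eval, h4]

end Program

/-! ### Correctness -/

section Correctness

variable {F : Type u} [Field F] {n d w : ℕ}

/-- The variables whose numbers occur in a sequence. -/
def memSet (n : ℕ) (p : List ℕ) : Finset (Fin n) := Finset.univ.filter fun x => (x : ℕ) ∈ p

theorem mem_memSet {p : List ℕ} {x : Fin n} : x ∈ memSet n p ↔ (x : ℕ) ∈ p := by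
  simp [memSet]

theorem memSet_cons (x : Fin n) (p : List ℕ) : memSet n (x :: p) = insert x (memSet n p) := by
  ext y
  simp [mem_memSet, Fin.ext_iff]

theorem Admissible.card_memSet {pass : List ℕ → Prop} {p : List ℕ} (h : Admissible n pass p) :
    (memSet n p).card = p.length := by
  induction p with
  | nil => simp [memSet]
  | cons x p ih =>
    have hx : ((⟨x, h.1⟩ : Fin n) : ℕ) = x := rfl
    rw [← hx, memSet_cons, Finset.card_insert_of_notMem (by simpa [mem_memSet] using h.2.1),
      ih h.2.2.2, List.length_cons]

/-- The set tested by the program is tested as in `Passes`. -/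
theorem progPasses_blackBox_iff (f : MvPolynomial (Fin n) F) (ρ : ℕ → F) (p : List ℕ) :
    ProgPasses (blackBox f) n (w + 1) (fun i x => ρ (2 * (n * i + x)))
      (fun i x => ρ (2 * (n * i + x) + 1)) (bitsOf p) ↔ Passes w f ρ (memSet n p) := by
  unfold ProgPasses Passes
  have : (fun i j => blackBox f (pointVal n (bitsOf p) (fun x => ρ (2 * (n * i + x)))
      fun x => ρ (2 * (n * j + x) + 1))) = testMatrix f ρ (memSet n p) := by
    ext i j
    unfold blackBox testMatrix
    congr 2
    ext x
    rw [pointVal, Val.entry_ofList]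
    by_cases hx : (x : ℕ) ∈ p
    · rw [Finset.piecewise_eq_of_mem _ _ _ (mem_memSet.2 hx)]
      simp [up, bitsOf, hx, innerPoint]
    · rw [Finset.piecewise_eq_of_notMem _ _ _ (fun h => hx (mem_memSet.1 h))]
      simp [up, bitsOf, hx, outerPoint]
  rw [this]

/-- Beyond the sizes for which all partitions have low rank, a set of low rank is a prefix or a
suffix of the order and can be extended by the next variable. -/
theorem LowRankPartition.exists_insert {σ : Equiv.Perm (Fin n)} {T : Finset (Fin n)}
    (h : LowRankPartition d w σ T) (hlog : Nat.log (d + 1) w < T.card) (hT : T.card < n) :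
    ∃ x ∉ T, LowRankPartition d w σ (insert x T) := by
  obtain ⟨x₀, hx₀⟩ : ∃ x, x ∉ T := by
    by_contra! hall
    rw [Finset.eq_univ_iff_forall.2 hall] at hT
    simp at hT
  rcases h with h | h | ⟨j, rfl⟩ | ⟨j, h⟩ | h
  · omega
  · refine ⟨x₀, hx₀, Or.inr (Or.inl (le_trans (Finset.card_le_card ?_) h))⟩
    exact Finset.compl_subset_compl.2 (Finset.subset_insert _ _)
  · have hj : j < n := by
      have := (σ.symm x₀).2
      simp only [mem_prefixSet] at hx₀
      omega
    refine ⟨σ ⟨j, hj⟩, by simp [mem_prefixSet], Or.inr (Or.inr (Or.inl ⟨j + 1, ?_⟩))⟩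
    exact (prefixSet_succ σ ⟨j, hj⟩).symm
  · obtain ⟨i, hij, hi⟩ : ∃ i : Fin n, Tᶜ = prefixSet σ (i + 1) ∧ (i : ℕ) < j := by
      have hx : x₀ ∈ prefixSet σ j := h ▸ Finset.mem_compl.2 hx₀
      rw [mem_prefixSet] at hx
      have hn : 0 < n := x₀.pos
      refine ⟨⟨min j n - 1, by omega⟩, ?_, by simp only; omega⟩
      rw [h]
      ext y
      have := (σ.symm y).2
      simp only [mem_prefixSet]
      omega
    have hTi : ∀ y, y ∉ T ↔ (σ.symm y : ℕ) < i + 1 := fun y => by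
      rw [← Finset.mem_compl, hij, mem_prefixSet]
    refine ⟨σ i, (hTi _).2 (by simp), Or.inr (Or.inr (Or.inr (Or.inl ⟨i, ?_⟩)))⟩
    ext y
    rw [Finset.mem_compl, Finset.mem_insert, not_or, hTi, mem_prefixSet, ← Equiv.symm_apply_eq,
      Fin.ext_iff]
    omega
  · exact ⟨x₀, hx₀, Or.inr (Or.inr (Or.inr (Or.inr h)))⟩

theorem mem_down {α : Type*} {g : ℕ → α} {m : ℕ} {x : α} :
    x ∈ down g m ↔ ∃ i < m, g i = x := by
  induction m with
  | zero => simp [down]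
  | succ m ih =>
    rw [down, List.mem_cons, ih]
    constructor
    · rintro (rfl | ⟨i, hi, rfl⟩)
      · exact ⟨m, by omega, rfl⟩
      · exact ⟨i, by omega, rfl⟩
    · rintro ⟨i, hi, rfl⟩
      rcases Nat.lt_succ_iff_lt_or_eq.1 hi with h | rfl
      · exact Or.inr ⟨i, h, rfl⟩
      · exact Or.inl rfl

/-- The hidden order, last variable first. -/
def hiddenOrder (σ : Equiv.Perm (Fin n)) (j : ℕ) : List ℕ :=
  down (fun i => if h : i < n then (σ ⟨i, h⟩ : ℕ) else 0) j

theorem mem_hiddenOrder {σ : Equiv.Perm (Fin n)} {j : ℕ} (hj : j ≤ n) (x : Fin n) :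
    (x : ℕ) ∈ hiddenOrder σ j ↔ (σ.symm x : ℕ) < j := by
  rw [hiddenOrder, mem_down]
  constructor
  · rintro ⟨i, hi, h⟩
    rw [dif_pos (by omega)] at h
    rw [← Fin.ext h]
    simpa using hi
  · intro h
    exact ⟨σ.symm x, h, by simp⟩

theorem admissible_hiddenOrder {σ : Equiv.Perm (Fin n)} {pass : List ℕ → Prop}
    (hpass : ∀ p, (∃ j, memSet n p = prefixSet σ j) → pass p) :
    ∀ {j : ℕ}, j ≤ n → Admissible n pass (hiddenOrder σ j)
  | 0, _ => trivial
  | j + 1, hj => by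
    have hg : (fun i => if h : i < n then (σ ⟨i, h⟩ : ℕ) else 0) j = σ ⟨j, hj⟩ := dif_pos hj
    refine ⟨?_, ?_, ?_, admissible_hiddenOrder hpass (by omega)⟩
    · rw [hg]; exact Fin.is_lt _
    · change _ ∉ hiddenOrder σ j
      rw [hg, mem_hiddenOrder (by omega)]
      simp
    · refine hpass _ ⟨j + 1, ?_⟩
      ext x
      rw [mem_memSet, mem_prefixSet]
      exact mem_hiddenOrder hj x

/-- The permutation listed by a sequence of length `n`. The sequence begins with the variable chosen
last, so that the prefixes of the permutation are the complements of the sets built. -/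
theorem Admissible.exists_perm {F : Type u} {pass : List ℕ → Prop} {p : List ℕ}
    (h : Admissible n pass p) (hp : p.length = n) :
    ∃ τ : Equiv.Perm (Fin n), (seqVal p : Val F) = .ofPerm τ ∧
      ∀ j, prefixSet τ j = (memSet n (p.drop j))ᶜ := by
  let g : Fin n → Fin n := fun i => ⟨p[(i : ℕ)], h.lt _ (List.getElem_mem _)⟩
  have hg : Function.Injective g := fun i j hij => by
    rw [Fin.ext_iff] at hij
    exact Fin.ext ((h.nodup.getElem_inj_iff).1 hij)
  refine ⟨Equiv.ofBijective g (Finite.injective_iff_bijective.1 hg), ?_, fun j => ?_⟩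
  · unfold seqVal Val.ofPerm
    congr 1
    refine List.ext_getElem (by simp [hp]) fun i hi _ => ?_
    simp [g]
  · set τ := Equiv.ofBijective g (Finite.injective_iff_bijective.1 hg)
    ext x
    obtain ⟨i, rfl⟩ := τ.surjective x
    rw [mem_prefixSet, Equiv.symm_apply_apply, Finset.mem_compl, mem_memSet, ← not_le, not_iff_not]
    change j ≤ i ↔ p[(i : ℕ)] ∈ p.drop j
    rw [List.mem_drop_iff_getElem]
    constructor
    · intro hij
      exact ⟨i - j, by have := i.2; omega, by congr 1; omega⟩
    · rintro ⟨i', hi', heq⟩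
      have := (h.nodup.getElem_inj_iff).1 heq
      omega

/-- A bound for the running time of the program. -/
def totalTime (n d w : ℕ) : ℕ :=
  (subtreeBound n (Nat.log (d + 1) w + 1) 0 + n) * (n * (testTime n (w + 1) + 2) + 42) +
    (w + 1) * (n * 14 + 20) + 50

/-- Whenever the test is sound, it accepts exactly the partitions of low rank, and the search finds
an order. -/
theorem exists_outputs_of_testSound (hn : 0 < n) (hw : 0 < w) {σ : Equiv.Perm (Fin n)}
    {A : Fin n × Fin (d + 1) × Fin w × Fin w → F} {ρ : ℕ → F} {s : Fin (d + 1) → F}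
    (hs : Function.Injective s) (hsound : TestSound hw σ A ρ) :
    ∃ (τ : Equiv.Perm (Fin n)) (t : ℕ), Outputs orderFinder d w (matPoly hw σ A) ρ τ t ∧
      HasROABP d w τ (matPoly hw σ A) ∧ t ≤ totalTime n d w := by
  set f := matPoly hw σ A
  let pass : List ℕ → Prop := fun p =>
    ProgPasses (blackBox f) n (w + 1) (fun i x => ρ (2 * (n * i + x)))
      (fun i x => ρ (2 * (n * i + x) + 1)) (bitsOf p)
  have hpass : ∀ p, pass p ↔ LowRankPartition d w σ (memSet n p) := fun p =>
    (progPasses_blackBox_iff f ρ p).trans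
      ⟨fun h => hsound _ h, fun h => (h.sepRankLE hs hw A).passes ρ⟩
  have hgoal : Admissible n pass (hiddenOrder σ n) :=
    admissible_hiddenOrder (fun p hp => (hpass p).2 (Or.inr (Or.inr (Or.inl hp)))) le_rfl
  have hext : ∀ p, Admissible n pass p → Nat.log (d + 1) w + 1 ≤ p.length → p.length < n →
      ∃ x < n, x ∉ p ∧ pass (x :: p) := by
    intro p hp hK hlt
    have hlow := (hpass p).1 (hp.pass_of_suffix List.suffix_rfl fun h => by simp [h] at hK)
    rw [← hp.card_memSet] at hK hlt
    obtain ⟨x, hx, hxT⟩ := hlow.exists_insert hK hlt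
    exact ⟨x, x.2, fun h => hx (mem_memSet.2 h), (hpass _).2 (by rwa [memSet_cons])⟩
  obtain ⟨s', t, hex, ht, cur, stack, hinv, hlen, h0⟩ := wp_orderFinder (q := blackBox f) (ρ := ρ)
    (d := d) (J := SearchInv n pass (hiddenOrder σ n))
    (size := roundsBound n (Nat.log (d + 1) w + 1))
    (fun cur stack h hcur => h.step hgoal (length_down _ _) hext hcur)
    ⟨by simp [Admissible], [], by simp, List.nil_suffix⟩
  have hadm := hinv.1 cur (by simp)
  obtain ⟨τ, hτ, hpre⟩ := hadm.exists_perm (F := F) (le_antisymm hadm.length_le hlen)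
  refine ⟨τ, t, ⟨s', hex, by rw [h0, hτ]⟩,
    hasROABP_of_sepRankLE hn hw (degreeOf_matPoly_le hw σ A) hs τ fun j => ?_, ?_⟩
  · rw [hpre]
    refine LowRankPartition.sepRankLE hs (LowRankPartition.compl ?_) hw A
    by_cases hj : cur.drop j = []
    · exact Or.inl (by simp [hj, memSet])
    · exact (hpass _).1 (hadm.pass_of_suffix (List.drop_suffix j cur) hj)
  · refine ht.trans_eq ?_
    simp [totalTime, roundsBound, workBound]

end Correctness

/-! ### The running time -/

section Time

theorem testTime_le {n m : ℕ} (hn : 0 < n) (hm : 0 < m) : testTime n m ≤ 400 * (n * m ^ 3) := by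
  have h1 : 1 ≤ n := hn
  have h2 : 1 ≤ m := hm
  have e1 : m ≤ m ^ 3 := Nat.le_self_pow (by norm_num) m
  have e2 : m ^ 2 ≤ m ^ 3 := Nat.pow_le_pow_right hm (by norm_num)
  have e3 : m ^ 3 ≤ n * m ^ 3 := Nat.le_mul_of_pos_left _ hn
  have e4 : n * m ^ 2 ≤ n * m ^ 3 := Nat.mul_le_mul_left n e2
  have e5 : n ≤ n * m ^ 3 := Nat.le_mul_of_pos_right _ (by positivity)
  unfold testTime
  ring_nf at *
  omega

theorem totalTime_le {n d w : ℕ} (hn : 2 ≤ n) (hw : 0 < w) :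
    totalTime n d w ≤ 9000 * (n ^ (3 * (Nat.log (d + 1) w + 1)) * w ^ 3) := by
  set K := Nat.log (d + 1) w + 1 with hK
  have hnK : n ≤ n ^ K := Nat.le_self_pow (by omega) n
  have h1 : subtreeBound n K 0 + n ≤ 2 * n ^ K := by
    have := subtreeBound_zero_le hn K
    omega
  have hX : 1 ≤ n ^ 2 * (w + 1) ^ 3 := Nat.one_le_iff_ne_zero.2 (by positivity)
  have hn2 : n ≤ n ^ 2 * (w + 1) ^ 3 :=
    (Nat.le_self_pow (by norm_num) n).trans (Nat.le_mul_of_pos_right _ (by positivity))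
  have h2 : n * (testTime n (w + 1) + 2) + 42 ≤ 444 * (n ^ 2 * (w + 1) ^ 3) := by
    have := Nat.mul_le_mul_left n (testTime_le (n := n) (m := w + 1) (by omega) (by omega))
    have e : n * (400 * (n * (w + 1) ^ 3)) = 400 * (n ^ 2 * (w + 1) ^ 3) := by ring
    rw [e] at this
    rw [mul_add]
    omega
  have h3 : (w + 1) * (n * 14 + 20) + 50 ≤ 84 * (n ^ 2 * (w + 1) ^ 3) := by
    have e1 : w + 1 ≤ (w + 1) ^ 3 := Nat.le_self_pow (by norm_num) _
    have e2 : n ≤ n ^ 2 := Nat.le_self_pow (by norm_num) _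
    have e3 : n * 14 + 20 ≤ 34 * n ^ 2 := by nlinarith
    have := Nat.mul_le_mul e1 e3
    have e4 : (w + 1) ^ 3 * (34 * n ^ 2) = 34 * (n ^ 2 * (w + 1) ^ 3) := by ring
    omega
  have h4 : (w + 1) ^ 3 ≤ 8 * w ^ 3 := by
    calc (w + 1) ^ 3 ≤ (2 * w) ^ 3 := Nat.pow_le_pow_left (by omega) 3
      _ = 8 * w ^ 3 := by ring
  have h5 : 1 ≤ n ^ K := Nat.one_le_iff_ne_zero.2 (by positivity)
  calc totalTime n d w ≤ 2 * n ^ K * (444 * (n ^ 2 * (w + 1) ^ 3)) +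
        84 * (n ^ 2 * (w + 1) ^ 3) := by
        unfold totalTime
        rw [← hK, add_assoc]
        exact Nat.add_le_add (Nat.mul_le_mul h1 h2) h3
    _ ≤ 2 * n ^ K * (444 * (n ^ 2 * (w + 1) ^ 3)) +
        n ^ K * (84 * (n ^ 2 * (w + 1) ^ 3)) := by
        exact Nat.add_le_add_left (Nat.le_mul_of_pos_left _ (by omega)) _
    _ = 972 * (n ^ (K + 2) * (w + 1) ^ 3) := by ring
    _ ≤ 972 * (n ^ (3 * K) * (8 * w ^ 3)) := by
        exact Nat.mul_le_mul_left _
          (Nat.mul_le_mul (Nat.pow_le_pow_right (by omega) (by omega)) h4)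
    _ = 7776 * (n ^ (3 * K) * w ^ 3) := by ring
    _ ≤ _ := Nat.mul_le_mul_right _ (by norm_num)

theorem totalTime_le_rpow {n d w C : ℕ} (hC : 9000 ≤ C) (hn : 2 ≤ n) (hd : 0 < d) (hw : 0 < w) :
    (totalTime n d w : ℝ) ≤ C *
      (n : ℝ) ^ ((C : ℝ) * (1 + Real.logb ((d : ℝ) + 1) (w : ℝ))) *
        ((d : ℝ) * (w : ℝ)) ^ C := by
  have h := totalTime_le (d := d) hn hw
  have hlog : ((Nat.log (d + 1) w + 1 : ℕ) : ℝ) ≤ 1 + Real.logb ((d : ℝ) + 1) w := by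
    have := Real.natLog_le_logb w (d + 1)
    push_cast at this ⊢
    linarith
  have h1 : ((n ^ (3 * (Nat.log (d + 1) w + 1)) : ℕ) : ℝ) ≤
      (n : ℝ) ^ ((C : ℝ) * (1 + Real.logb ((d : ℝ) + 1) (w : ℝ))) := by
    rw [Nat.cast_pow, ← Real.rpow_natCast]
    refine Real.rpow_le_rpow_of_exponent_le (by exact_mod_cast (by omega : 1 ≤ n)) ?_
    rw [Nat.cast_mul]
    refine mul_le_mul (by exact_mod_cast (by omega : 3 ≤ C)) hlog (by positivity) (by positivity)
  have h2 : ((w ^ 3 : ℕ) : ℝ) ≤ ((d : ℝ) * (w : ℝ)) ^ C := by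
    have : w ^ 3 ≤ (d * w) ^ C :=
      (Nat.pow_le_pow_left (Nat.le_mul_of_pos_left w hd) 3).trans
        (Nat.pow_le_pow_right (Nat.mul_pos hd hw) (by omega))
    exact_mod_cast this
  calc (totalTime n d w : ℝ) ≤
        ((9000 * (n ^ (3 * (Nat.log (d + 1) w + 1)) * w ^ 3) : ℕ) : ℝ) := by exact_mod_cast h
    _ = (9000 : ℕ) * ((n ^ (3 * (Nat.log (d + 1) w + 1)) : ℕ) : ℝ) * ((w ^ 3 : ℕ) : ℝ) := by
        push_cast; ring
    _ ≤ _ := by gcongr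

end Time

end OrderFinding

theorem mainTheorem5 :
    ∃ (R : OrderFinding.Prog) (C : ℕ),
      ∀ (F : Type u) [Field F] (S : Finset F) (hS : S.Nonempty) (n d w : ℕ)
        (_hn : 0 < n) (_hd : 0 < d) (hw : 0 < w) (σ : Equiv.Perm (Fin n)),
        2 ^ (2 * n + 1) * (n * d * w ^ 2) ≤ S.card →
        3 * Real.logb ((d : ℝ) + 1) (w : ℝ) ≤ (n : ℝ) →
        1 - 1 / (2 : ℝ) ^ (n - 1) ≤
          (OrderFinding.law S hS n d w).real
            {ω | ∃ (τ : Equiv.Perm (Fin n)) (t : ℕ),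
              OrderFinding.Outputs R d w (OrderFinding.randomPoly hw σ ω.1)
                (fun i => (ω.2 i).1) τ t ∧
              OrderFinding.HasROABP d w τ (OrderFinding.randomPoly hw σ ω.1) ∧
              (t : ℝ) ≤ C * (n : ℝ) ^ ((C : ℝ) * (1 + Real.logb ((d : ℝ) + 1) (w : ℝ))) *
                ((d : ℝ) * (w : ℝ)) ^ C} := by
  refine ⟨OrderFinding.orderFinder, 9000, fun F _ S hS n d w hn hd hw σ hcard _ => ?_⟩
  rcases Nat.lt_or_ge n 2 with hn2 | hn2
  · -- For a single variable the asserted probability is zero.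
    obtain rfl : n = 1 := by omega
    simp
  -- The sample set is large enough to contain `d + 1` interpolation nodes.
  have hdS : d + 1 ≤ S.card := by
    have h1 : 2 ≤ 2 ^ (2 * n + 1) := Nat.le_self_pow (by omega) 2
    have h2 : d ≤ n * d * w ^ 2 :=
      (Nat.le_mul_of_pos_left d hn).trans (Nat.le_mul_of_pos_right _ (by positivity))
    have := Nat.mul_le_mul h1 h2
    omega
  obtain ⟨e⟩ : Nonempty (Fin (d + 1) ↪ S) :=
    Function.Embedding.nonempty_of_card_le (by simpa using hdS)
  have hs : Function.Injective fun i => (e i : F) :=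
    Subtype.val_injective.comp e.injective
  have : MeasureTheory.IsProbabilityMeasure (OrderFinding.law S hS n d w) := by
    unfold OrderFinding.law; infer_instance
  refine (OrderFinding.le_law_testSound hS hn hd hw σ hcard hs).trans
    (MeasureTheory.measureReal_mono fun ω hω => ?_)
  obtain ⟨τ, t, hout, hroabp, ht⟩ :=
    OrderFinding.exists_outputs_of_testSound hn hw hs hω
  exact ⟨τ, t, hout, hroabp,
    (Nat.cast_le.2 ht).trans (OrderFinding.totalTime_le_rpow le_rfl hn2 hd hw)⟩
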